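/- Let $\gamma\colon S^1=\mathbb{R}/\mathbb{Z}\to\mathbb{R}^2$ be a simple (injective) closed curve that is regular and $C^3$ (continuous first, second and third derivatives, with $\gamma'$ nowhere zero). Let $C(y)=\gamma(y)+\kappa(y)^{-1}n(y)$ be the center of curvature at a point with signed curvature $\kappa(y)\neq 0$ and left unit normal $n(y)$; the curve $y\mapsto C(y)$ is the evolute. Assume that $\gamma$ is generic, i.e. that it meets its evolute only transversely and away from the cusps of the evolute: whenever $\kappa(y)\ne 0$ and $\gamma(x)=C(y)$, the vectors $\gamma'(x)$ and $C'(y)$ are linearly independent. A configuration is a pair $(x,y)\in S^1\times S^1$, with the human at $\gamma(x)$ and the puppy at $\gamma(y)$; put $D(x,y)=|\gamma(x)-\gamma(y)|$. The puppy wants to run forward (resp. backward) at $(x,y)$ if $D(x,y+\varepsilon)<D(x,y)$ (resp. $D(x,y-\varepsilon)<D(x,y)$) for all sufficiently small $\varepsilon>0$; if neither holds, $(x,y)$ is stable. In a configuration that is not stable the human stands still and the puppy runs in a direction in which it wants to run (an arbitrary one if it wants both), until it first reaches a point where it no longer wants to run in that direction. In a stable configuration the human may walk along the track in either direction, at bounded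 speed and for a finite time; the puppy moves continuously so as to keep the configuration stable, until it is forced to run again. The human catches the puppy when a configuration with $\gamma(x)=\gamma(y)$ is reached. Then from every starting configuration $(x,y)$ the human can catch the puppy after finitely many such walks and runs, in finite time, whatever directions the puppy chooses. -/

import Mathlib

open Set Filter Topology

/-- The Euclidean plane. -/
abbrev Plane : Type := EuclideanSpace ℝ (Fin 2)

noncomputable section

namespace Puppy

/-- A regular simple closed curve of class `C^3`. The circle is `ℝ / ℤ`, so the curve is a
`1`-periodic map on `ℝ` that is injective modulo the period. -/
structure IsTrack (γ : ℝ → Plane) : Prop where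
  periodic : Function.Periodic γ 1
  contDiff : ContDiff ℝ 3 γ
  regular : ∀ t, deriv γ t ≠ 0
  simple : ∀ s t, γ s = γ t → ∃ n : ℤ, t = s + n

/-- Counterclockwise rotation by a right angle. -/
def rot (v : Plane) : Plane := !₂[-v 1, v 0]

/-- The unit normal, to the left of the direction of travel. -/
def unitNormal (γ : ℝ → Plane) (t : ℝ) : Plane :=
  ‖deriv γ t‖⁻¹ • rot (deriv γ t)

/-- The signed curvature `det (γ', γ'') / |γ'|^3`. -/
def curvature (γ : ℝ → Plane) (t : ℝ) : ℝ :=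
  (deriv γ t 0 * deriv (deriv γ) t 1 - deriv γ t 1 * deriv (deriv γ) t 0) / ‖deriv γ t‖ ^ 3

/-- The center of curvature at parameter `t`, meaningful where the curvature is nonzero.
The evolute is the curve `t ↦ centerOfCurvature γ t` on that set of parameters. -/
def centerOfCurvature (γ : ℝ → Plane) (t : ℝ) : Plane :=
  γ t + (curvature γ t)⁻¹ • unitNormal γ t

/-- The curve meets its evolute only transversely and away from the cusps of the evolute:
where `γ x` is the center of curvature at `y`, the velocity of the curve at `x` and the velocity
of the evolute at `y` are linearly independent (so neither of them vanishes). -/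
def TransverseToEvolute (γ : ℝ → Plane) : Prop :=
  ∀ x y : ℝ, curvature γ y ≠ 0 → γ x = centerOfCurvature γ y →
    LinearIndependent ℝ ![deriv γ x, deriv (centerOfCurvature γ) y]

/-- With the human at `γ x` and the puppy at `γ y`, running forward brings the puppy closer. -/
def WantsForward (γ : ℝ → Plane) (x y : ℝ) : Prop :=
  ∀ᶠ ε in 𝓝[>] (0 : ℝ), dist (γ x) (γ (y + ε)) < dist (γ x) (γ y)

/-- With the human at `γ x` and the puppy at `γ y`, running backward brings the puppy closer. -/
def WantsBackward (γ : ℝ → Plane) (x y : ℝ) : Prop :=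
  ∀ᶠ ε in 𝓝[>] (0 : ℝ), dist (γ x) (γ (y - ε)) < dist (γ x) (γ y)

/-- The configuration is stable: the puppy does not move until the human does. -/
def Stable (γ : ℝ → Plane) (x y : ℝ) : Prop :=
  ¬ WantsForward γ x y ∧ ¬ WantsBackward γ x y

/-- With the human standing at `γ x`, the puppy can run from `γ y` to `γ y'`: it runs in one
direction as long as this brings it closer to the human, and stops at `y'`, the first place where
this is no longer so. Where both directions are possible at the start, the puppy may take either. -/
def Runs (γ : ℝ → Plane) (x y y' : ℝ) : Prop :=
  (y < y' ∧ (∀ z ∈ Ico y y', WantsForward γ x z) ∧ ¬ WantsForward γ x y') ∨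
  (y' < y ∧ (∀ z ∈ Ioc y' y, WantsBackward γ x z) ∧ ¬ WantsBackward γ x y')

/-- While the human walks along `x` during the time interval `[0, T]`, the puppy, starting at
`y₀`, moves continuously along `y` and keeps the configuration stable before time `T`. At time `T`
it need not be stable: that may be the moment at which the puppy is forced to run again. -/
structure Follows (γ : ℝ → Plane) (T : ℝ) (x : ℝ → ℝ) (y₀ : ℝ) (y : ℝ → ℝ) : Prop where
  start : y 0 = y₀
  continuousOn : ContinuousOn y (Icc 0 T)
  stable : ∀ t ∈ Ico 0 T, Stable γ (x t) (y t)

/-- From the configuration with the human at `γ x` and the puppy at `γ y`, the human can catch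
the puppy by finitely many moves, whatever the puppy does within its rules. -/
inductive CanCatch (γ : ℝ → Plane) : ℝ → ℝ → Prop
  /-- The two points coincide. -/
  | caught (x y : ℝ) (h : γ x = γ y) : CanCatch γ x y
  /-- The puppy runs while the human stands still. -/
  | run (x y : ℝ) (hex : ∃ y', Runs γ x y y')
      (h : ∀ y', Runs γ x y y' → CanCatch γ x y') : CanCatch γ x y
  /-- The human walks at bounded speed for some finite time `T`, in directions of their choice,
  and the puppy follows. -/
  | walk (T : ℝ) (hT : 0 ≤ T) (x : ℝ → ℝ) (hx : LipschitzOnWith 1 x (Icc 0 T)) (y₀ : ℝ)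
      (hex : ∃ y, Follows γ T x y₀ y)
      (h : ∀ y, Follows γ T x y₀ y → CanCatch γ (x T) (y T)) : CanCatch γ (x 0) y₀

end Puppy

end

/-! Lift the configurations to the plane of parameters and let F(x, y) be half the y-derivative of
the squared distance between γ x and γ y (`pull`). A configuration is stable exactly when F = 0 and
∂F/∂y > 0. A zero is degenerate when γ x is the center of curvature at y, and transversality to the
evolute says that ∂F/∂x and ∂²F/∂y² do not vanish there (`IsTrack.generic`): the zero set merely
folds over the x-axis. So the human can walk along a stable arc up to a fold; there F has one sign
on both sides, the puppy has only one direction to run, and it lands on another stable arc.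

Suppose that some stable configuration is lost. The lost stable configurations in a strip x < y < x
+ 1 form a set L that is closed under continuation along arcs and under the jumps at folds, since
otherwise there would be a winning move; no jump leaves the strip, because passing the human is
impossible and reaching the human is a catch (`isTrap_lost`). Hence L has points over every x. Just
below its lowest points a path with F < 0 runs across a whole turn: where the lowest branch changes,
the jump segment satisfies F ≤ 0, and the path goes around its isolated zeros
(`IsTrap.exists_barrier`). By reflection there is a path with F > 0 above L.

Such a pair of barriers cannot exist (`not_opposite_barriers`). Since F > 0 just above the diagonal
y = x, the signs from the bottom upwards are +, −, +, so two disjoint continua of zeros cross the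
slab, one above the other. At a zero the human is on the normal at γ y; recording y and the signed
position ρ on that normal maps the zeros injectively to a plane, as γ is simple. The ends of the two
continua then have interleaved abscissas. If the turn starts at the point of the track farthest from
some O, the normal rays prolonged beyond that point leave the disc containing the track, so the four
ends extend upwards to a common height without hitting anything. Two disjoint continua below a line
with interleaved ends on it contradict planar topology (`not_interleaved_continua`). A generic
choice of O keeps folds away from the ends of the turn, where a barrier has no room to evade them.
-/

open Set Filter Topology

noncomputable section

namespace Puppy

/-! ### Planar topology -/

/-- A continuous nowhere vanishing function on the plane has a continuous argument. -/
theorem exists_continuous_argument {w : ℝ × ℝ → ℂ} (hw : Continuous w) (h0 : ∀ p, w p ≠ 0) :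
    ∃ θ : ℝ × ℝ → ℝ, Continuous θ ∧
      ∀ p, ∃ r > 0, (w p).re = r * Real.cos (θ p) ∧ (w p).im = r * Real.sin (θ p) := by
  obtain ⟨f, ⟨-, hf⟩, -⟩ := Complex.isCoveringMapOn_exp.existsUnique_continuousMap_lifts
    (A := ℝ × ℝ) ⟨w, hw⟩ (a₀ := (0, 0)) (Complex.exp_log (h0 (0, 0))) (fun p => h0 p)
  refine ⟨fun p => (f p).im, by fun_prop, fun p => ⟨Real.exp (f p).re, Real.exp_pos _, ?_⟩⟩
  have hp : Complex.exp (f p) = w p := congrFun hf p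
  rw [← hp]
  exact ⟨Complex.exp_re _, Complex.exp_im _⟩

/-- A vector that stays in a closed half-plane cannot wind: by the intermediate value theorem an
argument leaving the window would take values just outside it, where the sine is negative. This
replaces winding numbers in the planar arguments. -/
theorem continuous_argument_window {θ : ℝ → ℝ} (hθ : Continuous θ) {α : ℝ}
    (h : ∀ t ∈ Icc (0 : ℝ) 1, 0 ≤ Real.sin (θ t - α)) {a b : ℝ} (ha : a ∈ Icc (0 : ℝ) 1)
    (hb : b ∈ Icc (0 : ℝ) 1) (hθa : θ a ∈ Icc α (α + Real.pi)) :
    θ b ∈ Icc α (α + Real.pi) := by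
  have hsub : uIcc a b ⊆ Icc 0 1 := uIcc_subset_Icc ha hb
  have hivt := intermediate_value_uIcc (hθ.continuousOn (s := uIcc a b))
  have key : ∀ v ∈ uIcc (θ a) (θ b), 0 ≤ Real.sin (v - α) := by
    intro v hv
    obtain ⟨t, ht, rfl⟩ := hivt hv
    exact h t (hsub ht)
  have hpi := Real.pi_pos
  obtain ⟨h1, h2⟩ := hθa
  constructor
  · by_contra! hlt
    have hm : max (θ b) (α - Real.pi / 2) ∈ uIcc (θ a) (θ b) := by
      rw [uIcc_of_ge (by linarith)]
      exact ⟨le_max_left _ _, max_le (by linarith) (by linarith)⟩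
    have hneg : Real.sin (max (θ b) (α - Real.pi / 2) - α) < 0 := by
      apply Real.sin_neg_of_neg_of_neg_pi_lt
      · have := max_lt hlt (show α - Real.pi / 2 < α by linarith)
        linarith
      · have := le_max_right (θ b) (α - Real.pi / 2)
        linarith
    linarith [key _ hm]
  · by_contra! hlt
    have hm : min (θ b) (α + 3 * Real.pi / 2) ∈ uIcc (θ a) (θ b) := by
      rw [uIcc_of_le (by linarith)]
      exact ⟨le_min (by linarith) (by linarith), min_le_left _ _⟩
    have hneg : Real.sin (min (θ b) (α + 3 * Real.pi / 2) - α) < 0 := by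
      rw [← Real.sin_sub_two_pi]
      apply Real.sin_neg_of_neg_of_neg_pi_lt
      · have := min_le_right (θ b) (α + 3 * Real.pi / 2)
        linarith
      · have := lt_min hlt (show α + Real.pi < α + 3 * Real.pi / 2 by linarith)
        linarith
    linarith [key _ hm]

theorem exists_int_sub_mem_Ico (θ α : ℝ) :
    ∃ k : ℤ, θ ∈ Ico (α + k * (2 * Real.pi)) (α + k * (2 * Real.pi) + 2 * Real.pi) := by
  obtain ⟨k, hk, -⟩ := existsUnique_add_zsmul_mem_Ico (show 0 < 2 * Real.pi by positivity) θ α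
  refine ⟨-k, ?_⟩
  simp only [zsmul_eq_mul, mem_Ico] at hk
  push_cast
  constructor <;> linarith [hk.1, hk.2]

/-- The Poincaré–Miranda theorem on the unit square. -/
theorem exists_zero_of_signs {φ g : ℝ × ℝ → ℝ} (hφ : Continuous φ) (hg : Continuous g)
    (hl : ∀ t ∈ Icc (0 : ℝ) 1, φ (0, t) < 0) (hr : ∀ t ∈ Icc (0 : ℝ) 1, 0 < φ (1, t))
    (hb : ∀ s ∈ Icc (0 : ℝ) 1, g (s, 0) < 0) (ht : ∀ s ∈ Icc (0 : ℝ) 1, 0 < g (s, 1)) :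
    ∃ p ∈ Icc (0 : ℝ) 1 ×ˢ Icc (0 : ℝ) 1, φ p = 0 ∧ g p = 0 := by
  -- Without a common zero, (φ, g) has a continuous argument. The sign conditions confine it to a
  -- half-plane on each edge, and following the boundary counterclockwise from (0, 0) forces it to
  -- increase by a full turn, although it returns to the same point.
  by_contra! hne
  -- Retracting the plane onto the square makes the vector field nonvanishing everywhere, so that
  -- the lifting theorem applies.
  let c : ℝ → ℝ := fun t => max 0 (min 1 t)
  have hc : ∀ t, c t ∈ Icc (0 : ℝ) 1 := fun t =>
    ⟨le_max_left _ _, max_le zero_le_one (min_le_left _ _)⟩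
  have hcid : ∀ t ∈ Icc (0 : ℝ) 1, c t = t := fun t ht => by
    simp only [c]
    rw [min_eq_right ht.2, max_eq_right ht.1]
  have hcc : Continuous c := by fun_prop
  obtain ⟨θ, hθ, hpol⟩ := exists_continuous_argument
    (w := fun p => ⟨φ (c p.1, c p.2), g (c p.1, c p.2)⟩)
    (by
      have : Continuous fun p : ℝ × ℝ =>
        ((φ (c p.1, c p.2) : ℝ) : ℂ) + ((g (c p.1, c p.2) : ℝ) : ℂ) * Complex.I := by fun_prop
      convert this using 2 with p
      exact Complex.mk_eq_add_mul_I _ _)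
    (fun p h0 => by
      have h1 := congrArg Complex.re h0
      have h2 := congrArg Complex.im h0
      exact hne (c p.1, c p.2) ⟨hc _, hc _⟩ h1 h2)
  have hcos : ∀ s ∈ Icc (0 : ℝ) 1, ∀ t ∈ Icc (0 : ℝ) 1, ∃ r > 0,
      φ (s, t) = r * Real.cos (θ (s, t)) ∧ g (s, t) = r * Real.sin (θ (s, t)) := by
    intro s hs t ht
    have := hpol (s, t)
    simpa [hcid s hs, hcid t ht] using this
  have m0 : (0 : ℝ) ∈ Icc (0 : ℝ) 1 := ⟨le_rfl, zero_le_one⟩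
  have m1 : (1 : ℝ) ∈ Icc (0 : ℝ) 1 := ⟨zero_le_one, le_rfl⟩
  have cl : ∀ t ∈ Icc (0 : ℝ) 1, Real.cos (θ (0, t)) < 0 := fun t h => by
    obtain ⟨r, hr0, h1, -⟩ := hcos 0 m0 t h
    have := hl t h
    by_contra! hn
    nlinarith
  have cr : ∀ t ∈ Icc (0 : ℝ) 1, 0 < Real.cos (θ (1, t)) := fun t h => by
    obtain ⟨r, hr0, h1, -⟩ := hcos 1 m1 t h
    have := hr t h
    by_contra! hn
    nlinarith
  have sb : ∀ t ∈ Icc (0 : ℝ) 1, Real.sin (θ (t, 0)) < 0 := fun t h => by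
    obtain ⟨r, hr0, -, h1⟩ := hcos t h 0 m0
    have := hb t h
    by_contra! hn
    nlinarith
  have st : ∀ t ∈ Icc (0 : ℝ) 1, 0 < Real.sin (θ (t, 1)) := fun t h => by
    obtain ⟨r, hr0, -, h1⟩ := hcos t h 1 m1
    have := ht t h
    by_contra! hn
    nlinarith
  have hpi := Real.pi_pos
  obtain ⟨k, hk⟩ := exists_int_sub_mem_Ico (θ (0, 0)) 0
  have shift : ∀ x y : ℝ, Real.sin (x - (y + k * (2 * Real.pi))) = Real.sin (x - y) := by
    intro x y
    rw [← sub_sub, Real.sin_sub_int_mul_two_pi]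
  have cshift : ∀ x : ℝ, Real.cos (x - k * (2 * Real.pi)) = Real.cos x :=
    fun x => Real.cos_sub_int_mul_two_pi x k
  have sshift : ∀ x : ℝ, Real.sin (x - k * (2 * Real.pi)) = Real.sin x :=
    fun x => Real.sin_sub_int_mul_two_pi x k
  set K : ℝ := k * (2 * Real.pi) with hK
  have h00 : θ (0, 0) ∈ Icc (Real.pi + K) (Real.pi + K + Real.pi) := by
    refine ⟨?_, by linarith [hk.2]⟩
    by_contra! hlt
    have h1 := sb 0 m0
    rw [← sshift] at h1
    have := Real.sin_nonneg_of_nonneg_of_le_pi (x := θ (0, 0) - K)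
      (by linarith [hk.1]) (by linarith)
    linarith
  have eb := continuous_argument_window (θ := fun s => θ (s, 0)) (by fun_prop)
    (α := Real.pi + K) (fun s hs => by
      rw [shift, Real.sin_sub_pi]; linarith [sb s hs]) m0 m1 h00
  have h10 : θ (1, 0) ∈ Icc (3 * Real.pi / 2 + K) (3 * Real.pi / 2 + K + Real.pi) := by
    refine ⟨?_, by linarith [eb.2]⟩
    by_contra! hlt
    have h1 := cr 0 m0
    rw [← cshift] at h1
    have := Real.cos_nonpos_of_pi_div_two_le_of_le (x := θ (1, 0) - K)
      (by linarith [eb.1]) (by linarith)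
    linarith
  have er := continuous_argument_window (θ := fun s => θ (1, s)) (by fun_prop)
    (α := 3 * Real.pi / 2 + K) (fun s hs => by
      rw [shift, ← Real.sin_add_two_pi,
        show θ (1, s) - 3 * Real.pi / 2 + 2 * Real.pi = θ (1, s) + Real.pi / 2 by ring,
        Real.sin_add_pi_div_two]
      exact (cr s hs).le) m0 m1 h10
  have h11 : θ (1, 1) ∈ Icc (2 * Real.pi + K) (2 * Real.pi + K + Real.pi) := by
    refine ⟨?_, by linarith [er.2]⟩
    by_contra! hlt
    have h1 := st 1 m1
    rw [← sshift, ← Real.sin_sub_two_pi] at h1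
    have := Real.sin_nonpos_of_nonpos_of_neg_pi_le (x := θ (1, 1) - K - 2 * Real.pi)
      (by linarith) (by linarith [er.1])
    linarith
  have et := continuous_argument_window (θ := fun s => θ (s, 1)) (by fun_prop)
    (α := 2 * Real.pi + K) (fun s hs => by
      rw [shift, Real.sin_sub_two_pi]; linarith [st s hs]) m1 m0 h11
  have h01 : θ (0, 1) ∈ Icc (5 * Real.pi / 2 + K) (5 * Real.pi / 2 + K + Real.pi) := by
    refine ⟨?_, by linarith [et.2]⟩
    by_contra! hlt
    have h1 := cl 1 m1
    rw [← cshift, ← Real.cos_sub_two_pi] at h1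
    have := Real.cos_nonneg_of_neg_pi_div_two_le_of_le (x := θ (0, 1) - K - 2 * Real.pi)
      (by linarith [et.1]) (by linarith)
    linarith
  have el := continuous_argument_window (θ := fun s => θ (0, s)) (by fun_prop)
    (α := 5 * Real.pi / 2 + K) (fun s hs => by
      rw [shift, ← Real.sin_add_two_pi,
        show θ (0, s) - 5 * Real.pi / 2 + 2 * Real.pi = θ (0, s) - Real.pi / 2 by ring,
        Real.sin_sub_pi_div_two]
      linarith [cl s hs]) m1 m0 h01
  linarith [el.1, h00.2]

/-- A continuous function on the unit square which is negative at the bottom and positive at the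
top vanishes on a continuum joining the left edge to the right edge. -/
theorem exists_continuum_of_zeros {g : ℝ × ℝ → ℝ} (hg : Continuous g)
    (hb : ∀ s ∈ Icc (0 : ℝ) 1, g (s, 0) < 0) (ht : ∀ s ∈ Icc (0 : ℝ) 1, 0 < g (s, 1)) :
    ∃ K ⊆ Icc (0 : ℝ) 1 ×ˢ Icc (0 : ℝ) 1, IsCompact K ∧ IsPreconnected K ∧
      (∀ p ∈ K, g p = 0) ∧ (∃ t, ((0 : ℝ), t) ∈ K) ∧ ∃ t, ((1 : ℝ), t) ∈ K := by
  set Q : Set (ℝ × ℝ) := Icc (0 : ℝ) 1 ×ˢ Icc (0 : ℝ) 1 with hQ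
  let Z : Set (ℝ × ℝ) := Q ∩ g ⁻¹' {0}
  have hZ : IsCompact Z := (isCompact_Icc.prod isCompact_Icc).inter_right
    (isClosed_singleton.preimage hg)
  have : CompactSpace Z := isCompact_iff_compactSpace.mp hZ
  let A : Set Z := {z | z.1.1 = 0}
  let B : Set Z := {z | z.1.1 = 1}
  have hA : IsClosed A := isClosed_eq (by fun_prop) (by fun_prop)
  have hB : IsClosed B := isClosed_eq (by fun_prop) (by fun_prop)
  -- If no connected component of the zero set meets both edges, a clopen set separates the two
  -- edges within it. A Urysohn function φ for this separation never equals 1/2 on the zero set,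
  -- contrary to Poincaré–Miranda applied to φ - 1/2 and g.
  by_contra hno
  push Not at hno
  have hq : Continuous ((↑) : Z → ConnectedComponents Z) := ConnectedComponents.continuous_coe
  have hA' : IsClosed (((↑) : Z → ConnectedComponents Z) '' A) :=
    (hA.isCompact.image hq).isClosed
  have hB' : IsClosed (((↑) : Z → ConnectedComponents Z) '' B) :=
    (hB.isCompact.image hq).isClosed
  have hdisj : ((↑) : Z → ConnectedComponents Z) '' A ⊆
      (((↑) : Z → ConnectedComponents Z) '' B)ᶜ := by
    rintro _ ⟨a, ha, rfl⟩ ⟨b, hb', hab⟩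
    have hbc : b ∈ connectedComponent a := ConnectedComponents.coe_eq_coe'.mp hab
    refine hno (Subtype.val '' connectedComponent a) ?_ ?_ ?_ ?_ ⟨a.1.2, a, mem_connectedComponent, ?_⟩
      b.1.2 ⟨b, hbc, ?_⟩
    · rintro _ ⟨z, -, rfl⟩
      exact z.2.1
    · exact isClosed_connectedComponent.isCompact.image continuous_subtype_val
    · exact isPreconnected_connectedComponent.image _ continuous_subtype_val.continuousOn
    · rintro _ ⟨z, -, rfl⟩
      exact z.2.2
    · exact Prod.ext ha rfl
    · exact Prod.ext hb' rfl
  obtain ⟨C, hC, hAC, hCB⟩ := exists_clopen_of_closed_subset_open hA' hB'.isOpen_compl hdisj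
  let D : Set Z := ((↑) : Z → ConnectedComponents Z) ⁻¹' C
  have hD : IsClopen D := hC.preimage hq
  have hD1 : IsCompact (Subtype.val '' D) := hD.1.isCompact.image continuous_subtype_val
  have hD2 : IsCompact (Subtype.val '' Dᶜ) :=
    hD.compl.1.isCompact.image continuous_subtype_val
  have hQl : IsClosed {p : ℝ × ℝ | p.1 = 0} := isClosed_eq (by fun_prop) (by fun_prop)
  have hQr : IsClosed {p : ℝ × ℝ | p.1 = 1} := isClosed_eq (by fun_prop) (by fun_prop)
  obtain ⟨φ, hφ0, hφ1, -⟩ := exists_continuous_zero_one_of_isClosed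
    (s := Subtype.val '' D ∪ {p : ℝ × ℝ | p.1 = 0})
    (t := Subtype.val '' Dᶜ ∪ {p : ℝ × ℝ | p.1 = 1})
    (hD1.isClosed.union hQl) (hD2.isClosed.union hQr) (by
      rw [Set.disjoint_left]
      rintro p (⟨z, hz, rfl⟩ | hp) (⟨z', hz', he⟩ | hp')
      · exact hz' (Subtype.ext he ▸ hz)
      · exact hCB hz ⟨z, hp', rfl⟩
      · subst he
        exact hz' (hAC ⟨z', hp, rfl⟩)
      · simp only [mem_ofPred_eq] at hp hp'
        linarith)
  obtain ⟨p, hpQ, hp1, hp2⟩ := exists_zero_of_signs (φ := fun p => φ p - 1 / 2) (by fun_prop) hg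
    (fun t _ => by rw [hφ0 (Or.inr rfl)]; norm_num)
    (fun t _ => by rw [hφ1 (Or.inr rfl)]; norm_num) hb ht
  have hpZ : p ∈ Z := ⟨hpQ, hp2⟩
  by_cases hpD : (⟨p, hpZ⟩ : Z) ∈ D
  · rw [hφ0 (Or.inl ⟨_, hpD, rfl⟩)] at hp1
    norm_num at hp1
  · rw [hφ1 (Or.inl ⟨⟨p, hpZ⟩, hpD, rfl⟩)] at hp1
    norm_num at hp1

/-- Components of open sets in the plane are path connected. This allows a continuum to be replaced
by a path arbitrarily close to it. -/
theorem joinedIn_of_isPreconnected_subset {K U : Set (ℝ × ℝ)} (hK : IsPreconnected K)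
    (hU : IsOpen U) (hKU : K ⊆ U) {p q : ℝ × ℝ} (hp : p ∈ K) (hq : q ∈ K) : JoinedIn U p q := by
  have hpath : IsPathConnected (connectedComponentIn U p) :=
    (hU.connectedComponentIn.isConnected_iff_isPathConnected).mp
      (isConnected_connectedComponentIn_iff.mpr (hKU hp))
  exact (hpath.joinedIn p (mem_connectedComponentIn (hKU hp)) q
    (hK.subset_connectedComponentIn hp hKU hq)).mono (connectedComponentIn_subset U p)

/-- Two disjoint continua in a closed half-plane cannot have interleaved boundary points. -/
theorem not_interleaved_continua {K₁ K₂ : Set (ℝ × ℝ)} {H : ℝ} (hc₁ : IsCompact K₁)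
    (hc₂ : IsCompact K₂) (hp₁ : IsPreconnected K₁) (hp₂ : IsPreconnected K₂)
    (hd : Disjoint K₁ K₂) (hH₁ : ∀ p ∈ K₁, p.2 ≤ H) (hH₂ : ∀ p ∈ K₂, p.2 ≤ H)
    {a b c d : ℝ} (hab : a < b) (hbc : b < c) (hcd : c < d) (ha : (a, H) ∈ K₁)
    (hb : (b, H) ∈ K₂) (hc : (c, H) ∈ K₁) (hd' : (d, H) ∈ K₂) : False := by
  -- The continua are replaced by paths P and R in disjoint thickenings, and the argument of P s - R
  -- t is followed around the square of parameters. On each edge one of the two points is on the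
  -- boundary line, so the difference stays in a half-plane. Both ways from (0, 0) to (1, 1), (1, 0)
  -- then give θ (1, 0) = π modulo 2π, whereas c - b > 0.
  obtain ⟨ε, hε, hdis⟩ := hd.exists_thickenings hc₁ hc₂.isClosed
  -- A path in the thickening may leave the half-plane; pushing it back does not increase its
  -- distance to the continuum.
  let cl : ℝ × ℝ → ℝ × ℝ := fun p => (p.1, min p.2 H)
  have hcl : ∀ K : Set (ℝ × ℝ), (∀ p ∈ K, p.2 ≤ H) → ∀ p ∈ Metric.thickening ε K,
      cl p ∈ Metric.thickening ε K := by
    intro K hK p hp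
    rw [Metric.mem_thickening_iff] at hp ⊢
    obtain ⟨z, hz, hpz⟩ := hp
    refine ⟨z, hz, lt_of_le_of_lt ?_ hpz⟩
    rw [Prod.dist_eq, Prod.dist_eq]
    refine max_le_max le_rfl ?_
    have h1 : z.2 = min z.2 H := (min_eq_left (hK z hz)).symm
    simp only [cl]
    rw [h1, Real.dist_eq, Real.dist_eq, ← h1]
    conv_lhs => rw [h1]
    refine (abs_min_sub_min_le_max _ _ _ _).trans ?_
    simp
  have path : ∀ K : Set (ℝ × ℝ), IsPreconnected K → (∀ p ∈ K, p.2 ≤ H) → ∀ p ∈ K, ∀ q ∈ K,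
      ∃ P : ℝ → ℝ × ℝ, Continuous P ∧ P 0 = p ∧ P 1 = q ∧ (∀ t, (P t).2 ≤ H) ∧
        ∀ t, P t ∈ Metric.thickening ε K := by
    intro K hK hKH p hp q hq
    obtain ⟨P, hP⟩ := joinedIn_of_isPreconnected_subset hK Metric.isOpen_thickening
      (Metric.self_subset_thickening hε K) hp hq
    refine ⟨fun t => cl (P.extend t), ?_, ?_, ?_, fun t => min_le_right _ _, fun t => ?_⟩
    · have := P.continuous_extend
      simp only [cl]
      fun_prop
    · simp only [Path.extend_zero, cl]
      rw [min_eq_left (hKH p hp)]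
    · simp only [Path.extend_one, cl]
      rw [min_eq_left (hKH q hq)]
    · exact hcl K hKH _ (hP _)
  obtain ⟨P, hPc, hP0, hP1, hPH, hPK⟩ := path K₁ hp₁ hH₁ _ ha _ hc
  obtain ⟨R, hRc, hR0, hR1, hRH, hRK⟩ := path K₂ hp₂ hH₂ _ hb _ hd'
  obtain ⟨θ, hθ, hpol⟩ := exists_continuous_argument
    (w := fun p => ⟨(P p.1).1 - (R p.2).1, (P p.1).2 - (R p.2).2⟩)
    (by
      have : Continuous fun p : ℝ × ℝ =>
        (((P p.1).1 - (R p.2).1 : ℝ) : ℂ) + (((P p.1).2 - (R p.2).2 : ℝ) : ℂ) * Complex.I := by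
          fun_prop
      convert this using 2 with p
      exact Complex.mk_eq_add_mul_I _ _)
    (fun p h0 => by
      have h1 := sub_eq_zero.mp (congrArg Complex.re h0)
      have h2 := sub_eq_zero.mp (congrArg Complex.im h0)
      exact Set.disjoint_left.mp hdis (hPK p.1) (Prod.ext h1 h2 ▸ hRK p.2))
  simp only at hpol
  have hpi := Real.pi_pos
  have m0 : (0 : ℝ) ∈ Icc (0 : ℝ) 1 := ⟨le_rfl, zero_le_one⟩
  have m1 : (1 : ℝ) ∈ Icc (0 : ℝ) 1 := ⟨zero_le_one, le_rfl⟩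
  have sgn : ∀ s t, (R t).2 ≤ (P s).2 → 0 ≤ Real.sin (θ (s, t)) := fun s t h => by
    obtain ⟨r, hr0, -, h1⟩ := hpol (s, t)
    by_contra! hn
    simp only at h1
    nlinarith
  have sgn' : ∀ s t, (P s).2 ≤ (R t).2 → Real.sin (θ (s, t)) ≤ 0 := fun s t h => by
    obtain ⟨r, hr0, -, h1⟩ := hpol (s, t)
    by_contra! hn
    simp only at h1
    nlinarith
  have csg : ∀ s t, (P s).1 < (R t).1 → Real.cos (θ (s, t)) < 0 := fun s t h => by
    obtain ⟨r, hr0, h1, -⟩ := hpol (s, t)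
    by_contra! hn
    simp only at h1
    nlinarith
  have csg' : ∀ s t, (R t).1 < (P s).1 → 0 < Real.cos (θ (s, t)) := fun s t h => by
    obtain ⟨r, hr0, h1, -⟩ := hpol (s, t)
    by_contra! hn
    simp only at h1
    nlinarith
  obtain ⟨k, hk⟩ := exists_int_sub_mem_Ico (θ (0, 0)) 0
  have shift : ∀ x y : ℝ, Real.sin (x - (y + k * (2 * Real.pi))) = Real.sin (x - y) := by
    intro x y
    rw [← sub_sub, Real.sin_sub_int_mul_two_pi]
  have cshift : ∀ x : ℝ, Real.cos (x - k * (2 * Real.pi)) = Real.cos x :=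
    fun x => Real.cos_sub_int_mul_two_pi x k
  have sshift : ∀ x : ℝ, Real.sin (x - k * (2 * Real.pi)) = Real.sin x :=
    fun x => Real.sin_sub_int_mul_two_pi x k
  set K : ℝ := k * (2 * Real.pi) with hK
  have at_pi : ∀ s t, θ (s, t) ∈ Icc K (2 * Real.pi + K) → Real.cos (θ (s, t)) < 0 →
      Real.sin (θ (s, t)) = 0 → θ (s, t) = Real.pi + K := by
    intro s t hm hcos hsin
    rw [← cshift] at hcos
    rw [← sshift] at hsin
    rcases lt_trichotomy (θ (s, t) - K) Real.pi with h | h | h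
    · rcases eq_or_lt_of_le (show 0 ≤ θ (s, t) - K by linarith [hm.1]) with h0 | h0
      · rw [← h0, Real.cos_zero] at hcos
        linarith
      · linarith [Real.sin_pos_of_pos_of_lt_pi h0 h]
    · linarith
    · rw [← Real.sin_sub_two_pi] at hsin
      rw [← Real.cos_sub_two_pi] at hcos
      rcases eq_or_lt_of_le (show θ (s, t) - K - 2 * Real.pi ≤ 0 by linarith [hm.2]) with h0 | h0
      · rw [h0, Real.cos_zero] at hcos
        linarith
      · linarith [Real.sin_neg_of_neg_of_neg_pi_lt h0 (by linarith)]
  have sin0 : ∀ s t, (P s).2 = (R t).2 → Real.sin (θ (s, t)) = 0 := fun s t h =>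
    le_antisymm (sgn' s t h.le) (sgn s t h.ge)
  have h00 : θ (0, 0) = Real.pi + K :=
    at_pi 0 0 ⟨by linarith [hk.1], by linarith [hk.2]⟩ (csg 0 0 (by rw [hP0, hR0]; exact hab))
      (sin0 0 0 (by rw [hP0, hR0]))
  have e1 := continuous_argument_window (θ := fun t => θ (0, t)) (by fun_prop)
    (α := 0 + K) (fun t _ => by
      rw [shift, sub_zero]; exact sgn 0 t (by rw [hP0]; exact hRH t)) m0 m1
      ⟨by linarith, by linarith⟩
  have h01 : θ (0, 1) = Real.pi + K :=
    at_pi 0 1 ⟨by linarith [e1.1], by linarith [e1.2]⟩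
      (csg 0 1 (by rw [hP0, hR1]; simp only; linarith)) (sin0 0 1 (by rw [hP0, hR1]))
  have e2 := continuous_argument_window (θ := fun s => θ (s, 1)) (by fun_prop)
    (α := Real.pi + K) (fun s _ => by
      rw [shift, Real.sin_sub_pi]; linarith [sgn' s 1 (by rw [hR1]; exact hPH s)]) m0 m1
      ⟨by linarith, by linarith⟩
  have h11 : θ (1, 1) = Real.pi + K :=
    at_pi 1 1 ⟨by linarith [e2.1], by linarith [e2.2]⟩
      (csg 1 1 (by rw [hP1, hR1]; exact hcd)) (sin0 1 1 (by rw [hP1, hR1]))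
  have e3 := continuous_argument_window (θ := fun t => θ (1, t)) (by fun_prop)
    (α := 0 + K) (fun t _ => by
      rw [shift, sub_zero]; exact sgn 1 t (by rw [hP1]; exact hRH t)) m1 m0
      ⟨by linarith, by linarith⟩
  have e4 := continuous_argument_window (θ := fun s => θ (s, 0)) (by fun_prop)
    (α := Real.pi + K) (fun s _ => by
      rw [shift, Real.sin_sub_pi]; linarith [sgn' s 0 (by rw [hR0]; exact hPH s)]) m0 m1
      ⟨by linarith, by linarith⟩
  have hcos := csg' 1 0 (by rw [hP1, hR0]; exact hbc)
  have : θ (1, 0) = Real.pi + K := le_antisymm (by linarith [e3.2]) e4.1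
  rw [this, ← cshift, add_sub_cancel_right, Real.cos_pi] at hcos
  linarith

/-! ### Families of functions with fold singularities -/

theorem eventually_sign_of_hasDerivAt_pos {f : ℝ → ℝ} {f' a : ℝ} (hf : HasDerivAt f f' a)
    (h0 : f a = 0) (hf' : 0 < f') :
    (∀ᶠ z in 𝓝[>] a, 0 < f z) ∧ ∀ᶠ z in 𝓝[<] a, f z < 0 := by
  have hs : ∀ᶠ z in 𝓝[≠] a, 0 < slope f a z :=
    (hasDerivAt_iff_tendsto_slope.mp hf).eventually (lt_mem_nhds hf')
  constructor
  · have := nhdsWithin_mono a (show Ioi a ⊆ {a}ᶜ from fun z hz => (ne_of_gt hz)) hs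
    filter_upwards [this, self_mem_nhdsWithin] with z hz hza
    rw [slope_def_field, h0, sub_zero] at hz
    exact (div_pos_iff_of_pos_right (sub_pos.mpr hza)).mp hz
  · have := nhdsWithin_mono a (show Iio a ⊆ {a}ᶜ from fun z hz => (ne_of_lt hz)) hs
    filter_upwards [this, self_mem_nhdsWithin] with z hz hza
    rw [slope_def_field, h0, sub_zero] at hz
    have hza' : z < a := hza
    by_contra! hn
    have := div_nonpos_of_nonneg_of_nonpos hn (show z - a ≤ 0 by linarith)
    linarith

theorem lt_of_hasDerivAt_pos {f f' : ℝ → ℝ} (hf : ∀ z, HasDerivAt f (f' z) z) {a b : ℝ}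
    (hab : a < b) (h : ∀ z ∈ Ioo a b, 0 < f' z) : f a < f b := by
  obtain ⟨c, hc, he⟩ := exists_hasDerivAt_eq_slope f f' hab
    (fun z _ => (hf z).continuousAt.continuousWithinAt) (fun z _ => hf z)
  have := h c hc
  rw [he] at this
  have := (div_pos_iff_of_pos_right (sub_pos.mpr hab)).mp this
  linarith

theorem lt_of_hasDerivAt_neg {f f' : ℝ → ℝ} (hf : ∀ z, HasDerivAt f (f' z) z) {a b : ℝ}
    (hab : a < b) (h : ∀ z ∈ Ioo a b, f' z < 0) : f b < f a := by
  have := lt_of_hasDerivAt_pos (f := fun z => -f z) (f' := fun z => -f' z)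
    (fun z => (hf z).neg) hab (fun z hz => neg_pos.mpr (h z hz))
  linarith

theorem eventually_neg_of_hasDerivAt_neg {f g : ℝ → ℝ} {g' a : ℝ}
    (hf : ∀ z, HasDerivAt f (g z) z) (hg : HasDerivAt g g' a) (hfa : f a = 0) (hga : g a = 0)
    (hg' : g' < 0) : ∀ᶠ z in 𝓝[≠] a, f z < 0 := by
  obtain ⟨h1, h2⟩ := eventually_sign_of_hasDerivAt_pos (f := fun z => -g z) hg.neg
    (by simp [hga]) (neg_pos.mpr hg')
  obtain ⟨b, hb, hab⟩ := (mem_nhdsGT_iff_exists_Ioo_subset (a := a)).mp h1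
  obtain ⟨c, hc, hca⟩ := (mem_nhdsLT_iff_exists_Ioo_subset (a := a)).mp h2
  have hnhds : Ioo c b ∈ 𝓝 a := Ioo_mem_nhds hc hb
  filter_upwards [mem_nhdsWithin_of_mem_nhds hnhds, self_mem_nhdsWithin] with z hz hza
  rcases lt_or_gt_of_ne hza with h | h
  · rw [← hfa]
    refine lt_of_hasDerivAt_pos hf h fun w hw => ?_
    have : -g w < 0 := hca ⟨hz.1.trans hw.1, hw.2⟩
    linarith
  · rw [← hfa]
    refine lt_of_hasDerivAt_neg hf h fun w hw => ?_
    have : 0 < -g w := hab ⟨hw.1, hw.2.trans hz.2⟩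
    linarith

/-- A family `F x` of real functions, with partial derivatives `Fx`, `Fy` and `Fyy`, whose
only degenerate zeros are folds that unfold transversely. -/
structure IsFoldFamily (F Fx Fy Fyy : ℝ → ℝ → ℝ) : Prop where
  cont : Continuous fun p : ℝ × ℝ => F p.1 p.2
  cont_x : Continuous fun p : ℝ × ℝ => Fx p.1 p.2
  cont_y : Continuous fun p : ℝ × ℝ => Fy p.1 p.2
  cont_yy : Continuous fun p : ℝ × ℝ => Fyy p.1 p.2
  deriv_x : ∀ x y, HasDerivAt (fun x => F x y) (Fx x y) x
  deriv_y : ∀ x y, HasDerivAt (F x) (Fy x y) y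
  deriv_yy : ∀ x y, HasDerivAt (Fy x) (Fyy x y) y
  generic : ∀ x y, F x y = 0 → Fy x y = 0 → Fx x y ≠ 0 ∧ Fyy x y ≠ 0

namespace IsFoldFamily

variable {F Fx Fy Fyy : ℝ → ℝ → ℝ}

/-- Changing the signs of both y and F preserves Fy, hence the increasing zeros, and exchanges the
two kinds of folds. Together with `reflect_x` it reduces every fold to the case Fyy < 0 < Fx. -/
theorem reflect_y (h : IsFoldFamily F Fx Fy Fyy) :
    IsFoldFamily (fun x y => -F x (-y)) (fun x y => -Fx x (-y)) (fun x y => Fy x (-y))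
      (fun x y => -Fyy x (-y)) where
  cont := (h.cont.comp (f := fun p : ℝ × ℝ => (p.1, -p.2)) (by fun_prop)).neg
  cont_x := (h.cont_x.comp (f := fun p : ℝ × ℝ => (p.1, -p.2)) (by fun_prop)).neg
  cont_y := h.cont_y.comp (f := fun p : ℝ × ℝ => (p.1, -p.2)) (by fun_prop)
  cont_yy := (h.cont_yy.comp (f := fun p : ℝ × ℝ => (p.1, -p.2)) (by fun_prop)).neg
  deriv_x x y := (h.deriv_x x (-y)).neg
  deriv_y x y := by
    have := ((h.deriv_y x (-y)).comp y (hasDerivAt_neg y)).neg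
    rw [mul_neg_one, neg_neg] at this
    exact this
  deriv_yy x y := by
    have := (h.deriv_yy x (-y)).comp y (hasDerivAt_neg y)
    simpa [Function.comp_def] using this
  generic x y h1 h2 := by
    obtain ⟨h3, h4⟩ := h.generic x (-y) (neg_eq_zero.mp h1) h2
    exact ⟨neg_ne_zero.mpr h3, neg_ne_zero.mpr h4⟩

theorem reflect_x (h : IsFoldFamily F Fx Fy Fyy) :
    IsFoldFamily (fun x y => F (-x) y) (fun x y => -Fx (-x) y) (fun x y => Fy (-x) y)
      (fun x y => Fyy (-x) y) where
  cont := h.cont.comp (f := fun p : ℝ × ℝ => (-p.1, p.2)) (by fun_prop)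
  cont_x := (h.cont_x.comp (f := fun p : ℝ × ℝ => (-p.1, p.2)) (by fun_prop)).neg
  cont_y := h.cont_y.comp (f := fun p : ℝ × ℝ => (-p.1, p.2)) (by fun_prop)
  cont_yy := h.cont_yy.comp (f := fun p : ℝ × ℝ => (-p.1, p.2)) (by fun_prop)
  deriv_x x y := by
    have := (h.deriv_x (-x) y).comp x (hasDerivAt_neg x)
    simpa [Function.comp_def] using this
  deriv_y x y := h.deriv_y (-x) y
  deriv_yy x y := h.deriv_yy (-x) y
  generic x y h1 h2 := by
    obtain ⟨h3, h4⟩ := h.generic (-x) y h1 h2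
    exact ⟨neg_ne_zero.mpr h3, h4⟩

theorem continuous_right (h : IsFoldFamily F Fx Fy Fyy) (x : ℝ) : Continuous (F x) :=
  h.cont.comp (f := fun y => (x, y)) (by fun_prop)

theorem continuous_left (h : IsFoldFamily F Fx Fy Fyy) (y : ℝ) : Continuous fun x => F x y :=
  h.cont.comp (f := fun x => (x, y)) (by fun_prop)

theorem eventually_ne (h : IsFoldFamily F Fx Fy Fyy) {x y : ℝ} (h0 : F x y = 0) :
    ∀ᶠ z in 𝓝[≠] y, F x z ≠ 0 := by
  by_cases hy : Fy x y = 0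
  · rcases lt_or_gt_of_ne (h.generic x y h0 hy).2 with h2 | h2
    · exact (eventually_neg_of_hasDerivAt_neg (h.deriv_y x) (h.deriv_yy x y) h0 hy h2).mono
        fun z hz => hz.ne
    · refine (eventually_neg_of_hasDerivAt_neg (f := fun z => -F x z) (g := fun z => -Fy x z)
        (fun z => (h.deriv_y x z).neg) (h.deriv_yy x y).neg (by simp [h0]) (by simp [hy])
        (neg_lt_zero.mpr h2)).mono fun z hz => ?_
      exact (neg_lt_zero.mp hz).ne'
  · have := (h.deriv_y x y).eventually_ne (c := 0) hy
    exact this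

/-- An arc of nondegenerate zeros, parametrized by `x`, from `p` to `q`; the last point may be
degenerate. -/
def Arc (F Fy : ℝ → ℝ → ℝ) (p q : ℝ × ℝ) : Prop :=
  ∃ s : ℝ → ℝ, ContinuousOn s (uIcc p.1 q.1) ∧ s p.1 = p.2 ∧ s q.1 = q.2 ∧
    ∀ x ∈ uIcc p.1 q.1, F x (s x) = 0 ∧ (x ≠ q.1 → 0 < Fy x (s x))

/-- The sign of F at a fixed level tells on which side of that level the crossing lies, and a strict
sign persists for nearby x. -/
theorem continuousOn_of_single_crossing {I : Set ℝ} {s : ℝ → ℝ} {α β : ℝ}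
    (hF : ∀ y, Continuous fun x => F x y)
    (hs : ∀ x ∈ I, s x ∈ Icc α β) (h0 : ∀ x ∈ I, F x (s x) = 0)
    (hlt : ∀ x ∈ I, ∀ c ∈ Icc α β, c < s x → F x c < 0)
    (hgt : ∀ x ∈ I, ∀ c ∈ Icc α β, s x < c → 0 < F x c) : ContinuousOn s I := by
  intro x hx
  rw [ContinuousWithinAt, tendsto_order]
  constructor
  · intro a ha
    by_cases haα : a < α
    · filter_upwards [self_mem_nhdsWithin] with x' hx'
      exact haα.trans_le (hs x' hx').1
    · push Not at haα
      have ham : a ∈ Icc α β := ⟨haα, ha.le.trans (hs x hx).2⟩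
      have hev : ∀ᶠ x' in 𝓝 x, F x' a < 0 :=
        (hF a).continuousAt.eventually_lt continuousAt_const (hlt x hx a ham ha)
      filter_upwards [self_mem_nhdsWithin, mem_nhdsWithin_of_mem_nhds hev] with x' hx' hn
      by_contra! hle
      rcases hle.lt_or_eq with h | h
      · linarith [hgt x' hx' a ham h]
      · rw [← h, h0 x' hx'] at hn
        exact lt_irrefl _ hn
  · intro a ha
    by_cases haβ : β < a
    · filter_upwards [self_mem_nhdsWithin] with x' hx'
      exact (hs x' hx').2.trans_lt haβ
    · push Not at haβ
      have ham : a ∈ Icc α β := ⟨(hs x hx).1.trans ha.le, haβ⟩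
      have hev : ∀ᶠ x' in 𝓝 x, 0 < F x' a :=
        continuousAt_const.eventually_lt (hF a).continuousAt (hgt x hx a ham ha)
      filter_upwards [self_mem_nhdsWithin, mem_nhdsWithin_of_mem_nhds hev] with x' hx' hn
      by_contra! hle
      rcases hle.lt_or_eq with h | h
      · linarith [hlt x' hx' a ham h]
      · rw [h, h0 x' hx'] at hn
        exact lt_irrefl _ hn

theorem exists_box {P : ℝ → ℝ → Prop} {x₀ y₀ : ℝ}
    (h : ∀ᶠ p : ℝ × ℝ in 𝓝 (x₀, y₀), P p.1 p.2) {r : ℝ} (hr : 0 < r) :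
    ∃ δ > 0, δ < r ∧ ∀ x ∈ Icc (x₀ - δ) (x₀ + δ), ∀ y ∈ Icc (y₀ - δ) (y₀ + δ), P x y := by
  obtain ⟨ε, hε, hb⟩ := Metric.eventually_nhds_iff.mp h
  refine ⟨min ε r / 2, by positivity, ?_, fun x hx y hy => ?_⟩
  · have := min_le_right ε r
    have : 0 < min ε r := lt_min hε hr
    linarith
  · have h1 := min_le_left ε r
    have h2 : 0 < min ε r := lt_min hε hr
    refine hb (y := (x, y)) ?_
    rw [Prod.dist_eq, max_lt_iff, Real.dist_eq, Real.dist_eq, abs_lt, abs_lt]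
    simp only
    refine ⟨⟨?_, ?_⟩, ?_, ?_⟩ <;> linarith [hx.1, hx.2, hy.1, hy.2]

/-- Near a nondegenerate zero, the zero set is the graph of a continuous function. -/
theorem exists_regular_branch (h : IsFoldFamily F Fx Fy Fyy) {x₀ y₀ : ℝ} (h0 : F x₀ y₀ = 0)
    (hy : 0 < Fy x₀ y₀) {r : ℝ} (hr : 0 < r) :
    ∃ δ > 0, δ < r ∧ ∃ η > 0, ∃ s : ℝ → ℝ, ContinuousOn s (Icc (x₀ - η) (x₀ + η)) ∧
      ∀ x ∈ Icc (x₀ - η) (x₀ + η), s x ∈ Icc (y₀ - δ) (y₀ + δ) ∧ F x (s x) = 0 ∧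
        ∀ y ∈ Icc (y₀ - δ) (y₀ + δ), 0 < Fy x y ∧ (F x y = 0 → y = s x) := by
  obtain ⟨δ, hδ, hδr, hbox⟩ := exists_box (P := fun x y => 0 < Fy x y)
    (continuousAt_const.eventually_lt h.cont_y.continuousAt hy) hr
  have hx₀ : x₀ ∈ Icc (x₀ - δ) (x₀ + δ) := ⟨by linarith, by linarith⟩
  have hlo : F x₀ (y₀ - δ) < 0 := by
    rw [← h0]
    exact lt_of_hasDerivAt_pos (h.deriv_y x₀) (by linarith)
      fun z hz => hbox _ hx₀ _ ⟨hz.1.le, by linarith [hz.2]⟩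
  have hhi : 0 < F x₀ (y₀ + δ) := by
    rw [← h0]
    exact lt_of_hasDerivAt_pos (h.deriv_y x₀) (by linarith)
      fun z hz => hbox _ hx₀ _ ⟨by linarith [hz.1], hz.2.le⟩
  have e1 : ∀ᶠ x in 𝓝 x₀, F x (y₀ - δ) < 0 :=
    (h.continuous_left _).continuousAt.eventually_lt continuousAt_const hlo
  have e2 : ∀ᶠ x in 𝓝 x₀, 0 < F x (y₀ + δ) :=
    continuousAt_const.eventually_lt (h.continuous_left _).continuousAt hhi
  obtain ⟨ε, hε, hb⟩ := Metric.eventually_nhds_iff.mp (e1.and e2)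
  have hη : 0 < min (ε / 2) δ := by positivity
  have hsub : ∀ x ∈ Icc (x₀ - min (ε / 2) δ) (x₀ + min (ε / 2) δ),
      x ∈ Icc (x₀ - δ) (x₀ + δ) ∧ F x (y₀ - δ) < 0 ∧ 0 < F x (y₀ + δ) := by
    intro x hx
    have h1 := min_le_left (ε / 2) δ
    have h2 := min_le_right (ε / 2) δ
    refine ⟨⟨by linarith [hx.1], by linarith [hx.2]⟩, hb ?_⟩
    rw [Real.dist_eq, abs_lt]
    constructor <;> linarith [hx.1, hx.2]
  have hex : ∀ x, ∃ y, x ∈ Icc (x₀ - min (ε / 2) δ) (x₀ + min (ε / 2) δ) →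
      y ∈ Icc (y₀ - δ) (y₀ + δ) ∧ F x y = 0 := by
    intro x
    by_cases hx : x ∈ Icc (x₀ - min (ε / 2) δ) (x₀ + min (ε / 2) δ)
    · obtain ⟨-, h1, h2⟩ := hsub x hx
      obtain ⟨y, hy, he⟩ := intermediate_value_Icc (show y₀ - δ ≤ y₀ + δ by linarith)
        (h.continuous_right x).continuousOn ⟨h1.le, h2.le⟩
      exact ⟨y, fun _ => ⟨hy, he⟩⟩
    · exact ⟨0, fun h => absurd h hx⟩
  choose s hs using hex
  have hmono : ∀ x ∈ Icc (x₀ - min (ε / 2) δ) (x₀ + min (ε / 2) δ),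
      ∀ y ∈ Icc (y₀ - δ) (y₀ + δ), ∀ z ∈ Icc (y₀ - δ) (y₀ + δ), y < z → F x y < F x z :=
    fun x hx y hy z hz hyz => lt_of_hasDerivAt_pos (h.deriv_y x) hyz fun w hw =>
      hbox x (hsub x hx).1 w ⟨hy.1.trans hw.1.le, hw.2.le.trans hz.2⟩
  refine ⟨δ, hδ, hδr, _, hη, s, ?_, fun x hx => ⟨(hs x hx).1, (hs x hx).2, fun y hy =>
    ⟨hbox x (hsub x hx).1 y hy, fun h0' => ?_⟩⟩⟩
  · refine continuousOn_of_single_crossing h.continuous_left (fun x hx => (hs x hx).1)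
      (fun x hx => (hs x hx).2) (fun x hx c hc hlt => ?_) (fun x hx c hc hlt => ?_)
    · rw [← (hs x hx).2]
      exact hmono x hx c hc _ (hs x hx).1 hlt
    · rw [← (hs x hx).2]
      exact hmono x hx _ (hs x hx).1 c hc hlt
  · rcases lt_trichotomy y (s x) with hlt | heq | hlt
    · linarith [hmono x hx y hy _ (hs x hx).1 hlt, (hs x hx).2]
    · exact heq
    · linarith [hmono x hx _ (hs x hx).1 y hy hlt, (hs x hx).2]

theorem eventually_box {x₀ y₀ η δ : ℝ} (hη : 0 < η) (hδ : 0 < δ) :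
    ∀ᶠ p : ℝ × ℝ in 𝓝 (x₀, y₀), p.1 ∈ Icc (x₀ - η) (x₀ + η) ∧ p.2 ∈ Icc (y₀ - δ) (y₀ + δ) :=
  prod_mem_nhds (Icc_mem_nhds (by linarith) (by linarith))
    (Icc_mem_nhds (by linarith) (by linarith))

/-- All zeros near a nondegenerate zero are joined to it in both directions. -/
theorem eventually_arc_of_regular (h : IsFoldFamily F Fx Fy Fyy) {x₀ y₀ : ℝ} (h0 : F x₀ y₀ = 0)
    (hy : 0 < Fy x₀ y₀) :
    ∀ᶠ p in 𝓝 (x₀, y₀), F p.1 p.2 = 0 → Arc F Fy p (x₀, y₀) ∧ Arc F Fy (x₀, y₀) p := by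
  obtain ⟨δ, hδ, -, η, hη, s, hsc, hs⟩ := h.exists_regular_branch h0 hy one_pos
  filter_upwards [eventually_box hη hδ] with p hp hp0
  have hx₀ : x₀ ∈ Icc (x₀ - η) (x₀ + η) := ⟨by linarith, by linarith⟩
  have hsub : uIcc p.1 x₀ ⊆ Icc (x₀ - η) (x₀ + η) := uIcc_subset_Icc hp.1 hx₀
  have e1 : p.2 = s p.1 := ((hs _ hp.1).2.2 _ hp.2).2 hp0
  have e2 : y₀ = s x₀ := ((hs _ hx₀).2.2 y₀ ⟨by linarith, by linarith⟩).2 h0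
  refine ⟨⟨s, hsc.mono hsub, e1.symm, e2.symm, fun x hx => ?_⟩,
    ⟨s, hsc.mono (uIcc_comm p.1 x₀ ▸ hsub), e2.symm, e1.symm, fun x hx => ?_⟩⟩
  · have := hs x (hsub hx)
    exact ⟨this.2.1, fun _ => (this.2.2 _ this.1).1⟩
  · have := hs x (hsub (uIcc_comm p.1 x₀ ▸ hx))
    exact ⟨this.2.1, fun _ => (this.2.2 _ this.1).1⟩

/-- Near the fold F is concave in y and increasing in x. Thus there are no zeros for x < x₀, while
for x > x₀ exactly one zero lies below y₀ in the box; this lower branch carries the positive slopes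
and tends to the fold. -/
theorem eventually_arc_of_fold_aux (h : IsFoldFamily F Fx Fy Fyy) {x₀ y₀ : ℝ} (h0 : F x₀ y₀ = 0)
    (hy : Fy x₀ y₀ = 0) (hyy : Fyy x₀ y₀ < 0) (hx : 0 < Fx x₀ y₀) :
    ∀ᶠ p in 𝓝 (x₀, y₀), F p.1 p.2 = 0 → 0 < Fy p.1 p.2 → Arc F Fy p (x₀, y₀) := by
  obtain ⟨δ, hδ, -, hbox⟩ := exists_box (P := fun x y => 0 < Fx x y ∧ Fyy x y < 0)
    ((continuousAt_const.eventually_lt h.cont_x.continuousAt hx).and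
      (h.cont_yy.continuousAt.eventually_lt continuousAt_const hyy)) one_pos
  have hx₀ : x₀ ∈ Icc (x₀ - δ) (x₀ + δ) := ⟨by linarith, by linarith⟩
  have hFy : ∀ x ∈ Icc (x₀ - δ) (x₀ + δ), ∀ y ∈ Icc (y₀ - δ) (y₀ + δ),
      ∀ z ∈ Icc (y₀ - δ) (y₀ + δ), y < z → Fy x z < Fy x y := fun x hx y hy z hz hyz =>
    lt_of_hasDerivAt_neg (h.deriv_yy x) hyz fun w hw =>
      (hbox x hx w ⟨hy.1.trans hw.1.le, hw.2.le.trans hz.2⟩).2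
  have hFx : ∀ y ∈ Icc (y₀ - δ) (y₀ + δ), ∀ x ∈ Icc (x₀ - δ) (x₀ + δ),
      ∀ x' ∈ Icc (x₀ - δ) (x₀ + δ), x < x' → F x y < F x' y := fun y hy x hx x' hx' hlt =>
    lt_of_hasDerivAt_pos (fun z => h.deriv_x z y) hlt fun w hw =>
      (hbox w ⟨hx.1.trans hw.1.le, hw.2.le.trans hx'.2⟩ y hy).1
  have hy₀ : y₀ ∈ Icc (y₀ - δ) (y₀ + δ) := ⟨by linarith, by linarith⟩
  have hneg : ∀ y ∈ Icc (y₀ - δ) (y₀ + δ), y ≠ y₀ → F x₀ y < 0 := by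
    intro y hym hne
    rw [← h0]
    rcases lt_or_gt_of_ne hne with hlt | hlt
    · exact lt_of_hasDerivAt_pos (h.deriv_y x₀) hlt fun w hw => by
        rw [← hy]
        exact hFy x₀ hx₀ w ⟨hym.1.trans hw.1.le, hw.2.le.trans hy₀.2⟩ y₀ hy₀ hw.2
    · exact lt_of_hasDerivAt_neg (h.deriv_y x₀) hlt fun w hw => by
        rw [← hy]
        exact hFy x₀ hx₀ y₀ hy₀ w ⟨hy₀.1.trans hw.1.le, hw.2.le.trans hym.2⟩ hw.1
  have hlo : ∀ᶠ x in 𝓝 x₀, F x (y₀ - δ) < 0 :=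
    (h.continuous_left _).continuousAt.eventually_lt continuousAt_const
      (hneg _ ⟨le_rfl, by linarith⟩ (by linarith))
  obtain ⟨ε, hε, hb⟩ := Metric.eventually_nhds_iff.mp hlo
  have hη : 0 < min (ε / 2) δ := by positivity
  filter_upwards [eventually_box hη hδ] with p hp hp0 hpy
  obtain ⟨x₁, y₁⟩ := p
  simp only at hp hp0 hpy ⊢
  have h1 := min_le_left (ε / 2) δ
  have h2 := min_le_right (ε / 2) δ
  have hx₁δ : x₁ ∈ Icc (x₀ - δ) (x₀ + δ) := ⟨by linarith [hp.1.1], by linarith [hp.1.2]⟩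
  -- For x < x₀ monotonicity gives F x y < F x₀ y ≤ 0, and over x₀ the only zero is the fold, which
  -- has slope 0.
  have hlt : x₀ < x₁ := by
    by_contra! hle
    rcases hle.lt_or_eq with hlt | rfl
    · have := hFx y₁ hp.2 x₁ hx₁δ x₀ hx₀ hlt
      by_cases hyy : y₁ = y₀
      · rw [hyy] at this hp0
        linarith
      · linarith [hneg y₁ hp.2 hyy]
    · by_cases hyy : y₁ = y₀
      · rw [hyy] at hpy
        linarith
      · linarith [hneg y₁ hp.2 hyy]
  have hsub : ∀ x ∈ Icc x₀ x₁, x ∈ Icc (x₀ - δ) (x₀ + δ) ∧ F x (y₀ - δ) < 0 := by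
    intro x hx
    refine ⟨⟨by linarith [hx.1], by linarith [hx.2, hx₁δ.2]⟩, hb ?_⟩
    rw [Real.dist_eq, abs_lt]
    constructor <;> linarith [hx.1, hx.2, hp.1.2]
  have hpos : ∀ x ∈ Ioc x₀ x₁, 0 < F x y₀ := fun x hx => by
    rw [← h0]
    exact hFx y₀ hy₀ x₀ hx₀ x (hsub x ⟨hx.1.le, hx.2⟩).1 hx.1
  -- at a zero `z ≤ y₀` of `F x`, the derivative is positive
  have hder : ∀ x ∈ Ioc x₀ x₁, ∀ z ∈ Icc (y₀ - δ) y₀, F x z = 0 → 0 < Fy x z := by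
    intro x hx z hz hz0
    by_contra! hle
    have hlt' : z < y₀ := lt_of_le_of_ne hz.2 fun he => by
      have := hpos x hx
      rw [← he, hz0] at this
      exact lt_irrefl _ this
    have hzm : z ∈ Icc (y₀ - δ) (y₀ + δ) := ⟨hz.1, by linarith⟩
    have := lt_of_hasDerivAt_neg (h.deriv_y x) hlt' fun w hw =>
      (hFy x (hsub x ⟨hx.1.le, hx.2⟩).1 z hzm w ⟨hz.1.trans hw.1.le, by linarith [hw.2]⟩
        hw.1).trans_le hle
    linarith [hpos x hx]
  have hbelow : ∀ x ∈ Ioc x₀ x₁, ∀ z ∈ Icc (y₀ - δ) y₀, F x z = 0 →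
      ∀ w ∈ Icc (y₀ - δ) z, w < z → F x w < 0 := by
    intro x hx z hz hz0 w hw hwz
    rw [← hz0]
    have hzm : z ∈ Icc (y₀ - δ) (y₀ + δ) := ⟨hz.1, by linarith [hz.2]⟩
    exact lt_of_hasDerivAt_pos (h.deriv_y x) hwz fun u hu =>
      (hder x hx z hz hz0).trans (hFy x (hsub x ⟨hx.1.le, hx.2⟩).1 u
        ⟨hw.1.trans hu.1.le, by linarith [hu.2, hz.2]⟩ z hzm hu.2)
  have habove : ∀ x ∈ Ioc x₀ x₁, ∀ z ∈ Icc (y₀ - δ) y₀, F x z = 0 →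
      ∀ w ∈ Icc z y₀, z < w → 0 < F x w := by
    intro x hx z hz hz0 w hw hzw
    by_contra! hle
    rcases hle.lt_or_eq with hn | he
    · obtain ⟨u, hu, hu0⟩ := intermediate_value_Icc hw.2 (h.continuous_right x).continuousOn
        ⟨hn.le, (hpos x hx).le⟩
      have := hbelow x hx u ⟨hz.1.trans (hw.1.trans hu.1), hu.2⟩ hu0 z
        ⟨hz.1, hw.1.trans hu.1⟩ (hzw.trans_le hu.1)
      linarith
    · have := hbelow x hx w ⟨hz.1.trans hw.1, hw.2⟩ he z ⟨hz.1, hw.1⟩ hzw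
      linarith
  have hex : ∀ x, ∃ y, (x ∈ Ioc x₀ x₁ → y ∈ Icc (y₀ - δ) y₀ ∧ F x y = 0) ∧
      (x = x₀ → y = y₀) := by
    intro x
    by_cases hxm : x ∈ Ioc x₀ x₁
    · obtain ⟨y, hy, he⟩ := intermediate_value_Icc (show y₀ - δ ≤ y₀ by linarith)
        (h.continuous_right x).continuousOn
        ⟨(hsub x ⟨hxm.1.le, hxm.2⟩).2.le, (hpos x hxm).le⟩
      exact ⟨y, fun _ => ⟨hy, he⟩, fun he => absurd hxm.1 (by rw [he]; exact lt_irrefl _)⟩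
    · exact ⟨y₀, fun h => absurd h hxm, fun _ => rfl⟩
  choose s hs using hex
  have hs₀ : s x₀ = y₀ := (hs x₀).2 rfl
  have hcase : ∀ x ∈ Icc x₀ x₁, x = x₀ ∨ x ∈ Ioc x₀ x₁ := fun x hx =>
    hx.1.eq_or_lt.imp Eq.symm fun h' => ⟨h', hx.2⟩
  have hsm : ∀ x ∈ Icc x₀ x₁, s x ∈ Icc (y₀ - δ) y₀ ∧ F x (s x) = 0 := by
    intro x hx
    rcases hcase x hx with rfl | hx'
    · rw [hs₀]
      exact ⟨⟨by linarith, le_rfl⟩, h0⟩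
    · exact (hs x).1 hx'
  -- If the zero were above y₀, concavity and its positive slope would make F x₁ increase from y₀ to
  -- y₁, contrary to F x₁ y₀ > 0.
  have hy₁lt : y₁ < y₀ := by
    by_contra! hle
    have hx1 := hpos x₁ ⟨hlt, le_rfl⟩
    rcases hle.lt_or_eq with hlt' | rfl
    · have := lt_of_hasDerivAt_pos (h.deriv_y x₁) hlt' fun w hw =>
        hpy.trans (hFy x₁ hx₁δ w ⟨by linarith [hw.1], hw.2.le.trans hp.2.2⟩ y₁ hp.2 hw.2)
      linarith
    · linarith
  have hs₁ : s x₁ = y₁ := by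
    have hm : x₁ ∈ Ioc x₀ x₁ := ⟨hlt, le_rfl⟩
    obtain ⟨ha, hb'⟩ := hsm x₁ ⟨hlt.le, le_rfl⟩
    rcases lt_trichotomy (s x₁) y₁ with h' | h' | h'
    · linarith [habove x₁ hm _ ha hb' y₁ ⟨h'.le, hy₁lt.le⟩ h']
    · exact h'
    · linarith [hbelow x₁ hm _ ha hb' y₁ ⟨hp.2.1, h'.le⟩ h']
  refine ⟨s, ?_, hs₁, hs₀, ?_⟩
  · rw [uIcc_of_ge hlt.le]
    refine continuousOn_of_single_crossing h.continuous_left (fun x hx => (hsm x hx).1)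
      (fun x hx => (hsm x hx).2) (fun x hx c hc hcs => ?_) (fun x hx c hc hcs => ?_)
    · rcases hcase x hx with rfl | hx'
      · rw [hs₀] at hcs
        exact hneg c ⟨hc.1, by linarith⟩ hcs.ne
      · exact hbelow x hx' _ (hsm x hx).1 (hsm x hx).2 c ⟨hc.1, hcs.le⟩ hcs
    · rcases hcase x hx with rfl | hx'
      · rw [hs₀] at hcs
        linarith [hc.2]
      · exact habove x hx' _ (hsm x hx).1 (hsm x hx).2 c ⟨hcs.le, hc.2⟩ hcs
  · simp only
    rw [uIcc_of_ge hlt.le]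
    intro x hx
    refine ⟨(hsm x hx).2, fun hne => ?_⟩
    rcases hcase x hx with he | hx'
    · exact absurd he hne
    · exact hder x hx' _ (hsm x hx).1 (hsm x hx).2

theorem Arc.of_reflect_y {p q : ℝ × ℝ}
    (h : Arc (fun x y => -F x (-y)) (fun x y => Fy x (-y)) (p.1, -p.2) (q.1, -q.2)) :
    Arc F Fy p q := by
  obtain ⟨s, hc, h1, h2, h3⟩ := h
  refine ⟨fun x => -s x, hc.neg, by simp [h1], by simp [h2], fun x hx => ?_⟩
  obtain ⟨h4, h5⟩ := h3 x hx
  exact ⟨neg_eq_zero.mp h4, h5⟩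

theorem Arc.of_reflect_x {p q : ℝ × ℝ}
    (h : Arc (fun x y => F (-x) y) (fun x y => Fy (-x) y) (-p.1, p.2) (-q.1, q.2)) :
    Arc F Fy p q := by
  obtain ⟨s, hc, h1, h2, h3⟩ := h
  have hmap : ∀ x ∈ uIcc p.1 q.1, -x ∈ uIcc (-p.1) (-q.1) := by
    intro x hx
    rw [mem_uIcc] at hx ⊢
    rcases hx with hx | hx
    · right; constructor <;> linarith [hx.1, hx.2]
    · left; constructor <;> linarith [hx.1, hx.2]
  refine ⟨fun x => s (-x), hc.comp continuous_neg.continuousOn hmap, h1, h2, fun x hx => ?_⟩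
  obtain ⟨h4, h5⟩ := h3 (-x) (hmap x hx)
  simp only [neg_neg] at h4 h5
  exact ⟨h4, fun hne => h5 fun he => hne (neg_injective he)⟩

/-- All nondegenerate zeros of positive slope near a fold are joined to it. -/
theorem eventually_arc_of_fold (h : IsFoldFamily F Fx Fy Fyy) {x₀ y₀ : ℝ} (h0 : F x₀ y₀ = 0)
    (hy : Fy x₀ y₀ = 0) :
    ∀ᶠ p in 𝓝 (x₀, y₀), F p.1 p.2 = 0 → 0 < Fy p.1 p.2 → Arc F Fy p (x₀, y₀) := by
  have main : ∀ {F Fx Fy Fyy : ℝ → ℝ → ℝ}, IsFoldFamily F Fx Fy Fyy → ∀ {x₀ y₀ : ℝ},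
      F x₀ y₀ = 0 → Fy x₀ y₀ = 0 → Fyy x₀ y₀ < 0 →
      ∀ᶠ p in 𝓝 (x₀, y₀), F p.1 p.2 = 0 → 0 < Fy p.1 p.2 → Arc F Fy p (x₀, y₀) := by
    intro F Fx Fy Fyy h x₀ y₀ h0 hy hyy
    rcases lt_or_gt_of_ne (h.generic _ _ h0 hy).1 with hx | hx
    · have := h.reflect_x.eventually_arc_of_fold_aux (x₀ := -x₀) (y₀ := y₀) (by simpa using h0)
        (by simpa using hy) (by simpa using hyy) (by simpa using hx)
      have ht : Tendsto (fun p : ℝ × ℝ => (-p.1, p.2)) (𝓝 (x₀, y₀)) (𝓝 (-x₀, y₀)) :=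
        Continuous.tendsto' (by fun_prop) _ _ rfl
      filter_upwards [ht.eventually this] with p hp hp0 hpy
      exact Arc.of_reflect_x (hp (by simpa using hp0) (by simpa using hpy))
    · exact h.eventually_arc_of_fold_aux h0 hy hyy hx
  rcases lt_or_gt_of_ne (h.generic _ _ h0 hy).2 with hyy | hyy
  · exact main h h0 hy hyy
  · have := main h.reflect_y (x₀ := x₀) (y₀ := -y₀) (by simpa using h0)
      (by simpa using hy) (by simpa using hyy)
    have ht : Tendsto (fun p : ℝ × ℝ => (p.1, -p.2)) (𝓝 (x₀, y₀)) (𝓝 (x₀, -y₀)) :=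
      Continuous.tendsto' (by fun_prop) _ _ rfl
    filter_upwards [ht.eventually this] with p hp hp0 hpy
    exact Arc.of_reflect_y (hp (by simpa using hp0) (by simpa using hpy))

end IsFoldFamily

/-! ### Barriers -/

theorem joinedIn_vertical {S : Set (ℝ × ℝ)} {x u v : ℝ} (h : ∀ z ∈ uIcc u v, (x, z) ∈ S) :
    JoinedIn S (x, u) (x, v) := by
  refine JoinedIn.of_segment_subset ?_
  rw [← Prod.image_mk_segment_right, segment_eq_uIcc]
  rintro _ ⟨z, hz, rfl⟩
  exact h z hz

theorem joinedIn_horizontal {S : Set (ℝ × ℝ)} {y u v : ℝ} (h : ∀ z ∈ uIcc u v, (z, y) ∈ S) :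
    JoinedIn S (u, y) (v, y) := by
  refine JoinedIn.of_segment_subset ?_
  rw [← Prod.image_mk_segment_left, segment_eq_uIcc]
  rintro _ ⟨z, hz, rfl⟩
  exact h z hz

/-- The part of the strip `lo < y < hi` over `[x₁, x₂]` where `F` is negative. -/
def negRegion (F : ℝ → ℝ → ℝ) (lo hi : ℝ → ℝ) (x₁ x₂ : ℝ) : Set (ℝ × ℝ) :=
  {p | lo p.1 < p.2 ∧ p.2 < hi p.1 ∧ F p.1 p.2 < 0 ∧ p.1 ∈ Icc x₁ x₂}

namespace IsFoldFamily

variable {F Fx Fy Fyy : ℝ → ℝ → ℝ}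

/-- Where `Fx` does not vanish, `F` decreases strictly on one of the two sides. -/
theorem exists_side (h : IsFoldFamily F Fx Fy Fyy) {x₀ y₀ : ℝ} (hx : Fx x₀ y₀ ≠ 0) {r : ℝ}
    (hr : 0 < r) :
    ∃ δ > 0, δ < r ∧ ∃ x' ∈ Icc (x₀ - δ) (x₀ + δ), x' ≠ x₀ ∧ ∀ y ∈ Icc (y₀ - δ) (y₀ + δ),
      ∀ x ∈ uIcc x' x₀, x ≠ x₀ → F x y < F x₀ y := by
  rcases lt_or_gt_of_ne hx with hx | hx
  · obtain ⟨δ, hδ, hδr, hbox⟩ := exists_box (P := fun x y => Fx x y < 0)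
      (h.cont_x.continuousAt.eventually_lt continuousAt_const hx) hr
    refine ⟨δ, hδ, hδr, x₀ + δ, ⟨by linarith, le_rfl⟩, by linarith, fun y hy x hxm hne => ?_⟩
    rw [uIcc_of_ge (by linarith)] at hxm
    refine lt_of_hasDerivAt_neg (fun z => h.deriv_x z y) (lt_of_le_of_ne hxm.1 hne.symm)
      fun z hz => hbox z ⟨by linarith [hz.1], hz.2.le.trans hxm.2⟩ y hy
  · obtain ⟨δ, hδ, hδr, hbox⟩ := exists_box (P := fun x y => 0 < Fx x y)
      (continuousAt_const.eventually_lt h.cont_x.continuousAt hx) hr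
    refine ⟨δ, hδ, hδr, x₀ - δ, ⟨le_rfl, by linarith⟩, by linarith, fun y hy x hxm hne => ?_⟩
    rw [uIcc_of_le (by linarith)] at hxm
    refine lt_of_hasDerivAt_pos (fun z => h.deriv_x z y) (lt_of_le_of_ne hxm.2 hne)
      fun z hz => hbox z ⟨hxm.1.trans hz.1.le, by linarith [hz.2]⟩ y hy

/-- On a vertical segment where `F ≤ 0`, the points with `F < 0` can be joined in the region
`F < 0` by going around the zeros. -/
theorem joinedIn_of_nonpos (h : IsFoldFamily F Fx Fy Fyy) {lo hi : ℝ → ℝ} (hlo : Continuous lo)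
    (hhi : Continuous hi) {x₁ x₂ x₀ : ℝ} (hx₀ : x₀ ∈ Icc x₁ x₂) {c c' : ℝ} (hcc : c ≤ c')
    (hm : ∀ z ∈ Icc c c', lo x₀ < z ∧ z < hi x₀ ∧ F x₀ z ≤ 0 ∧ (F x₀ z = 0 → x₀ ∈ Ioo x₁ x₂))
    (hc : F x₀ c < 0) (hc' : F x₀ c' < 0) :
    JoinedIn (negRegion F lo hi x₁ x₂) (x₀, c) (x₀, c') := by
  set S := negRegion F lo hi x₁ x₂ with hS
  have hopen : ∀ z ∈ Icc c c', ∀ᶠ p : ℝ × ℝ in 𝓝 (x₀, z), lo p.1 < p.2 ∧ p.2 < hi p.1 := by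
    intro z hz
    have h1 : Continuous fun p : ℝ × ℝ => lo p.1 := hlo.comp continuous_fst
    have h2 : Continuous fun p : ℝ × ℝ => hi p.1 := hhi.comp continuous_fst
    exact (h1.continuousAt.eventually_lt continuous_snd.continuousAt (hm z hz).1).and
      (continuous_snd.continuousAt.eventually_lt h2.continuousAt (hm z hz).2.1)
  have hzero : ∀ z ∈ Icc c c', F x₀ z = 0 → Icc c c' ∈ 𝓝 z := by
    intro z hz hz0
    refine Icc_mem_nhds (lt_of_le_of_ne hz.1 ?_) (lt_of_le_of_ne hz.2 ?_)
    · rintro rfl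
      exact hc.ne hz0
    · rintro rfl
      exact hc'.ne hz0
  have hloc : ∀ z ∈ Icc c c', ∃ N ∈ 𝓝 z, ∀ u ∈ N ∩ Icc c c', ∀ v ∈ N ∩ Icc c c',
      F x₀ u < 0 → F x₀ v < 0 → JoinedIn S (x₀, u) (x₀, v) := by
    intro z hz
    rcases (hm z hz).2.2.1.lt_or_eq with hneg | hz0
    · obtain ⟨δ, hδ, -, hbox⟩ := exists_box (P := fun x y => F x y < 0)
        (h.cont.continuousAt.eventually_lt continuousAt_const hneg) one_pos
      refine ⟨Icc (z - δ) (z + δ), Icc_mem_nhds (by linarith) (by linarith),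
        fun u hu v hv _ _ => joinedIn_vertical fun w hw => ?_⟩
      have hwI := uIcc_subset_Icc hu.2 hv.2 hw
      exact ⟨(hm w hwI).1, (hm w hwI).2.1,
        hbox x₀ ⟨by linarith, by linarith⟩ w (uIcc_subset_Icc hu.1 hv.1 hw), hx₀⟩
    · have hx₀i := (hm z hz).2.2.2 hz0
      -- An interior zero on a segment with F ≤ 0 is a local maximum, hence a fold. There Fx ≠ 0, so
      -- F is smaller on one side and a detour through x' passes the zero; this needs x₀ to be
      -- interior to [x₁, x₂].
      have hy0 : Fy x₀ z = 0 := by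
        refine IsLocalMax.hasDerivAt_eq_zero ?_ (h.deriv_y x₀ z)
        filter_upwards [hzero z hz hz0] with w hw
        rw [hz0]
        exact (hm w hw).2.2.1
      obtain ⟨r, hr, -, hbox⟩ := exists_box
        (P := fun x y => (lo x < y ∧ y < hi x) ∧ x ∈ Ioo x₁ x₂) ((hopen z hz).and
          (continuous_fst.continuousAt.eventually (Ioo_mem_nhds hx₀i.1 hx₀i.2))) one_pos
      obtain ⟨δ, hδ, hδr, x', hx', hne, hside⟩ := h.exists_side (h.generic _ _ hz0 hy0).1 hr
      have hmem : ∀ w ∈ Icc (z - δ) (z + δ), ∀ x ∈ uIcc x' x₀, F x w < 0 → (x, w) ∈ S := by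
        intro w hw x hx hF
        have hxm : x ∈ Icc (x₀ - r) (x₀ + r) := by
          have := uIcc_subset_Icc hx' (show x₀ ∈ Icc (x₀ - δ) (x₀ + δ) from
            ⟨by linarith, by linarith⟩) hx
          exact ⟨by linarith [this.1], by linarith [this.2]⟩
        obtain ⟨h1, h2⟩ := hbox x hxm w ⟨by linarith [hw.1], by linarith [hw.2]⟩
        exact ⟨h1.1, h1.2, hF, h2.1.le, h2.2.le⟩
      refine ⟨Icc (z - δ) (z + δ), Icc_mem_nhds (by linarith) (by linarith),
        fun u hu v hv hFu hFv => ?_⟩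
      have side : ∀ u ∈ Icc (z - δ) (z + δ) ∩ Icc c c', F x₀ u < 0 →
          JoinedIn S (x₀, u) (x', u) := by
        intro u hu hFu
        refine (joinedIn_horizontal fun x hx => hmem u hu.1 x hx ?_).symm
        by_cases hxx : x = x₀
        · rw [hxx]
          exact hFu
        · exact (hside u hu.1 x hx hxx).trans hFu
      refine ((side u hu hFu).trans ?_).trans (side v hv hFv).symm
      refine joinedIn_vertical fun w hw => hmem w (uIcc_subset_Icc hu.1 hv.1 hw) x'
        left_mem_uIcc ?_
      exact (hside w (uIcc_subset_Icc hu.1 hv.1 hw) x' left_mem_uIcc hne).trans_le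
        (hm w (uIcc_subset_Icc hu.2 hv.2 hw)).2.2.1
  have hdense : ∀ z ∈ Icc c c', ∀ N ∈ 𝓝 z, ∃ u ∈ N ∩ Icc c c', F x₀ u < 0 := by
    intro z hz N hN
    rcases (hm z hz).2.2.1.lt_or_eq with hneg | hz0
    · exact ⟨z, ⟨mem_of_mem_nhds hN, hz⟩, hneg⟩
    · obtain ⟨u, hu1, hu2⟩ := ((h.eventually_ne hz0).and
        (mem_nhdsWithin_of_mem_nhds (inter_mem hN (hzero z hz hz0)))).exists
      exact ⟨u, hu2, lt_of_le_of_ne (hm u hu2.2).2.2.1 hu1⟩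
  -- A zero z is not itself in the region, so the relation speaks of the points with F < 0 near z
  -- and z'. Transitivity holds because such points are dense in the segment.
  let P : ℝ → ℝ → Prop := fun z z' => ∃ N ∈ 𝓝 z, ∃ N' ∈ 𝓝 z', ∀ u ∈ N ∩ Icc c c',
    ∀ v ∈ N' ∩ Icc c c', F x₀ u < 0 → F x₀ v < 0 → JoinedIn S (x₀, u) (x₀, v)
  have hP : P c c' := by
    refine isPreconnected_Icc.induction₂ P (fun z hz => ?_) ?_ ?_
      (left_mem_Icc.mpr hcc) (right_mem_Icc.mpr hcc)
    · obtain ⟨N, hN, hJ⟩ := hloc z hz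
      filter_upwards [mem_nhdsWithin_of_mem_nhds (eventually_mem_nhds_iff.mpr hN)] with z' hz'
      exact ⟨N, hN, N, hz', hJ⟩
    · rintro z w t - hw - ⟨N₁, h1, N₂, h2, hJ⟩ ⟨N₃, h3, N₄, h4, hJ'⟩
      obtain ⟨u, hu, hFu⟩ := hdense w hw _ (inter_mem h2 h3)
      exact ⟨N₁, h1, N₄, h4, fun a ha b hb hFa hFb =>
        (hJ a ha u ⟨hu.1.1, hu.2⟩ hFa hFu).trans (hJ' u ⟨hu.1.2, hu.2⟩ b hb hFu hFb)⟩
    · rintro z w - - ⟨N₁, h1, N₂, h2, hJ⟩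
      exact ⟨N₂, h2, N₁, h1, fun a ha b hb hFa hFb => (hJ b hb a ha hFb hFa).symm⟩
  obtain ⟨N, hN, N', hN', hJ⟩ := hP
  exact hJ c ⟨mem_of_mem_nhds hN, left_mem_Icc.mpr hcc⟩ c'
    ⟨mem_of_mem_nhds hN', right_mem_Icc.mpr hcc⟩ hc hc'

/-- To the left of a zero where `F x₀` increases from below, nearby increasing zeros have a
negative interval of uniform length below them. -/
theorem exists_negative_below (h : IsFoldFamily F Fx Fy Fyy) {x₀ y₀ : ℝ} (h0 : F x₀ y₀ = 0)
    (hy : 0 < Fy x₀ y₀ ∨ Fy x₀ y₀ = 0 ∧ Fyy x₀ y₀ < 0) {r : ℝ} (hr : 0 < r) :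
    ∃ d > 0, d < r ∧ (∀ z ∈ Ico (y₀ - d) y₀, F x₀ z < 0) ∧
      ∀ᶠ q : ℝ × ℝ in 𝓝 (x₀, y₀), F q.1 q.2 = 0 → 0 < Fy q.1 q.2 →
        y₀ - d < q.2 ∧ ∀ z ∈ Ico (y₀ - d) q.2, F q.1 z < 0 := by
  rcases hy with hy | ⟨hy, hyy⟩
  · obtain ⟨d, hd, hdr, hbox⟩ := exists_box (P := fun x y => 0 < Fy x y)
      (continuousAt_const.eventually_lt h.cont_y.continuousAt hy) hr
    refine ⟨d, hd, hdr, fun z hz => ?_, ?_⟩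
    · rw [← h0]
      exact lt_of_hasDerivAt_pos (h.deriv_y x₀) hz.2 fun w hw =>
        hbox x₀ ⟨by linarith, by linarith⟩ w ⟨hz.1.trans hw.1.le, by linarith [hw.2]⟩
    · filter_upwards [eventually_box hd (half_pos hd)] with q hq hq0 hqy
      refine ⟨by linarith [hq.2.1], fun z hz => ?_⟩
      rw [← hq0]
      exact lt_of_hasDerivAt_pos (h.deriv_y q.1) hz.2 fun w hw =>
        hbox q.1 hq.1 w ⟨hz.1.trans hw.1.le, by linarith [hw.2, hq.2.2]⟩
  · obtain ⟨d, hd, hdr, hbox⟩ := exists_box (P := fun x y => Fyy x y < 0)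
      (h.cont_yy.continuousAt.eventually_lt continuousAt_const hyy) hr
    refine ⟨d, hd, hdr, fun z hz => ?_, ?_⟩
    · rw [← h0]
      refine lt_of_hasDerivAt_pos (h.deriv_y x₀) hz.2 fun w hw => ?_
      rw [← hy]
      exact lt_of_hasDerivAt_neg (h.deriv_yy x₀) hw.2 fun t ht =>
        hbox x₀ ⟨by linarith, by linarith⟩ t
          ⟨hz.1.trans (hw.1.trans ht.1).le, by linarith [ht.2]⟩
    · filter_upwards [eventually_box hd (half_pos hd)] with q hq hq0 hqy
      refine ⟨by linarith [hq.2.1], fun z hz => ?_⟩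
      rw [← hq0]
      refine lt_of_hasDerivAt_pos (h.deriv_y q.1) hz.2 fun w hw => hqy.trans ?_
      exact lt_of_hasDerivAt_neg (h.deriv_yy q.1) hw.2 fun t ht =>
        hbox q.1 hq.1 t ⟨hz.1.trans (hw.1.trans ht.1).le, by linarith [ht.2, hq.2.2]⟩

end IsFoldFamily

/-- A set `L` of nondegenerate increasing zeros in the strip `lo < y < hi` which is closed under
continuation along the zero set and under the jumps at the folds. -/
structure IsTrap (F Fy Fyy : ℝ → ℝ → ℝ) (lo hi : ℝ → ℝ) (L : Set (ℝ × ℝ)) : Prop where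
  cont_lo : Continuous lo
  cont_hi : Continuous hi
  lo_pos : ∀ x, 0 < F x (lo x)
  hi_neg : ∀ x, F x (hi x) < 0
  mem : ∀ p ∈ L, F p.1 p.2 = 0 ∧ 0 < Fy p.1 p.2 ∧ lo p.1 < p.2 ∧ p.2 < hi p.1
  nearby : ∀ p ∈ L, ∀ᶠ q in 𝓝 p, F q.1 q.2 = 0 → q ∈ L
  closure_mem : ∀ p ∈ closure L, 0 < Fy p.1 p.2 → p ∈ L
  fold_neg : ∀ p ∈ closure L, Fy p.1 p.2 = 0 → Fyy p.1 p.2 < 0 →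
    ∃ y', p.2 < y' ∧ (p.1, y') ∈ L ∧ ∀ z ∈ Icc p.2 y', F p.1 z ≤ 0
  fold_pos : ∀ p ∈ closure L, Fy p.1 p.2 = 0 → 0 < Fyy p.1 p.2 →
    ∃ y', y' < p.2 ∧ (p.1, y') ∈ L ∧ ∀ z ∈ Icc y' p.2, 0 ≤ F p.1 z
  nonempty : L.Nonempty

namespace IsTrap

variable {F Fx Fy Fyy : ℝ → ℝ → ℝ} {lo hi : ℝ → ℝ} {L : Set (ℝ × ℝ)}

/-- The reflection exchanges upward and downward jumps, so the upper barrier is the lower barrier of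
the mirror image. -/
theorem reflect_y (h : IsTrap F Fy Fyy lo hi L) :
    IsTrap (fun x y => -F x (-y)) (fun x y => Fy x (-y)) (fun x y => -Fyy x (-y))
      (fun x => -hi x) (fun x => -lo x) {p | (p.1, -p.2) ∈ L} := by
  have hcont : Continuous fun p : ℝ × ℝ => (p.1, -p.2) := by fun_prop
  have hcl : ∀ p ∈ closure {p : ℝ × ℝ | (p.1, -p.2) ∈ L}, (p.1, -p.2) ∈ closure L := fun p hp =>
    map_mem_closure (f := fun p : ℝ × ℝ => (p.1, -p.2)) hcont hp fun q hq => hq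
  refine ⟨h.cont_hi.neg, h.cont_lo.neg, fun x => ?_, fun x => ?_, fun p hp => ?_, fun p hp => ?_,
    fun p hp hy => ?_, fun p hp hy hyy => ?_, fun p hp hy hyy => ?_, ?_⟩
  · simpa using h.hi_neg x
  · simpa using h.lo_pos x
  · obtain ⟨h1, h2, h3, h4⟩ := h.mem _ hp
    simp only at h1 h2 h3 h4
    exact ⟨neg_eq_zero.mpr h1, h2, by linarith, by linarith⟩
  · have := (hcont.tendsto p).eventually (h.nearby _ hp)
    filter_upwards [this] with q hq hq0
    exact hq (neg_eq_zero.mp hq0)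
  · exact h.closure_mem _ (hcl p hp) hy
  · obtain ⟨y', h1, h2, h3⟩ := h.fold_pos _ (hcl p hp) hy (by simpa using hyy)
    simp only at h1 h2 h3
    refine ⟨-y', by linarith, by simpa using h2, fun z hz => ?_⟩
    have := h3 (-z) ⟨by linarith [hz.2], by linarith [hz.1]⟩
    linarith
  · obtain ⟨y', h1, h2, h3⟩ := h.fold_neg _ (hcl p hp) hy (by simpa using hyy)
    simp only at h1 h2 h3
    refine ⟨-y', by linarith, by simpa using h2, fun z hz => ?_⟩
    have := h3 (-z) ⟨by linarith [hz.2], by linarith [hz.1]⟩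
    linarith
  · obtain ⟨p, hp⟩ := h.nonempty
    exact ⟨(p.1, -p.2), by simpa using hp⟩

theorem of_mem_closure (h : IsTrap F Fy Fyy lo hi L) (hF : IsFoldFamily F Fx Fy Fyy)
    {p : ℝ × ℝ} (hp : p ∈ closure L) :
    F p.1 p.2 = 0 ∧ 0 ≤ Fy p.1 p.2 ∧ lo p.1 < p.2 ∧ p.2 < hi p.1 := by
  have hclosed : IsClosed {p : ℝ × ℝ | F p.1 p.2 = 0 ∧ 0 ≤ Fy p.1 p.2 ∧ lo p.1 ≤ p.2 ∧
      p.2 ≤ hi p.1} := by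
    refine (isClosed_eq hF.cont continuous_const).and ((isClosed_le continuous_const
      hF.cont_y).and ((isClosed_le (h.cont_lo.comp continuous_fst) continuous_snd).and
      (isClosed_le continuous_snd (h.cont_hi.comp continuous_fst))))
  obtain ⟨h1, h2, h3, h4⟩ := closure_minimal (fun q hq => by
    obtain ⟨h1, h2, h3, h4⟩ := h.mem q hq
    exact ⟨h1, h2.le, h3.le, h4.le⟩) hclosed hp
  refine ⟨h1, h2, lt_of_le_of_ne h3 fun he => ?_, lt_of_le_of_ne h4 fun he => ?_⟩
  · have := h.lo_pos p.1
    rw [he, h1] at this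
    exact lt_irrefl _ this
  · have := h.hi_neg p.1
    rw [← he, h1] at this
    exact lt_irrefl _ this

theorem nonempty_of_mem_closure (h : IsTrap F Fy Fyy lo hi L) (hF : IsFoldFamily F Fx Fy Fyy)
    {p : ℝ × ℝ} (hp : p ∈ closure L) : ∃ y, (p.1, y) ∈ L := by
  obtain ⟨h0, hy, -⟩ := h.of_mem_closure hF hp
  rcases hy.lt_or_eq with hy | hy
  · exact ⟨p.2, h.closure_mem p hp hy⟩
  · rcases lt_or_gt_of_ne (hF.generic _ _ h0 hy.symm).2 with h2 | h2
    · obtain ⟨y, -, hy', -⟩ := h.fold_neg p hp hy.symm h2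
      exact ⟨y, hy'⟩
    · obtain ⟨y, -, hy', -⟩ := h.fold_pos p hp hy.symm h2
      exact ⟨y, hy'⟩

/-- Near a point of `L` there are points of `L` over all nearby parameters. -/
theorem eventually_exists_near (h : IsTrap F Fy Fyy lo hi L) (hF : IsFoldFamily F Fx Fy Fyy)
    {x₀ y₀ : ℝ} (hp : (x₀, y₀) ∈ L) {r : ℝ} (hr : 0 < r) :
    ∀ᶠ x in 𝓝 x₀, ∃ y ∈ Icc (y₀ - r) (y₀ + r), (x, y) ∈ L := by
  obtain ⟨h0, hy, -⟩ := h.mem _ hp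
  obtain ⟨ρ, hρ, hρr, hbox⟩ := IsFoldFamily.exists_box
    (P := fun x y => F x y = 0 → (x, y) ∈ L) (h.nearby _ hp) hr
  obtain ⟨δ, hδ, hδρ, η, hη, s, -, hs⟩ := hF.exists_regular_branch h0 hy hρ
  filter_upwards [Icc_mem_nhds (show x₀ - η < x₀ by linarith) (show x₀ < x₀ + η by linarith),
    Icc_mem_nhds (show x₀ - ρ < x₀ by linarith) (show x₀ < x₀ + ρ by linarith)] with x hx hx'
  obtain ⟨hm, hz, -⟩ := hs x hx
  exact ⟨s x, ⟨by linarith [hm.1], by linarith [hm.2]⟩,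
    hbox x hx' _ ⟨by linarith [hm.1], by linarith [hm.2]⟩ hz⟩

theorem eventually_bounded (h : IsTrap F Fy Fyy lo hi L) (x₀ : ℝ) :
    ∀ᶠ x in 𝓝 x₀, ∀ y, (x, y) ∈ L → y ∈ Icc (lo x₀ - 1) (hi x₀ + 1) := by
  filter_upwards [continuousAt_const.eventually_lt h.cont_lo.continuousAt
      (show lo x₀ - 1 < lo x₀ by linarith),
    h.cont_hi.continuousAt.eventually_lt continuousAt_const
      (show hi x₀ < hi x₀ + 1 by linarith)] with x h1 h2 y hy
  obtain ⟨-, -, h3, h4⟩ := h.mem _ hy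
  simp only at h3 h4
  exact ⟨by linarith, by linarith⟩

/-- The projection of L is open because nondegenerate zeros continue to nearby x. It is closed
because L is bounded over bounded sets of x and a limit point outside L is a fold, whose jump lands
in L over the same x. -/
theorem fiber_nonempty (h : IsTrap F Fy Fyy lo hi L) (hF : IsFoldFamily F Fx Fy Fyy) (x : ℝ) :
    ∃ y, (x, y) ∈ L := by
  let E : Set ℝ := {x | ∃ y, (x, y) ∈ L}
  have hopen : IsOpen E := by
    rw [isOpen_iff_mem_nhds]
    rintro x₀ ⟨y₀, hy₀⟩
    filter_upwards [h.eventually_exists_near hF hy₀ one_pos] with x hx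
    obtain ⟨y, -, hy⟩ := hx
    exact ⟨y, hy⟩
  have hclosed : IsClosed E := by
    rw [← isOpen_compl_iff, isOpen_iff_mem_nhds]
    intro x₀ hx₀
    have := isCompact_Icc.eventually_forall_of_forall_eventually
      (x₀ := x₀) (K := Icc (lo x₀ - 1) (hi x₀ + 1)) (P := fun x y => (x, y) ∉ L) fun y _ => by
        have hn : (x₀, y) ∉ closure L := fun hc => hx₀ (h.nonempty_of_mem_closure hF hc)
        filter_upwards [isClosed_closure.isOpen_compl.mem_nhds hn] with p hp hpL
        exact hp (subset_closure hpL)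
    filter_upwards [this, h.eventually_bounded x₀] with x h1 h2
    rintro ⟨y, hy⟩
    exact h1 y (h2 y hy) hy
  obtain ⟨p, hp⟩ := h.nonempty
  have huniv := IsClopen.eq_univ ⟨hclosed, hopen⟩ ⟨p.1, p.2, hp⟩
  have : x ∈ E := huniv ▸ mem_univ x
  exact this

/-- L is not closed, but zeros of F x are isolated, so the infimum of a fiber must belong to it. -/
theorem exists_min (h : IsTrap F Fy Fyy lo hi L) (hF : IsFoldFamily F Fx Fy Fyy) (x : ℝ) :
    ∃ m, (x, m) ∈ L ∧ ∀ y, (x, y) ∈ L → m ≤ y := by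
  let E : Set ℝ := {y | (x, y) ∈ L}
  have hne : E.Nonempty := h.fiber_nonempty hF x
  have hbdd : BddBelow E := ⟨lo x, fun y hy => (h.mem _ hy).2.2.1.le⟩
  have hcl : sInf E ∈ closure E := csInf_mem_closure hne hbdd
  have hcl' : (x, sInf E) ∈ closure L :=
    map_mem_closure (f := fun y => (x, y)) (by fun_prop) hcl fun y hy => hy
  have h0 : F x (sInf E) = 0 := (h.of_mem_closure hF hcl').1
  refine ⟨sInf E, ?_, fun y hy => csInf_le hbdd hy⟩
  have hiso := eventually_nhdsWithin_iff.mp (hF.eventually_ne h0)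
  obtain ⟨y, hy1, hy2⟩ := mem_closure_iff_nhds.mp hcl _ hiso
  by_cases hye : y = sInf E
  · exact hye ▸ hy2
  · exact absurd (h.mem _ hy2).1 (hy1 hye)

/-- Below the lowest branches of `L` there is a path in the region `F < 0`. -/
theorem exists_barrier (h : IsTrap F Fy Fyy lo hi L) (hF : IsFoldFamily F Fx Fy Fyy)
    {x₁ x₂ : ℝ} (hx : x₁ ≤ x₂)
    (hfold : ∀ x, x = x₁ ∨ x = x₂ → ∀ y, F x y = 0 → Fy x y ≠ 0) :
    ∃ a₁ a₂, (∀ y, (x₁, y) ∈ L → a₁ < y) ∧ (∀ y, (x₂, y) ∈ L → a₂ < y) ∧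
      JoinedIn (negRegion F lo hi x₁ x₂) (x₁, a₁) (x₂, a₂) := by
  set S := negRegion F lo hi x₁ x₂ with hS
  choose m hmL hmin using h.exists_min hF
  -- Admissible heights of the barrier: those from which F is negative up to the lowest point of L.
  -- Any two over the same x are joined vertically, so only their connection across nearby x is at
  -- issue.
  let T : ℝ → Set ℝ := fun x => {a | a < m x ∧ ∀ z ∈ Ico a (m x), F x z < 0}
  have hTne : ∀ x, (T x).Nonempty := by
    intro x
    obtain ⟨h0, hy, -⟩ := h.mem _ (hmL x)
    obtain ⟨d, hd, -, hneg, -⟩ := hF.exists_negative_below h0 (Or.inl hy) one_pos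
    exact ⟨m x - d, by linarith, hneg⟩
  have hTlo : ∀ x, ∀ a ∈ T x, lo x < a := by
    intro x a ha
    by_contra! hle
    linarith [ha.2 (lo x) ⟨hle, (h.mem _ (hmL x)).2.2.1⟩, h.lo_pos x]
  have hmhi : ∀ x, m x < hi x := fun x => (h.mem _ (hmL x)).2.2.2
  have hTS : ∀ x ∈ Icc x₁ x₂, ∀ a ∈ T x, ∀ z ∈ Ico a (m x), (x, z) ∈ S := fun x hx a ha z hz =>
    ⟨(hTlo x a ha).trans_le hz.1, hz.2.trans (hmhi x), ha.2 z hz, hx⟩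
  have hTT : ∀ x ∈ Icc x₁ x₂, ∀ a ∈ T x, ∀ b ∈ T x, JoinedIn S (x, a) (x, b) := by
    intro x hx a ha b hb
    refine joinedIn_vertical fun z hz => ?_
    rcases le_total a b with hab | hab
    · rw [uIcc_of_le hab] at hz
      exact hTS x hx a ha z ⟨hz.1, hz.2.trans_lt hb.1⟩
    · rw [uIcc_of_ge hab] at hz
      exact hTS x hx b hb z ⟨hz.1, hz.2.trans_lt ha.1⟩
  have hloc : ∀ x₀ ∈ Icc x₁ x₂, ∀ᶠ x in 𝓝[Icc x₁ x₂] x₀, ∀ a ∈ T x₀, ∀ b ∈ T x,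
      JoinedIn S (x₀, a) (x, b) := by
    intro x₀ hx₀
    obtain ⟨a₀, ha₀⟩ := hTne x₀
    -- By compactness of the range of heights, each possible limit y of the lowest points m x as x
    -- tends to x₀ can be treated separately.
    have key := isCompact_Icc.eventually_forall_of_forall_eventually
      (x₀ := x₀) (K := Icc (lo x₀ - 1) (hi x₀ + 1))
      (P := fun x y => y = m x → x ∈ Icc x₁ x₂ → ∃ b ∈ T x, JoinedIn S (x₀, a₀) (x, b)) ?_
    · rw [eventually_nhdsWithin_iff]
      filter_upwards [key, h.eventually_bounded x₀] with x h1 h2 hxI a ha b hb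
      obtain ⟨b', hb', hJ⟩ := h1 (m x) (h2 _ (hmL x)) rfl hxI
      exact ((hTT x₀ hx₀ a ha a₀ ha₀).trans hJ).trans (hTT x hxI b' hb' b hb)
    intro y _
    -- No limit lies above m x₀: L has points near (x₀, m x₀) over all nearby x.
    by_cases hym : m x₀ < y
    · obtain ⟨r, hr, hr2⟩ : ∃ r > 0, m x₀ + r < y - r := ⟨(y - m x₀) / 3, by linarith, by linarith⟩
      have e1 := h.eventually_exists_near hF (hmL x₀) hr
      have e2 := (continuous_fst.tendsto (x₀, y)).eventually e1
      filter_upwards [e2, IsFoldFamily.eventually_box (x₀ := x₀) (y₀ := y) hr hr] with p h1 h2 h3 _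
      obtain ⟨y', hy', hyL⟩ := h1
      have := hmin _ _ hyL
      linarith [hy'.2, h2.2.1]
    push Not at hym
    by_cases hcl : (x₀, y) ∈ closure L
    swap
    · filter_upwards [isClosed_closure.isOpen_compl.mem_nhds hcl] with p hp hpm _
      refine absurd (subset_closure ?_) hp
      have := hmL p.1
      rw [← hpm] at this
      exact this
    obtain ⟨h0, hy0, hlo, hhi⟩ := h.of_mem_closure hF hcl
    simp only at h0 hy0 hlo hhi
    -- Either the lowest branch continues, or it starts at a fold whose jump goes up to L; the jump
    -- gives F ≤ 0 from the fold up to m x₀. A fold with a downward jump would put a point of L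
    -- below m x₀.
    have hcase : (0 < Fy x₀ y ∧ y = m x₀) ∨ (Fy x₀ y = 0 ∧ Fyy x₀ y < 0 ∧ y < m x₀ ∧
        (∀ z ∈ Icc y (m x₀), F x₀ z ≤ 0) ∧ x₀ ∈ Ioo x₁ x₂) := by
      rcases hy0.lt_or_eq with hpos | hzero
      · exact Or.inl ⟨hpos, le_antisymm hym (hmin _ _ (h.closure_mem _ hcl hpos))⟩
      · rcases lt_or_gt_of_ne (hF.generic _ _ h0 hzero.symm).2 with h2 | h2
        · obtain ⟨y', hy', hyL, hneg⟩ := h.fold_neg _ hcl hzero.symm h2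
          refine Or.inr ⟨hzero.symm, h2, lt_of_le_of_ne hym ?_, fun z hz =>
            hneg z ⟨hz.1, hz.2.trans (hmin _ _ hyL)⟩, lt_of_le_of_ne hx₀.1 ?_,
            lt_of_le_of_ne hx₀.2 ?_⟩
          · intro he
            have := (h.mem _ (hmL x₀)).2.1
            rw [← he] at this
            exact this.ne hzero
          · intro he
            exact hfold x₀ (Or.inl he.symm) y h0 hzero.symm
          · intro he
            exact hfold x₀ (Or.inr he) y h0 hzero.symm
        · obtain ⟨y', hy', hyL, -⟩ := h.fold_pos _ hcl hzero.symm h2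
          have := hmin _ _ hyL
          simp only at hy'
          linarith
    have hsmall : ∃ r > 0, r < y - lo x₀ ∧ (y = m x₀ → r < m x₀ - a₀) := by
      refine ⟨min (y - lo x₀) (m x₀ - a₀) / 2, ?_, ?_, fun _ => ?_⟩
      · have : 0 < min (y - lo x₀) (m x₀ - a₀) := lt_min (by linarith) (by linarith [ha₀.1])
        linarith
      · have : 0 < min (y - lo x₀) (m x₀ - a₀) := lt_min (by linarith) (by linarith [ha₀.1])
        linarith [min_le_left (y - lo x₀) (m x₀ - a₀)]
      · have : 0 < min (y - lo x₀) (m x₀ - a₀) := lt_min (by linarith) (by linarith [ha₀.1])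
        linarith [min_le_right (y - lo x₀) (m x₀ - a₀)]
    obtain ⟨r, hr, hr1, hr2⟩ := hsmall
    obtain ⟨d, hd, hdr, hneg, hev⟩ := hF.exists_negative_below h0
      (hcase.imp (fun h => h.1) fun h => ⟨h.1, h.2.1⟩) hr
    have hJ₀ : JoinedIn S (x₀, a₀) (x₀, y - d) := by
      rcases hcase with ⟨-, he⟩ | ⟨-, -, hlt, hnp, hint⟩
      · have := hr2 he
        refine hF.joinedIn_of_nonpos h.cont_lo h.cont_hi hx₀ (by linarith) (fun z hz => ?_)
          (ha₀.2 a₀ ⟨le_rfl, ha₀.1⟩) (hneg _ ⟨le_rfl, by linarith⟩)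
        have hlt : F x₀ z < 0 := ha₀.2 z ⟨hz.1, by linarith [hz.2]⟩
        exact ⟨(hTlo x₀ a₀ ha₀).trans_le hz.1, by linarith [hz.2], hlt.le,
          fun h => absurd h hlt.ne⟩
      · have hya : y < a₀ := by
          by_contra! hle
          exact (ha₀.2 y ⟨hle, hlt⟩).ne h0
        refine (hF.joinedIn_of_nonpos h.cont_lo h.cont_hi hx₀ (show y - d ≤ a₀ by linarith)
          (fun z hz => ?_) (hneg _ ⟨le_rfl, by linarith⟩) (ha₀.2 a₀ ⟨le_rfl, ha₀.1⟩)).symm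
        refine ⟨by linarith [hz.1], by linarith [hz.2, hmhi x₀, ha₀.1], ?_, fun _ => hint⟩
        rcases lt_or_ge z y with hzy | hzy
        · exact (hneg z ⟨hz.1, hzy⟩).le
        · exact hnp z ⟨hzy, hz.2.trans ha₀.1.le⟩
    have hnb : ∀ᶠ p : ℝ × ℝ in 𝓝 (x₀, y), ∀ x ∈ uIcc x₀ p.1,
        lo x < y - d ∧ y - d < hi x ∧ F x (y - d) < 0 := by
      have e1 : ∀ᶠ x in 𝓝 x₀, lo x < y - d ∧ y - d < hi x ∧ F x (y - d) < 0 :=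
        (h.cont_lo.continuousAt.eventually_lt continuousAt_const (by linarith)).and
          ((continuousAt_const.eventually_lt h.cont_hi.continuousAt (by linarith)).and
            ((hF.continuous_left _).continuousAt.eventually_lt continuousAt_const
              (hneg _ ⟨le_rfl, by linarith⟩)))
      obtain ⟨ε, hε, hb⟩ := Metric.eventually_nhds_iff.mp e1
      filter_upwards [IsFoldFamily.eventually_box (x₀ := x₀) (y₀ := y) (half_pos hε) one_pos]
        with p hp x hx
      have := uIcc_subset_Icc (show x₀ ∈ Icc (x₀ - ε / 2) (x₀ + ε / 2) from
        ⟨by linarith, by linarith⟩) hp.1 hx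
      refine hb ?_
      rw [Real.dist_eq, abs_lt]
      constructor <;> linarith [this.1, this.2]
    filter_upwards [hev, hnb] with p h1 h2 h3 hpI
    obtain ⟨q0, qy, -⟩ := h.mem _ (hmL p.1)
    simp only at q0 qy
    rw [h3] at h1
    obtain ⟨h4, h5⟩ := h1 q0 qy
    refine ⟨y - d, ⟨h4, h5⟩, hJ₀.trans (joinedIn_horizontal fun x hx => ?_)⟩
    obtain ⟨h6, h7, h8⟩ := h2 x hx
    exact ⟨h6, h7, h8, uIcc_subset_Icc hx₀ hpI hx⟩
  have hglob := isPreconnected_Icc.induction₂ (s := Icc x₁ x₂)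
    (fun x x' => ∀ a ∈ T x, ∀ b ∈ T x', JoinedIn S (x, a) (x', b)) hloc
    (fun x y z _ _ _ h1 h2 a ha b hb => by
      obtain ⟨c, hc⟩ := hTne y
      exact (h1 a ha c hc).trans (h2 c hc b hb))
    (fun x y _ _ h1 a ha b hb => (h1 b hb a ha).symm)
    (left_mem_Icc.mpr hx) (right_mem_Icc.mpr hx)
  obtain ⟨a₁, ha₁⟩ := hTne x₁
  obtain ⟨a₂, ha₂⟩ := hTne x₂
  exact ⟨a₁, a₂, fun y hy => ha₁.1.trans_le (hmin _ _ hy), fun y hy =>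
    ha₂.1.trans_le (hmin _ _ hy), hglob a₁ ha₁ a₂ ha₂⟩

/-- Above the highest branches of `L` there is a path in the region `F > 0`. -/
theorem exists_upper_barrier (h : IsTrap F Fy Fyy lo hi L) (hF : IsFoldFamily F Fx Fy Fyy)
    {x₁ x₂ : ℝ} (hx : x₁ ≤ x₂)
    (hfold : ∀ x, x = x₁ ∨ x = x₂ → ∀ y, F x y = 0 → Fy x y ≠ 0) :
    ∃ b₁ b₂, (∀ y, (x₁, y) ∈ L → y < b₁) ∧ (∀ y, (x₂, y) ∈ L → y < b₂) ∧
      JoinedIn {p : ℝ × ℝ | lo p.1 < p.2 ∧ p.2 < hi p.1 ∧ 0 < F p.1 p.2 ∧ p.1 ∈ Icc x₁ x₂}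
        (x₁, b₁) (x₂, b₂) := by
  obtain ⟨a₁, a₂, h1, h2, hJ⟩ := h.reflect_y.exists_barrier hF.reflect_y hx
    (fun x hx y h0 => hfold x hx (-y) (neg_eq_zero.mp h0))
  refine ⟨-a₁, -a₂, fun y hy => ?_, fun y hy => ?_, ?_⟩
  · have := h1 (-y) (by simpa using hy)
    linarith
  · have := h2 (-y) (by simpa using hy)
    linarith
  · have hc : Continuous fun p : ℝ × ℝ => (p.1, -p.2) := by fun_prop
    have := hJ.map_continuousOn (f := fun p : ℝ × ℝ => (p.1, -p.2)) hc.continuousOn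
    refine this.mono ?_
    rintro _ ⟨p, ⟨h3, h4, h5, h6⟩, rfl⟩
    exact ⟨by simp only; linarith, by simp only; linarith, by simp only; linarith, h6⟩

end IsTrap

/-! ### The pull function of a track -/

/-- Half the derivative, in `y`, of the squared distance from `γ x` to `γ y`. -/
def pull (γ : ℝ → Plane) (x y : ℝ) : ℝ :=
  (γ y 0 - γ x 0) * deriv γ y 0 + (γ y 1 - γ x 1) * deriv γ y 1

/-- The derivative of `pull γ x y` in `x`. -/
def pullX (γ : ℝ → Plane) (x y : ℝ) : ℝ :=
  -(deriv γ x 0 * deriv γ y 0 + deriv γ x 1 * deriv γ y 1)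

/-- The derivative of `pull γ x y` in `y`. -/
def pullY (γ : ℝ → Plane) (x y : ℝ) : ℝ :=
  deriv γ y 0 ^ 2 + deriv γ y 1 ^ 2 +
    ((γ y 0 - γ x 0) * deriv (deriv γ) y 0 + (γ y 1 - γ x 1) * deriv (deriv γ) y 1)

/-- The second derivative of `pull γ x y` in `y`. -/
def pullYY (γ : ℝ → Plane) (x y : ℝ) : ℝ :=
  3 * (deriv γ y 0 * deriv (deriv γ) y 0 + deriv γ y 1 * deriv (deriv γ) y 1) +
    ((γ y 0 - γ x 0) * deriv (deriv (deriv γ)) y 0 +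
      (γ y 1 - γ x 1) * deriv (deriv (deriv γ)) y 1)

theorem hasDerivAt_coord {f : ℝ → Plane} {D : Plane} {t : ℝ} (h : HasDerivAt f D t) (i : Fin 2) :
    HasDerivAt (fun s => f s i) (D i) t :=
  (EuclideanSpace.proj (𝕜 := ℝ) i).hasFDerivAt.comp_hasDerivAt t h

theorem hasDerivAt_of_coord {f : ℝ → Plane} {D : Plane} {t : ℝ}
    (h : ∀ i, HasDerivAt (fun s => f s i) (D i) t) : HasDerivAt f D t := by
  have h1 : HasDerivAt (fun s => WithLp.ofLp (f s)) (WithLp.ofLp D) t := hasDerivAt_pi.mpr h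
  exact (PiLp.continuousLinearEquiv 2 ℝ (fun _ : Fin 2 => ℝ)).symm.toContinuousLinearMap.hasFDerivAt.comp_hasDerivAt
    t h1

theorem plane_ext {u v : Plane} (h0 : u 0 = v 0) (h1 : u 1 = v 1) : u = v := by
  ext i
  fin_cases i
  · exact h0
  · exact h1

theorem norm_sq_plane (u : Plane) : ‖u‖ ^ 2 = u 0 ^ 2 + u 1 ^ 2 := by
  rw [EuclideanSpace.norm_sq_eq]
  simp

namespace IsTrack

variable {γ : ℝ → Plane}

theorem hasDerivAt (h : IsTrack γ) (t : ℝ) : HasDerivAt γ (deriv γ t) t :=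
  (h.contDiff.differentiable (by norm_num) t).hasDerivAt

theorem contDiff_deriv (h : IsTrack γ) : ContDiff ℝ 2 (deriv γ) :=
  ContDiff.deriv' (n := 2) (by simpa [show (2 : WithTop ℕ∞) + 1 = 3 by norm_num] using h.contDiff)

theorem contDiff_deriv_deriv (h : IsTrack γ) : ContDiff ℝ 1 (deriv (deriv γ)) :=
  ContDiff.deriv' (n := 1)
    (by simpa [show (1 : WithTop ℕ∞) + 1 = 2 by norm_num] using h.contDiff_deriv)

theorem hasDerivAt_deriv (h : IsTrack γ) (t : ℝ) :
    HasDerivAt (deriv γ) (deriv (deriv γ) t) t :=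
  (h.contDiff_deriv.differentiable (by norm_num) t).hasDerivAt

theorem hasDerivAt_deriv_deriv (h : IsTrack γ) (t : ℝ) :
    HasDerivAt (deriv (deriv γ)) (deriv (deriv (deriv γ)) t) t :=
  (h.contDiff_deriv_deriv.differentiable (by norm_num) t).hasDerivAt

theorem continuous_coord (h : IsTrack γ) (i : Fin 2) : Continuous fun t => γ t i :=
  (EuclideanSpace.proj (𝕜 := ℝ) i).continuous.comp h.contDiff.continuous

theorem continuous_deriv_coord (h : IsTrack γ) (i : Fin 2) : Continuous fun t => deriv γ t i :=
  (EuclideanSpace.proj (𝕜 := ℝ) i).continuous.comp h.contDiff_deriv.continuous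

theorem continuous_deriv2_coord (h : IsTrack γ) (i : Fin 2) :
    Continuous fun t => deriv (deriv γ) t i :=
  (EuclideanSpace.proj (𝕜 := ℝ) i).continuous.comp h.contDiff_deriv_deriv.continuous

theorem continuous_deriv3_coord (h : IsTrack γ) (i : Fin 2) :
    Continuous fun t => deriv (deriv (deriv γ)) t i :=
  (EuclideanSpace.proj (𝕜 := ℝ) i).continuous.comp (h.contDiff_deriv_deriv.continuous_deriv le_rfl)

theorem speed_pos (h : IsTrack γ) (t : ℝ) : 0 < deriv γ t 0 ^ 2 + deriv γ t 1 ^ 2 := by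
  rw [← norm_sq_plane]
  have := norm_pos_iff.mpr (h.regular t)
  positivity

theorem periodic_deriv (h : IsTrack γ) : Function.Periodic (deriv γ) 1 := by
  intro t
  have : (fun s => γ (s + 1)) = γ := funext h.periodic
  rw [← deriv_comp_add_const γ 1 t, this]

theorem periodic_deriv2 (h : IsTrack γ) : Function.Periodic (deriv (deriv γ)) 1 := by
  intro t
  have : (fun s => deriv γ (s + 1)) = deriv γ := funext h.periodic_deriv
  rw [← deriv_comp_add_const (deriv γ) 1 t, this]

theorem pull_add_one_left (h : IsTrack γ) (x y : ℝ) : pull γ (x + 1) y = pull γ x y := by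
  simp only [pull, h.periodic x]

theorem pullY_add_one_left (h : IsTrack γ) (x y : ℝ) : pullY γ (x + 1) y = pullY γ x y := by
  simp only [pullY, h.periodic x]

theorem periodic_pull (h : IsTrack γ) (x : ℝ) : Function.Periodic (pull γ x) 1 := fun y => by
  simp only [pull, h.periodic y, h.periodic_deriv y]

theorem periodic_pullY (h : IsTrack γ) (x : ℝ) : Function.Periodic (pullY γ x) 1 := fun y => by
  simp only [pullY, h.periodic y, h.periodic_deriv y, h.periodic_deriv2 y]

/-- The norms cancel, which leaves an expression rational in the derivatives of γ and easy to
differentiate. -/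
theorem centerOfCurvature_eq (h : IsTrack γ) (t : ℝ) :
    centerOfCurvature γ t = γ t + ((deriv γ t 0 ^ 2 + deriv γ t 1 ^ 2) /
      (deriv γ t 0 * deriv (deriv γ) t 1 - deriv γ t 1 * deriv (deriv γ) t 0)) •
        rot (deriv γ t) := by
  have hne := norm_ne_zero_iff.mpr (h.regular t)
  rw [centerOfCurvature, unitNormal, curvature, smul_smul, ← norm_sq_plane, inv_div]
  congr 2
  field_simp

/-- Transversality to the evolute says that the degenerate zeros of the pull are folds. -/
theorem generic (h : IsTrack γ) (hgen : TransverseToEvolute γ) (x y : ℝ)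
    (h0 : pull γ x y = 0) (hy : pullY γ x y = 0) : pullX γ x y ≠ 0 ∧ pullYY γ x y ≠ 0 := by
  have hN := h.speed_pos y
  have hC := funext h.centerOfCurvature_eq
  have d0 := hasDerivAt_coord (h.hasDerivAt y)
  have d1 := hasDerivAt_coord (h.hasDerivAt_deriv y)
  have d2 := hasDerivAt_coord (h.hasDerivAt_deriv_deriv y)
  simp only [pull, pullX, pullY, pullYY] at *
  set a := deriv γ y 0 with ha
  set b := deriv γ y 1 with hb
  set a₂ := deriv (deriv γ) y 0 with ha₂
  set b₂ := deriv (deriv γ) y 1 with hb₂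
  set a₃ := deriv (deriv (deriv γ)) y 0 with ha₃
  set b₃ := deriv (deriv (deriv γ)) y 1 with hb₃
  set N := a ^ 2 + b ^ 2 with hNdef
  set k := a * b₂ - b * a₂ with hk
  -- A vanishing pull puts γ x on the normal at γ y; r is its coordinate there in units of the
  -- speed. The second equation then reads N = r k, which makes γ x the center of curvature.
  obtain ⟨r, hr0, hr1⟩ : ∃ r, γ x 0 - γ y 0 = -(r * b) ∧ γ x 1 - γ y 1 = r * a := by
    refine ⟨((γ x 1 - γ y 1) * a - (γ x 0 - γ y 0) * b) / N, ?_, ?_⟩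
    · field_simp
      rw [hNdef]
      linear_combination (-a) * h0
    · field_simp
      rw [hNdef]
      linear_combination (-b) * h0
  have hrk : N = r * k := by
    rw [hk]
    linear_combination hy + a₂ * hr0 + b₂ * hr1
  have hk0 : k ≠ 0 := by
    intro hk0
    rw [hk0, mul_zero] at hrk
    exact hN.ne' hrk
  have hr : N / k = r := by
    rw [hrk]
    field_simp
  have hrne : r ≠ 0 := by
    intro hr0
    rw [hr0, zero_mul] at hrk
    exact hN.ne' hrk
  have hcurv : curvature γ y ≠ 0 := by
    rw [curvature]
    exact div_ne_zero hk0 (pow_ne_zero _ (norm_ne_zero_iff.mpr (h.regular y)))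
  have hcenter : γ x = centerOfCurvature γ y := by
    rw [hC]
    simp only
    rw [← ha, ← hb, ← ha₂, ← hb₂, ← hNdef, ← hk, hr]
    refine plane_ext ?_ ?_
    · simp only [rot, PiLp.add_apply, PiLp.smul_apply, smul_eq_mul]
      simp
      linarith
    · simp only [rot, PiLp.add_apply, PiLp.smul_apply, smul_eq_mul]
      simp
      linarith
  have hLI := hgen x y hcurv hcenter
  rw [LinearIndependent.pair_iff] at hLI
  set M := a * a₂ + b * b₂ with hM
  set k' := a * b₃ - b * a₃ with hk'
  have dN : HasDerivAt (fun t => deriv γ t 0 ^ 2 + deriv γ t 1 ^ 2) (2 * M) y :=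
    (((d1 0).pow 2).add ((d1 1).pow 2)).congr_deriv (by
      simp only [hM, ha, hb, ha₂, hb₂]
      push_cast
      ring)
  have dk : HasDerivAt (fun t => deriv γ t 0 * deriv (deriv γ) t 1 -
      deriv γ t 1 * deriv (deriv γ) t 0) k' y :=
    (((d1 0).mul (d2 1)).sub ((d1 1).mul (d2 0))).congr_deriv (by
      simp only [hk', ha, hb, ha₃, hb₃]
      ring)
  set q' := (2 * M * k - N * k') / k ^ 2 with hq'
  have dq : HasDerivAt (fun t => (deriv γ t 0 ^ 2 + deriv γ t 1 ^ 2) /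
      (deriv γ t 0 * deriv (deriv γ) t 1 - deriv γ t 1 * deriv (deriv γ) t 0)) q' y :=
    dN.div dk hk0
  have hq'N : q' * N = 2 * M * r - r ^ 2 * k' := by
    rw [hq', hrk]
    field_simp
  -- The evolute moves along the normal: c is the coefficient of its velocity along `rot (deriv γ
  -- y)`, and the tangential part cancels. At the given zero, c N equals r times `pullYY`.
  set c := (q' * N + r * M) / N with hc
  have hcN : c * N = r * (3 * M - r * k') := by
    rw [hc, div_mul_cancel₀ _ hN.ne', hq'N]
    ring
  have hcN' : c * N = q' * N + r * M := by rw [hc, div_mul_cancel₀ _ hN.ne']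
  have e0 : a + (q' * -b + r * -b₂) = -(c * b) := by
    apply mul_right_cancel₀ hN.ne'
    linear_combination b * hcN' + (a - r * b₂) * hNdef - b * r * hM + a * hrk - a * hNdef +
      a * r * hk
  have e1 : b + (q' * a + r * a₂) = c * a := by
    apply mul_right_cancel₀ hN.ne'
    linear_combination (-a) * hcN' + (b + r * a₂) * hNdef + a * r * hM + b * hrk -
      b * hNdef + b * r * hk
  have dC : HasDerivAt (centerOfCurvature γ) !₂[-(c * b), c * a] y := by
    rw [hC]
    refine hasDerivAt_of_coord fun i => ?_
    fin_cases i
    · refine HasDerivAt.congr_deriv (f' := a + (q' * -b + r * -b₂)) ?_ (by rw [e0]; simp)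
      have := (d0 0).add (dq.mul (d1 1).neg)
      simp only [← ha, ← hb, ← ha₂, ← hb₂] at this
      rw [← hk, ← hNdef, hr] at this
      refine (this.congr_of_eventuallyEq (Eventually.of_forall fun t => ?_))
      simp [rot]
    · refine HasDerivAt.congr_deriv (f' := b + (q' * a + r * a₂)) ?_ (by rw [e1]; simp)
      have := (d0 1).add (dq.mul (d1 0))
      simp only [← ha, ← hb, ← ha₂, ← hb₂] at this
      rw [← hk, ← hNdef, hr] at this
      refine (this.congr_of_eventuallyEq (Eventually.of_forall fun t => ?_))
      simp [rot]
  rw [dC.deriv] at hLI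
  -- If `pullX` vanishes, the velocity at x is also normal to that at y, hence dependent on the
  -- velocity of the evolute. If `pullYY` vanishes, c = 0 and the evolute has velocity 0.
  constructor
  · intro hx0
    obtain ⟨e, he0, he1⟩ : ∃ e, deriv γ x 0 = -(e * b) ∧ deriv γ x 1 = e * a := by
      refine ⟨(deriv γ x 1 * a - deriv γ x 0 * b) / N, ?_, ?_⟩
      · field_simp
        rw [hNdef]
        linear_combination (-a) * hx0
      · field_simp
        rw [hNdef]
        linear_combination (-b) * hx0
    obtain ⟨-, he⟩ := hLI c (-e) (plane_ext (by simp [he0]; ring) (by simp [he1]; ring))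
    rw [neg_eq_zero] at he
    refine h.regular x (plane_ext ?_ ?_)
    · simp [he0, he]
    · simp [he1, he]
  · intro hyy
    have hc0 : c = 0 := by
      have h1 : 3 * M - r * k' = 0 := by
        rw [← hyy, hM, hk']
        linear_combination a₃ * hr0 + b₃ * hr1
      rw [h1, mul_zero] at hcN
      exact (mul_eq_zero.mp hcN).resolve_right hN.ne'
    have := (hLI 0 1 (plane_ext (by simp [hc0]) (by simp [hc0]))).2
    exact one_ne_zero this

theorem isFoldFamily (h : IsTrack γ) (hgen : TransverseToEvolute γ) :
    IsFoldFamily (pull γ) (pullX γ) (pullY γ) (pullYY γ) where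
  cont := (((h.continuous_coord 0).comp continuous_snd |>.sub
      ((h.continuous_coord 0).comp continuous_fst)).mul
        ((h.continuous_deriv_coord 0).comp continuous_snd)).add
    (((h.continuous_coord 1).comp continuous_snd |>.sub
      ((h.continuous_coord 1).comp continuous_fst)).mul
        ((h.continuous_deriv_coord 1).comp continuous_snd))
  cont_x := ((((h.continuous_deriv_coord 0).comp continuous_fst).mul
        ((h.continuous_deriv_coord 0).comp continuous_snd)).add
    (((h.continuous_deriv_coord 1).comp continuous_fst).mul
        ((h.continuous_deriv_coord 1).comp continuous_snd))).neg
  cont_y := ((((h.continuous_deriv_coord 0).comp continuous_snd).pow 2).add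
      (((h.continuous_deriv_coord 1).comp continuous_snd).pow 2)).add
    ((((h.continuous_coord 0).comp continuous_snd |>.sub
      ((h.continuous_coord 0).comp continuous_fst)).mul
        ((h.continuous_deriv2_coord 0).comp continuous_snd)).add
    (((h.continuous_coord 1).comp continuous_snd |>.sub
      ((h.continuous_coord 1).comp continuous_fst)).mul
        ((h.continuous_deriv2_coord 1).comp continuous_snd)))
  cont_yy := (continuous_const.mul ((((h.continuous_deriv_coord 0).comp continuous_snd).mul
        ((h.continuous_deriv2_coord 0).comp continuous_snd)).add
    (((h.continuous_deriv_coord 1).comp continuous_snd).mul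
        ((h.continuous_deriv2_coord 1).comp continuous_snd)))).add
    ((((h.continuous_coord 0).comp continuous_snd |>.sub
      ((h.continuous_coord 0).comp continuous_fst)).mul
        ((h.continuous_deriv3_coord 0).comp continuous_snd)).add
    (((h.continuous_coord 1).comp continuous_snd |>.sub
      ((h.continuous_coord 1).comp continuous_fst)).mul
        ((h.continuous_deriv3_coord 1).comp continuous_snd)))
  deriv_x x y := by
    have d0 := hasDerivAt_coord (h.hasDerivAt x)
    have := (((d0 0).const_sub (γ y 0)).mul_const (deriv γ y 0)).add
      (((d0 1).const_sub (γ y 1)).mul_const (deriv γ y 1))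
    exact this.congr_deriv (by simp only [pullX]; ring)
  deriv_y x y := by
    have d0 := hasDerivAt_coord (h.hasDerivAt y)
    have d1 := hasDerivAt_coord (h.hasDerivAt_deriv y)
    have := (((d0 0).sub_const (γ x 0)).mul (d1 0)).add (((d0 1).sub_const (γ x 1)).mul (d1 1))
    exact this.congr_deriv (by simp only [pullY]; ring)
  deriv_yy x y := by
    have d0 := hasDerivAt_coord (h.hasDerivAt y)
    have d1 := hasDerivAt_coord (h.hasDerivAt_deriv y)
    have d2 := hasDerivAt_coord (h.hasDerivAt_deriv_deriv y)
    have := (((d1 0).pow 2).add ((d1 1).pow 2)).add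
      ((((d0 0).sub_const (γ x 0)).mul (d2 0)).add (((d0 1).sub_const (γ x 1)).mul (d2 1)))
    exact this.congr_deriv (by simp only [pullYY]; push_cast; ring)
  generic := h.generic hgen

/-- The pull near the diagonal. -/
theorem exists_strip (h : IsTrack γ) (hgen : TransverseToEvolute γ) :
    ∃ δ > 0, δ < 1 / 2 ∧ (∀ x y, x < y → y ≤ x + δ → 0 < pull γ x y) ∧
      (∀ x y, x + 1 - δ ≤ y → y < x + 1 → pull γ x y < 0) := by
  have hF := h.isFoldFamily hgen
  have hself : ∀ x, pull γ x x = 0 := fun x => by simp [pull]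
  -- On the diagonal the pull is 0 and `pullY` is the squared speed; compactness of one period makes
  -- the width uniform.
  have key : ∀ᶠ u in 𝓝 (0 : ℝ), ∀ x ∈ Icc (0 : ℝ) 1, 0 < pullY γ x (x + u) := by
    refine isCompact_Icc.eventually_forall_of_forall_eventually fun x _ => ?_
    have hc : Continuous fun z : ℝ × ℝ => pullY γ z.2 (z.2 + z.1) :=
      hF.cont_y.comp (f := fun z : ℝ × ℝ => (z.2, z.2 + z.1)) (by fun_prop)
    refine continuousAt_const.eventually_lt hc.continuousAt ?_
    simpa [pullY] using h.speed_pos x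
  obtain ⟨ε, hε, hb⟩ := Metric.eventually_nhds_iff.mp key
  have hpos : ∀ x u : ℝ, |u| < ε → 0 < pullY γ x (x + u) := by
    intro x u hu
    have h1 := hb (y := u) (by simpa [Real.dist_eq] using hu) (Int.fract x)
      ⟨Int.fract_nonneg x, (Int.fract_lt_one x).le⟩
    have h2 : ∀ y, Function.Periodic (fun x => pullY γ x y) 1 := fun y x =>
      h.pullY_add_one_left x y
    have e1 : pullY γ (Int.fract x) (Int.fract x + u) = pullY γ x (Int.fract x + u) := by
      have := (h2 (Int.fract x + u)).sub_int_mul_eq (x := x) ⌊x⌋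
      simpa [Int.self_sub_floor] using this
    have e2 : pullY γ x (Int.fract x + u) = pullY γ x (x + u) := by
      have := (h.periodic_pullY x).sub_int_mul_eq (x := x + u) ⌊x⌋
      rw [← this]
      congr 1
      rw [Int.fract]
      ring
    rwa [e1, e2] at h1
  refine ⟨min (ε / 2) (1 / 4), by positivity, ?_, fun x y hxy hy => ?_, fun x y hy hyx => ?_⟩
  · linarith [min_le_right (ε / 2) (1 / 4 : ℝ)]
  · have := min_le_left (ε / 2) (1 / 4 : ℝ)
    rw [← hself x]
    refine lt_of_hasDerivAt_pos (hF.deriv_y x) hxy fun z hz => ?_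
    have := hpos x (z - x) (by rw [abs_lt]; constructor <;> linarith [hz.1, hz.2])
    rwa [add_sub_cancel] at this
  · have := min_le_left (ε / 2) (1 / 4 : ℝ)
    have e : pull γ x y = pull γ x (y - 1) := ((h.periodic_pull x).sub_eq y).symm
    rw [e, ← hself x]
    refine lt_of_hasDerivAt_pos (hF.deriv_y x) (by linarith) fun z hz => ?_
    have := hpos x (z - x) (by rw [abs_lt]; constructor <;> linarith [hz.1, hz.2])
    rwa [add_sub_cancel] at this

end IsTrack

/-! ### A human position without folds -/

namespace IsFoldFamily

variable {F Fx Fy Fyy : ℝ → ℝ → ℝ}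

/-- Folds are isolated. -/
theorem eventually_eq_of_fold (h : IsFoldFamily F Fx Fy Fyy) {x₀ y₀ : ℝ} (h0 : F x₀ y₀ = 0)
    (hy : Fy x₀ y₀ = 0) :
    ∀ᶠ p in 𝓝 (x₀, y₀), F p.1 p.2 = 0 → Fy p.1 p.2 = 0 → p = (x₀, y₀) := by
  have aux : ∀ {F Fx Fy Fyy : ℝ → ℝ → ℝ}, IsFoldFamily F Fx Fy Fyy → ∀ {x₀ y₀ : ℝ},
      F x₀ y₀ = 0 → Fy x₀ y₀ = 0 → Fyy x₀ y₀ < 0 → 0 < Fx x₀ y₀ →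
      ∀ᶠ p in 𝓝 (x₀, y₀), F p.1 p.2 = 0 → Fy p.1 p.2 = 0 → p = (x₀, y₀) := by
    intro F Fx Fy Fyy h x₀ y₀ h0 hy hyy hx
    obtain ⟨δ, hδ, -, hbox⟩ := exists_box (P := fun x y => 0 < Fx x y ∧ Fyy x y < 0)
      ((continuousAt_const.eventually_lt h.cont_x.continuousAt hx).and
        (h.cont_yy.continuousAt.eventually_lt continuousAt_const hyy)) one_pos
    have hFy : ∀ x ∈ Icc (x₀ - δ) (x₀ + δ), ∀ y ∈ Icc (y₀ - δ) (y₀ + δ),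
        ∀ z ∈ Icc (y₀ - δ) (y₀ + δ), y < z → Fy x z < Fy x y := fun x hx y hy z hz hyz =>
      lt_of_hasDerivAt_neg (h.deriv_yy x) hyz fun w hw =>
        (hbox x hx w ⟨hy.1.trans hw.1.le, hw.2.le.trans hz.2⟩).2
    have hFx : ∀ y ∈ Icc (y₀ - δ) (y₀ + δ), ∀ x ∈ Icc (x₀ - δ) (x₀ + δ),
        ∀ x' ∈ Icc (x₀ - δ) (x₀ + δ), x < x' → F x y < F x' y := fun y hy x hx x' hx' hlt =>
      lt_of_hasDerivAt_pos (fun z => h.deriv_x z y) hlt fun w hw =>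
        (hbox w ⟨hx.1.trans hw.1.le, hw.2.le.trans hx'.2⟩ y hy).1
    -- By concavity a critical value is the maximum of F x on the box. Since F increases strictly
    -- with x, this maximum cannot be 0 for two values of x.
    have hmax : ∀ x ∈ Icc (x₀ - δ) (x₀ + δ), ∀ y ∈ Icc (y₀ - δ) (y₀ + δ), Fy x y = 0 →
        ∀ z ∈ Icc (y₀ - δ) (y₀ + δ), F x z ≤ F x y := by
      intro x hx y hy hy0 z hz
      rcases lt_trichotomy z y with hlt | rfl | hlt
      · refine (lt_of_hasDerivAt_pos (h.deriv_y x) hlt fun w hw => ?_).le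
        rw [← hy0]
        exact hFy x hx w ⟨hz.1.trans hw.1.le, hw.2.le.trans hy.2⟩ y hy hw.2
      · exact le_rfl
      · refine (lt_of_hasDerivAt_neg (h.deriv_y x) hlt fun w hw => ?_).le
        rw [← hy0]
        exact hFy x hx y hy w ⟨hy.1.trans hw.1.le, hw.2.le.trans hz.2⟩ hw.1
    have hx₀ : x₀ ∈ Icc (x₀ - δ) (x₀ + δ) := ⟨by linarith, by linarith⟩
    have hy₀ : y₀ ∈ Icc (y₀ - δ) (y₀ + δ) := ⟨by linarith, by linarith⟩
    filter_upwards [eventually_box hδ hδ] with p hp hp0 hpy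
    obtain ⟨x₁, y₁⟩ := p
    simp only at hp hp0 hpy
    rcases lt_trichotomy x₁ x₀ with hlt | rfl | hlt
    · linarith [hFx y₁ hp.2 x₁ hp.1 x₀ hx₀ hlt, hmax x₀ hx₀ y₀ hy₀ hy y₁ hp.2]
    · rcases lt_trichotomy y₁ y₀ with hlt | rfl | hlt
      · linarith [hFy x₁ hx₀ y₁ hp.2 y₀ hy₀ hlt]
      · rfl
      · linarith [hFy x₁ hx₀ y₀ hy₀ y₁ hp.2 hlt]
    · linarith [hFx y₀ hy₀ x₀ hx₀ x₁ hp.1 hlt, hmax x₁ hp.1 y₁ hp.2 hpy y₀ hy₀]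
  have aux' : ∀ {F Fx Fy Fyy : ℝ → ℝ → ℝ}, IsFoldFamily F Fx Fy Fyy → ∀ {x₀ y₀ : ℝ},
      F x₀ y₀ = 0 → Fy x₀ y₀ = 0 → Fyy x₀ y₀ < 0 →
      ∀ᶠ p in 𝓝 (x₀, y₀), F p.1 p.2 = 0 → Fy p.1 p.2 = 0 → p = (x₀, y₀) := by
    intro F Fx Fy Fyy h x₀ y₀ h0 hy hyy
    rcases lt_or_gt_of_ne (h.generic _ _ h0 hy).1 with hx | hx
    · have := aux h.reflect_x (x₀ := -x₀) (y₀ := y₀) (by simpa using h0)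
        (by simpa using hy) (by simpa using hyy) (by simpa using hx)
      have ht : Tendsto (fun p : ℝ × ℝ => (-p.1, p.2)) (𝓝 (x₀, y₀)) (𝓝 (-x₀, y₀)) :=
        Continuous.tendsto' (by fun_prop) _ _ rfl
      filter_upwards [ht.eventually this] with p hp hp0 hpy
      have := hp (by simpa using hp0) (by simpa using hpy)
      rw [Prod.mk.injEq, neg_inj] at this
      exact Prod.ext this.1 this.2
    · exact aux h h0 hy hyy hx
  rcases lt_or_gt_of_ne (h.generic _ _ h0 hy).2 with hyy | hyy
  · exact aux' h h0 hy hyy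
  · have := aux' h.reflect_y (x₀ := x₀) (y₀ := -y₀) (by simpa using h0)
      (by simpa using hy) (by simpa using hyy)
    have ht : Tendsto (fun p : ℝ × ℝ => (p.1, -p.2)) (𝓝 (x₀, y₀)) (𝓝 (x₀, -y₀)) :=
      Continuous.tendsto' (by fun_prop) _ _ rfl
    filter_upwards [ht.eventually this] with p hp hp0 hpy
    have := hp (by simpa using hp0) (by simpa using hpy)
    rw [Prod.mk.injEq, neg_inj] at this
    exact Prod.ext this.1 this.2

theorem countable_folds (h : IsFoldFamily F Fx Fy Fyy) :
    {p : ℝ × ℝ | F p.1 p.2 = 0 ∧ Fy p.1 p.2 = 0}.Countable := by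
  have : DiscreteTopology {p : ℝ × ℝ | F p.1 p.2 = 0 ∧ Fy p.1 p.2 = 0} := by
    rw [discreteTopology_subtype_iff]
    rintro p ⟨hp0, hpy⟩
    rw [← disjoint_iff, disjoint_principal_right, mem_nhdsWithin_iff_eventually]
    filter_upwards [h.eventually_eq_of_fold hp0 hpy] with q hq hne hmem
    exact hne (hq hmem.1 hmem.2)
  exact countable_coe_iff.mp countable_of_Lindelof_of_discrete

end IsFoldFamily

/-- A parabola meets every line in finitely many points, so countably many lines cannot cover it.
The candidates for O are taken on the parabola (t, t ^ 2). -/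
theorem finite_parabola_line {a b : ℝ} (c : ℝ) (hab : 0 < a ^ 2 + b ^ 2) :
    {t : ℝ | a * t + b * t ^ 2 = c}.Finite := by
  let P : Polynomial ℝ := Polynomial.C b * Polynomial.X ^ 2 + Polynomial.C a * Polynomial.X +
    Polynomial.C (-c)
  have hP : P ≠ 0 := by
    intro h0
    have h2 : P.coeff 2 = b := by simp [P]
    have h1 : P.coeff 1 = a := by simp [P, Polynomial.coeff_C]
    rw [h0, Polynomial.coeff_zero] at h1 h2
    rw [← h1, ← h2] at hab
    simp at hab
  refine (Polynomial.finite_setOfPred_isRoot hP).subset fun t ht => ?_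
  have ht' : a * t + b * t ^ 2 = c := ht
  change P.eval t = 0
  simp [P]
  linarith

namespace IsTrack

variable {γ : ℝ → Plane}

/-- There is a point `O` such that the point of the track farthest from `O` is no fold position
of the human. -/
theorem exists_farthest (h : IsTrack γ) (hgen : TransverseToEvolute γ) :
    ∃ O₀ O₁ xs : ℝ, (∀ t, (γ t 0 - O₀) ^ 2 + (γ t 1 - O₁) ^ 2 ≤
        (γ xs 0 - O₀) ^ 2 + (γ xs 1 - O₁) ^ 2) ∧
      (γ xs 0 - O₀) * deriv γ xs 0 + (γ xs 1 - O₁) * deriv γ xs 1 = 0 ∧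
      ∀ y, pull γ xs y = 0 → pullY γ xs y ≠ 0 := by
  have hF := h.isFoldFamily hgen
  -- The forbidden t are those for which (t, t ^ 2) lies on the normal of the track at the human's
  -- position in some fold. The point farthest from O has O on its normal, so a permitted t keeps it
  -- off the folds.
  have hcount : (⋃ p ∈ {p : ℝ × ℝ | pull γ p.1 p.2 = 0 ∧ pullY γ p.1 p.2 = 0},
      {t : ℝ | deriv γ p.1 0 * t + deriv γ p.1 1 * t ^ 2 =
        deriv γ p.1 0 * γ p.1 0 + deriv γ p.1 1 * γ p.1 1}).Countable :=
    hF.countable_folds.biUnion fun p _ => (finite_parabola_line _ (h.speed_pos p.1)).countable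
  obtain ⟨t, ht⟩ : ∃ t : ℝ, t ∉ ⋃ p ∈ {p : ℝ × ℝ | pull γ p.1 p.2 = 0 ∧ pullY γ p.1 p.2 = 0},
      {t : ℝ | deriv γ p.1 0 * t + deriv γ p.1 1 * t ^ 2 =
        deriv γ p.1 0 * γ p.1 0 + deriv γ p.1 1 * γ p.1 1} := by
    by_contra! hall
    exact not_countable_univ (α := ℝ) (hcount.mono fun t _ => hall t)
  let f : ℝ → ℝ := fun s => (γ s 0 - t) ^ 2 + (γ s 1 - t ^ 2) ^ 2
  have hfc : Continuous f := (((h.continuous_coord 0).sub continuous_const).pow 2).add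
    (((h.continuous_coord 1).sub continuous_const).pow 2)
  have hfp : Function.Periodic f 1 := fun s => by simp only [f, h.periodic s]
  obtain ⟨xs, -, hmax⟩ := isCompact_Icc.exists_isMaxOn
    (nonempty_Icc.mpr (zero_le_one (α := ℝ))) hfc.continuousOn
  have hglob : ∀ s, f s ≤ f xs := by
    intro s
    have h1 : f s = f (Int.fract s) := by
      have := hfp.sub_int_mul_eq (x := s) ⌊s⌋
      rw [← this, mul_one, Int.self_sub_floor]
    rw [h1]
    exact hmax ⟨Int.fract_nonneg s, (Int.fract_lt_one s).le⟩
  have hder : HasDerivAt f (2 * ((γ xs 0 - t) * deriv γ xs 0 + (γ xs 1 - t ^ 2) * deriv γ xs 1))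
      xs := by
    have d0 := hasDerivAt_coord (h.hasDerivAt xs)
    exact ((((d0 0).sub_const t).pow 2).add (((d0 1).sub_const (t ^ 2)).pow 2)).congr_deriv
      (by push_cast; ring)
  have hcrit := IsLocalMax.hasDerivAt_eq_zero (Eventually.of_forall hglob) hder
  refine ⟨t, t ^ 2, xs, hglob, by linarith, fun y h0 hy => ht ?_⟩
  refine mem_iUnion₂.mpr ⟨(xs, y), ⟨h0, hy⟩, ?_⟩
  change deriv γ xs 0 * t + deriv γ xs 1 * t ^ 2 = _
  linarith

end IsTrack

/-! ### Continua of zeros -/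

/-- Between two paths on which `G` has opposite signs there is a continuum of zeros. -/
theorem exists_continuum_between {G : ℝ × ℝ → ℝ} (hG : Continuous G) {W : Set (ℝ × ℝ)}
    (hW : Convex ℝ W) {p₀ p₁ q₀ q₁ : ℝ × ℝ} (hp : JoinedIn {p ∈ W | G p < 0} p₀ p₁)
    (hq : JoinedIn {p ∈ W | 0 < G p} q₀ q₁) :
    ∃ K ⊆ W, IsCompact K ∧ IsPreconnected K ∧ (∀ p ∈ K, G p = 0) ∧
      (∃ p ∈ K, p ∈ openSegment ℝ p₀ q₀) ∧ ∃ p ∈ K, p ∈ openSegment ℝ p₁ q₁ := by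
  obtain ⟨P, hP⟩ := hp
  obtain ⟨Q, hQ⟩ := hq
  -- The straight-line homotopy between the two paths stays in the convex set W, and G ∘ A has
  -- opposite signs on the bottom and top of the square.
  let A : ℝ × ℝ → ℝ × ℝ := fun z => (1 - z.2) • P.extend z.1 + z.2 • Q.extend z.1
  have hA : Continuous A := by
    have h1 := P.continuous_extend
    have h2 := Q.continuous_extend
    fun_prop
  have hPm : ∀ s, P.extend s ∈ {p ∈ W | G p < 0} := fun s => hP _
  have hQm : ∀ s, Q.extend s ∈ {p ∈ W | 0 < G p} := fun s => hQ _
  have hA0 : ∀ s, A (s, 0) = P.extend s := fun s => by simp [A]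
  have hA1 : ∀ s, A (s, 1) = Q.extend s := fun s => by simp [A]
  obtain ⟨K, hKQ, hKc, hKp, hK0, ⟨t₀, ht₀⟩, t₁, ht₁⟩ := exists_continuum_of_zeros
    (g := fun z => G (A z)) (hG.comp hA)
    (fun s _ => by simp only [hA0]; exact (hPm s).2)
    (fun s _ => by simp only [hA1]; exact (hQm s).2)
  have hint : ∀ s t, (s, t) ∈ K → 0 < t ∧ t < 1 := by
    intro s t hst
    have h1 := hKQ hst
    have h2 := hK0 _ hst
    refine ⟨lt_of_le_of_ne h1.2.1 ?_, lt_of_le_of_ne h1.2.2 ?_⟩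
    · intro he
      rw [← he, hA0] at h2
      exact (hPm s).2.ne h2
    · intro he
      rw [he, hA1] at h2
      exact (hQm s).2.ne' h2
  refine ⟨A '' K, ?_, hKc.image hA, hKp.image _ hA.continuousOn, ?_, ⟨A (0, t₀),
    mem_image_of_mem _ ht₀, ?_⟩, ⟨A (1, t₁), mem_image_of_mem _ ht₁, ?_⟩⟩
  · rintro _ ⟨⟨s, t⟩, hst, rfl⟩
    have := hint s t hst
    exact hW (hPm s).1 (hQm s).1 (by simp only; linarith) this.1.le (by simp)
  · rintro _ ⟨z, hz, rfl⟩
    exact hK0 z hz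
  · have := hint _ _ ht₀
    exact ⟨1 - t₀, t₀, by linarith, this.1, by ring, by simp [A]⟩
  · have := hint _ _ ht₁
    exact ⟨1 - t₁, t₁, by linarith, this.1, by ring, by simp [A]⟩

/-! ### Two opposite barriers are impossible -/

/-- The part of the strip `x < y < x + 1` over `[c, c + 1]`. -/
def slab (c : ℝ) : Set (ℝ × ℝ) := {p | c ≤ p.1 ∧ p.1 ≤ c + 1 ∧ p.1 < p.2 ∧ p.2 < p.1 + 1}

theorem convex_slab (c : ℝ) : Convex ℝ (slab c) := by
  rintro ⟨x, y⟩ ⟨h1, h2, h3, h4⟩ ⟨x', y'⟩ ⟨h1', h2', h3', h4'⟩ a b ha hb hab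
  simp only at h1 h2 h3 h4 h1' h2' h3' h4'
  obtain rfl : a = 1 - b := by linarith
  refine ⟨?_, ?_, ?_, ?_⟩ <;> simp only [Prod.smul_mk, Prod.mk_add_mk, smul_eq_mul]
  · nlinarith
  · nlinarith
  · rcases hb.eq_or_lt with rfl | hb
    · simpa using h3
    · nlinarith
  · rcases hb.eq_or_lt with rfl | hb
    · simpa using h4
    · nlinarith

theorem of_mem_openSegment_vertical {x u v : ℝ} (huv : u < v) {p : ℝ × ℝ}
    (hp : p ∈ openSegment ℝ (x, u) (x, v)) : ∃ y, p = (x, y) ∧ u < y ∧ y < v := by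
  obtain ⟨a, b, ha, hb, hab, rfl⟩ := hp
  obtain rfl : a = 1 - b := by linarith
  refine ⟨(1 - b) * u + b * v, ?_, by nlinarith, by nlinarith⟩
  simp only [Prod.smul_mk, Prod.mk_add_mk, smul_eq_mul, Prod.mk.injEq, and_true]
  ring

/-- A path crossing the slab separates the points of its left side. -/
theorem not_joined_across {G : ℝ × ℝ → ℝ} {c a₁ a₂ y₁ y₂ : ℝ} {K : Set (ℝ × ℝ)}
    (hKc : IsCompact K) (hKp : IsPreconnected K) (hKs : K ⊆ slab c) (hK0 : ∀ p ∈ K, G p = 0)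
    (hJ : JoinedIn {p ∈ slab c | G p < 0} (c, a₁) (c + 1, a₂)) (h1 : (c, y₁) ∈ K)
    (h2 : (c, y₂) ∈ K) (hy₁ : y₁ < a₁) (hy₂ : a₁ < y₂) : False := by
  let B : Set (ℝ × ℝ) := {p | c ≤ p.1 ∧ p ∉ K}
  have hright : ∀ x y, c + 1 < x → (x, y) ∈ B := fun x y hx =>
    ⟨by simp only; linarith, fun hK => by
      have := (hKs hK).2.1
      simp only at this
      linarith⟩
  -- All heights in the slab are below c + 2. The negative path, prolonged around the right of the
  -- slab and back at height c + 3, ends on the left side above y₂, so its ends interleave with y₁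
  -- and y₂.
  have htop : ∀ x, c ≤ x → (x, c + 3) ∈ B := fun x hx => ⟨hx, fun hK => by
    obtain ⟨-, h3, -, h4⟩ := hKs hK
    simp only at h3 h4
    linarith⟩
  have hJ1 : JoinedIn B (c, a₁) (c + 1, a₂) := hJ.mono fun p hp =>
    ⟨hp.1.1, fun hK => hp.2.ne (hK0 p hK)⟩
  have hJ2 : JoinedIn B (c + 1, a₂) (c + 2, a₂) := by
    refine joinedIn_horizontal fun x hx => ?_
    rw [uIcc_of_le (by linarith)] at hx
    rcases hx.1.eq_or_lt with rfl | hlt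
    · exact hJ1.target_mem
    · exact hright x a₂ hlt
  have hJ3 : JoinedIn B (c + 2, a₂) (c + 2, c + 3) :=
    joinedIn_vertical fun y _ => hright _ _ (by linarith)
  have hJ4 : JoinedIn B (c + 2, c + 3) (c, c + 3) := by
    refine joinedIn_horizontal fun x hx => htop x ?_
    rw [uIcc_of_ge (by linarith)] at hx
    exact hx.1
  obtain ⟨P, hP⟩ := ((hJ1.trans hJ2).trans hJ3).trans hJ4
  let A : ℝ × ℝ → ℝ × ℝ := fun p => (p.2, -p.1)
  have hA : Continuous A := by fun_prop
  have hAinj : Function.Injective A := fun p q hpq => by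
    simp only [A, Prod.mk.injEq, neg_inj] at hpq
    exact Prod.ext hpq.2 hpq.1
  have hPB : range P ⊆ B := by
    rintro _ ⟨t, rfl⟩
    exact hP t
  have hy₂' : y₂ < c + 3 := by
    obtain ⟨-, h3, -, h4⟩ := hKs h2
    simp only at h3 h4
    linarith
  refine not_interleaved_continua (K₁ := A '' K) (K₂ := A '' range P) (H := -c)
    (hKc.image hA) ((isCompact_range P.continuous).image hA) (hKp.image _ hA.continuousOn)
    ((isPreconnected_range P.continuous).image _ hA.continuousOn) ?_ ?_ ?_ hy₁ hy₂ hy₂'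
    ⟨_, h1, rfl⟩ ⟨_, ⟨0, P.source⟩, rfl⟩ ⟨_, h2, rfl⟩ ⟨_, ⟨1, P.target⟩, rfl⟩
  · rw [disjoint_image_iff hAinj, Set.disjoint_left]
    exact fun p hp hp' => (hPB hp').2 hp
  · rintro _ ⟨p, hp, rfl⟩
    exact neg_le_neg (hKs hp).1
  · rintro _ ⟨p, hp, rfl⟩
    exact neg_le_neg (hPB hp).1

theorem pos_of_sq_mul_le {r m : ℝ} (hm : 0 < m) (hr : r ≠ 0) (h : (1 - r) ^ 2 * m ≤ m) : 0 < r := by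
  by_contra! hle
  have hlt : r < 0 := lt_of_le_of_ne hle hr
  have : 0 < r * (r - 2) := mul_pos_of_neg_of_neg hlt (by linarith)
  nlinarith [mul_pos this hm]

/-- A ray from a point of a disc through a boundary point leaves the disc there. -/
theorem ray_leaves_disc {A B u v r r' : ℝ} (hM : 0 < u ^ 2 + v ^ 2) (hr : 0 < r) (hlt : r < r')
    (h₁ : (A - r * u) ^ 2 + (B + r * v) ^ 2 ≤ A ^ 2 + B ^ 2) :
    A ^ 2 + B ^ 2 < (A + (r' - r) * u) ^ 2 + (B - (r' - r) * v) ^ 2 := by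
  have f3 : r * (r * (u ^ 2 + v ^ 2)) ≤ r * (2 * (A * u - B * v)) := by nlinarith
  have f4 : r * (u ^ 2 + v ^ 2) ≤ 2 * (A * u - B * v) := le_of_mul_le_mul_left f3 hr
  have f5 : 0 < A * u - B * v := by nlinarith [mul_pos hr hM]
  have f6 : 0 < r' - r := by linarith
  nlinarith [mul_pos f6 f5, mul_pos (mul_pos f6 f6) hM]

/-! ### Normal coordinates for the zeros of the pull, and the crossing argument. -/

namespace IsTrack

variable {γ : ℝ → Plane}

theorem eq_of_eq_of_abs_lt (h : IsTrack γ) {s t : ℝ} (he : γ s = γ t) (hst : |s - t| < 1) :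
    s = t := by
  obtain ⟨n, hn⟩ := h.simple s t he
  have : |(n : ℝ)| < 1 := by
    rw [show (n : ℝ) = -(s - t) by linarith, abs_neg]
    exact hst
  have hn0 : n = 0 := Int.abs_lt_one_iff.mp (by exact_mod_cast this)
  rw [hn, hn0]
  simp

/-- The zeros of the pull, described by the position `y` of the puppy and the signed distance `ρ`,
in units depending on `y`, at which the human is found on the normal line at `γ y`. -/
theorem exists_polar (h : IsTrack γ) {O₀ O₁ xs : ℝ}
    (hfar : ∀ t, (γ t 0 - O₀) ^ 2 + (γ t 1 - O₁) ^ 2 ≤ (γ xs 0 - O₀) ^ 2 + (γ xs 1 - O₁) ^ 2)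
    (hcrit : (γ xs 0 - O₀) * deriv γ xs 0 + (γ xs 1 - O₁) * deriv γ xs 1 = 0) :
    ∃ ρ : ℝ × ℝ → ℝ, Continuous ρ ∧ (∀ p ∈ slab xs, pull γ p.1 p.2 = 0 → ρ p ≠ 0) ∧
      (∀ p ∈ slab xs, ∀ q ∈ slab xs, pull γ p.1 p.2 = 0 → pull γ q.1 q.2 = 0 →
        p.2 = q.2 → ρ p = ρ q → p = q) ∧
      (∀ p ∈ slab xs, pull γ p.1 p.2 = 0 → p.2 = xs + 1 → 0 < ρ p) ∧
      ∀ m ∈ slab xs, (m.1 = xs ∨ m.1 = xs + 1) → pull γ m.1 m.2 = 0 → 0 < ρ m →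
        ∀ k ∈ slab xs, pull γ k.1 k.2 = 0 → k.2 = m.2 → ρ m ≤ ρ k → k = m := by
  have hN := h.speed_pos
  -- The critical point condition puts O on the normal at γ xs. The constant c fixes the sign and
  -- unit of ρ so that O has ρ = 1 on this normal.
  obtain ⟨c, hc0, hc1⟩ : ∃ c, γ xs 0 - O₀ = -(c * deriv γ xs 1) ∧
      γ xs 1 - O₁ = c * deriv γ xs 0 := by
    have hNx := (hN xs).ne'
    refine ⟨((γ xs 1 - O₁) * deriv γ xs 0 - (γ xs 0 - O₀) * deriv γ xs 1) /
      (deriv γ xs 0 ^ 2 + deriv γ xs 1 ^ 2), ?_, ?_⟩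
    · field_simp
      linear_combination deriv γ xs 0 * hcrit
    · field_simp
      linear_combination deriv γ xs 1 * hcrit
  -- Otherwise γ xs = O would be at maximal distance 0 and the whole track would be one point.
  have hcne : c ≠ 0 := by
    rintro rfl
    have hO : ∀ t, γ t 0 = O₀ ∧ γ t 1 = O₁ := by
      intro t
      have := hfar t
      rw [hc0, hc1] at this
      constructor <;> nlinarith [sq_nonneg (γ t 0 - O₀), sq_nonneg (γ t 1 - O₁)]
    have := h.eq_of_eq_of_abs_lt (s := 0) (t := 1 / 2)
      (plane_ext ((hO 0).1.trans (hO _).1.symm) ((hO 0).2.trans (hO _).2.symm))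
      (by norm_num [abs_lt])
    norm_num at this
  let ρ : ℝ × ℝ → ℝ := fun p => ((γ p.1 0 - γ p.2 0) * deriv γ p.2 1 -
    (γ p.1 1 - γ p.2 1) * deriv γ p.2 0) / (c * (deriv γ p.2 0 ^ 2 + deriv γ p.2 1 ^ 2))
  have hρc : Continuous ρ := by
    refine Continuous.div ?_ ?_ fun p => mul_ne_zero hcne (hN p.2).ne'
    · exact ((((h.continuous_coord 0).comp continuous_fst).sub
        ((h.continuous_coord 0).comp continuous_snd)).mul
          ((h.continuous_deriv_coord 1).comp continuous_snd)).sub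
        ((((h.continuous_coord 1).comp continuous_fst).sub
        ((h.continuous_coord 1).comp continuous_snd)).mul
          ((h.continuous_deriv_coord 0).comp continuous_snd))
    · exact continuous_const.mul ((((h.continuous_deriv_coord 0).comp continuous_snd).pow 2).add
        (((h.continuous_deriv_coord 1).comp continuous_snd).pow 2))
  have hρ : ∀ x y, pull γ x y = 0 → γ x 0 = γ y 0 + ρ (x, y) * (c * deriv γ y 1) ∧
      γ x 1 = γ y 1 - ρ (x, y) * (c * deriv γ y 0) := by
    intro x y h0
    have hNy := (hN y).ne'
    simp only [pull] at h0
    simp only [ρ]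
    constructor
    · field_simp
      linear_combination (-deriv γ y 0) * h0
    · field_simp
      linear_combination (-deriv γ y 1) * h0
  have hρne : ∀ p ∈ slab xs, pull γ p.1 p.2 = 0 → ρ p ≠ 0 := by
    rintro ⟨x, y⟩ ⟨-, -, h3, h4⟩ h0 hρ0
    simp only at h3 h4 h0
    obtain ⟨e0, e1⟩ := hρ x y h0
    rw [hρ0] at e0 e1
    have := h.eq_of_eq_of_abs_lt (s := x) (t := y) (plane_ext (by linarith) (by linarith))
      (by rw [abs_lt]; constructor <;> linarith)
    linarith
  have hinj : ∀ p ∈ slab xs, ∀ q ∈ slab xs, pull γ p.1 p.2 = 0 → pull γ q.1 q.2 = 0 →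
      p.2 = q.2 → ρ p = ρ q → p = q := by
    rintro ⟨x, y⟩ ⟨-, -, h3, h4⟩ ⟨x', y'⟩ ⟨-, -, h3', h4'⟩ h0 h0' hy hρe
    simp only at h3 h4 h3' h4' h0 h0' hy
    subst hy
    obtain ⟨e0, e1⟩ := hρ x y h0
    obtain ⟨e0', e1'⟩ := hρ x' y h0'
    rw [hρe] at e0 e1
    rw [h.eq_of_eq_of_abs_lt (s := x) (t := x') (plane_ext (by linarith) (by linarith))
      (by rw [abs_lt]; constructor <;> linarith)]
  have hγ1 : γ (xs + 1) = γ xs := h.periodic xs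
  have hγ1' : deriv γ (xs + 1) = deriv γ xs := h.periodic_deriv xs
  refine ⟨ρ, hρc, hρne, hinj, ?_, ?_⟩
  · rintro ⟨x, w⟩ hq hq0 hw
    simp only at hq0 hw
    subst hw
    obtain ⟨e0, e1⟩ := hρ x _ hq0
    have hne := hρne _ hq hq0
    have hx := hfar x
    rw [e0, e1, hγ1, hγ1'] at hx
    generalize ρ (x, xs + 1) = r at hx hne ⊢
    have hM : 0 < c ^ 2 * (deriv γ xs 0 ^ 2 + deriv γ xs 1 ^ 2) :=
      mul_pos (by positivity) (hN xs)
    -- With the puppy at γ xs, the human is on the normal through O and in the disc around O, so |1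
    -- - ρ| ≤ 1; and ρ ≠ 0.
    refine pos_of_sq_mul_le hM hne ?_
    have e2 : γ xs 0 + r * (c * deriv γ xs 1) - O₀ = -((1 - r) * (c * deriv γ xs 1)) := by
      linear_combination hc0
    have e3 : γ xs 1 - r * (c * deriv γ xs 0) - O₁ = (1 - r) * (c * deriv γ xs 0) := by
      linear_combination hc1
    rw [e2, e3, hc0, hc1] at hx
    linarith
  · rintro ⟨x, y⟩ hm hx h0 hρm ⟨x', y'⟩ hk hk0 hy hle
    simp only at hx h0 hk0 hy
    subst hy
    rcases hle.eq_or_lt with he | hlt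
    · exact (hinj _ hm _ hk h0 hk0 rfl he).symm
    exfalso
    have hγx : γ x = γ xs := by
      rcases hx with rfl | rfl
      · rfl
      · exact hγ1
    obtain ⟨e0, e1⟩ := hρ x y' h0
    obtain ⟨e0', e1'⟩ := hρ x' y' hk0
    rw [hγx] at e0 e1
    have f1 := hfar y'
    have f2 := hfar x'
    have hM : 0 < (c * deriv γ y' 1) ^ 2 + (c * deriv γ y' 0) ^ 2 := by
      have := mul_pos (show 0 < c ^ 2 by positivity) (hN y')
      linarith
    have g1 : γ y' 0 - O₀ = γ xs 0 - O₀ - ρ (x, y') * (c * deriv γ y' 1) := by linarith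
    have g2 : γ y' 1 - O₁ = γ xs 1 - O₁ + ρ (x, y') * (c * deriv γ y' 0) := by linarith
    have g3 : γ x' 0 - O₀ = γ xs 0 - O₀ + (ρ (x', y') - ρ (x, y')) * (c * deriv γ y' 1) := by
      linarith
    have g4 : γ x' 1 - O₁ = γ xs 1 - O₁ - (ρ (x', y') - ρ (x, y')) * (c * deriv γ y' 0) := by
      linarith
    rw [g1, g2] at f1
    rw [g3, g4] at f2
    exact absurd f2 (not_le.mpr (ray_leaves_disc hM hρm hlt f1))

/-- There is no pair of a path in `pull < 0` and a path in `pull > 0` above it, both crossing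
the slab over a whole turn starting at a point of the track farthest from some point `O`. -/
theorem not_opposite_barriers (h : IsTrack γ) (hgen : TransverseToEvolute γ) {O₀ O₁ xs : ℝ}
    (hfar : ∀ t, (γ t 0 - O₀) ^ 2 + (γ t 1 - O₁) ^ 2 ≤ (γ xs 0 - O₀) ^ 2 + (γ xs 1 - O₁) ^ 2)
    (hcrit : (γ xs 0 - O₀) * deriv γ xs 0 + (γ xs 1 - O₁) * deriv γ xs 1 = 0)
    {δ : ℝ} (hδ : 0 < δ) (hδ1 : δ < 1 / 2)
    (hstrip : ∀ x y, x < y → y ≤ x + δ → 0 < pull γ x y) {a₁ a₂ b₁ b₂ : ℝ}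
    (ha₁ : xs + δ < a₁) (ha₂ : xs + 1 + δ < a₂) (hab₁ : a₁ < b₁) (hab₂ : a₂ < b₂)
    (hneg : JoinedIn {p ∈ slab xs | pull γ p.1 p.2 < 0} (xs, a₁) (xs + 1, a₂))
    (hpos : JoinedIn {p ∈ slab xs | 0 < pull γ p.1 p.2} (xs, b₁) (xs + 1, b₂)) : False := by
  have hF := h.isFoldFamily hgen
  -- The third sign region is a segment parallel to the diagonal, below the negative path at both
  -- ends.
  have hbot : JoinedIn {p ∈ slab xs | 0 < pull γ p.1 p.2} (xs, xs + δ) (xs + 1, xs + 1 + δ) := by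
    refine JoinedIn.of_segment_subset ?_
    rintro _ ⟨a, b, ha, hb, hab, rfl⟩
    obtain rfl : a = 1 - b := by linarith
    have e : (1 - b) • (xs, xs + δ) + b • (xs + 1, xs + 1 + δ) = (xs + b, xs + b + δ) := by
      simp only [Prod.smul_mk, Prod.mk_add_mk, smul_eq_mul, Prod.mk.injEq]
      constructor <;> ring
    rw [e]
    exact ⟨⟨by simp only; linarith, by simp only; linarith, by simp only; linarith,
      by simp only; linarith⟩, hstrip _ _ (by simp only; linarith) le_rfl⟩
  obtain ⟨K₁, hs₁, hc₁, hp₁, hz₁, ⟨m₁, hm₁, hm₁'⟩, n₁, hn₁, hn₁'⟩ :=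
    exists_continuum_between (G := fun p => pull γ p.1 p.2) hF.cont (convex_slab xs) hneg hbot
  obtain ⟨K₂, hs₂, hc₂, hp₂, hz₂, ⟨m₂, hm₂, hm₂'⟩, n₂, hn₂, hn₂'⟩ :=
    exists_continuum_between (G := fun p => pull γ p.1 p.2) hF.cont (convex_slab xs) hneg hpos
  rw [openSegment_symm] at hm₁' hn₁'
  obtain ⟨y₁, rfl, hy₁, hy₁'⟩ := of_mem_openSegment_vertical ha₁ hm₁'
  obtain ⟨z₁, rfl, hz₁l, hz₁r⟩ := of_mem_openSegment_vertical ha₂ hn₁'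
  obtain ⟨y₂, rfl, hy₂, hy₂'⟩ := of_mem_openSegment_vertical hab₁ hm₂'
  obtain ⟨z₂, rfl, hz₂l, hz₂r⟩ := of_mem_openSegment_vertical hab₂ hn₂'
  -- If they met, their union would be a continuum of zeros with points on both sides of the start
  -- of the negative path.
  have hdisj : Disjoint K₁ K₂ := by
    rw [Set.disjoint_iff_inter_eq_empty, ← Set.not_nonempty_iff_eq_empty]
    intro hne
    exact not_joined_across (G := fun p => pull γ p.1 p.2) (hc₁.union hc₂)
      (hp₁.union' hne hp₂) (union_subset hs₁ hs₂)
      (fun p hp => hp.elim (hz₁ p) (hz₂ p)) hneg (Or.inl hm₁) (Or.inr hm₂) hy₁' hy₂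
  obtain ⟨ρ, hρc, hρne, hinj, hρfar, hray⟩ := h.exists_polar hfar hcrit
  -- `ρ` is positive on the continua
  have hρpos : ∀ K ⊆ slab xs, IsPreconnected K → (∀ p ∈ K, pull γ p.1 p.2 = 0) →
      ∀ y z, (xs, y) ∈ K → (xs + 1, z) ∈ K → ∀ p ∈ K, 0 < ρ p := by
    intro K hKs hKp hK0 y z hy hz p hp
    -- K begins with y < xs + 1 and ends with y > xs + 1, so the puppy passes xs + 1, where ρ > 0.
    -- As ρ never vanishes on the connected set K, its sign is constant.
    obtain ⟨q, hqK, hq⟩ : ∃ q ∈ K, q.2 = xs + 1 := by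
      have h1 := (hKs hy).2.2.2
      have h2 := (hKs hz).2.2.1
      exact hKp.intermediate_value hy hz continuous_snd.continuousOn ⟨h1.le, h2.le⟩
    have hq0 : 0 < ρ q := hρfar q (hKs hqK) (hK0 q hqK) hq
    by_contra! hle
    obtain ⟨w, hwK, hw⟩ := hKp.intermediate_value hp hqK hρc.continuousOn ⟨hle, hq0.le⟩
    exact hρne w (hKs hwK) (hK0 w hwK) hw
  have hρ₁ := hρpos K₁ hs₁ hp₁ hz₁ _ _ hm₁ hn₁
  have hρ₂ := hρpos K₂ hs₂ hp₂ hz₂ _ _ hm₂ hn₂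
  obtain ⟨H, hH⟩ := (((hc₁.union hc₂).image hρc).bddAbove)
  have hHρ : ∀ k ∈ K₁ ∪ K₂, ρ k ≤ H := fun k hk => hH (mem_image_of_mem _ hk)
  let Ψ : ℝ × ℝ → ℝ × ℝ := fun p => (p.2, ρ p)
  have hΨ : Continuous Ψ := continuous_snd.prodMk hρc
  -- The vertical segment above Ψ m is the prolonged normal ray; for an end m of a continuum it
  -- meets no other image of a zero of K₁ ∪ K₂.
  let R : ℝ × ℝ → Set (ℝ × ℝ) := fun m => {m.2} ×ˢ Icc (ρ m) H
  have hRc : ∀ m, IsCompact (R m) := fun m => isCompact_singleton.prod isCompact_Icc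
  have hRp : ∀ m, IsPreconnected (R m) := fun m => isPreconnected_singleton.prod isPreconnected_Icc
  have hRm : ∀ m ∈ K₁ ∪ K₂, Ψ m ∈ R m := fun m hm => ⟨rfl, le_rfl, hHρ m hm⟩
  have hRt : ∀ m ∈ K₁ ∪ K₂, (m.2, H) ∈ R m := fun m hm => ⟨rfl, hHρ m hm, le_rfl⟩
  have hconn : ∀ K ⊆ K₁ ∪ K₂, IsPreconnected K → ∀ m ∈ K, ∀ n ∈ K,
      IsPreconnected (Ψ '' K ∪ R m ∪ R n) := fun K hK hKp m hm n hn =>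
    ((hKp.image _ hΨ.continuousOn).union (Ψ m) (mem_image_of_mem _ hm) (hRm m (hK hm))
      (hRp m)).union (Ψ n) (Or.inl (mem_image_of_mem _ hn)) (hRm n (hK hn)) (hRp n)
  have hbd : ∀ K ⊆ K₁ ∪ K₂, ∀ m n, ∀ p ∈ Ψ '' K ∪ R m ∪ R n, p.2 ≤ H := by
    rintro K hK m n p ((⟨k, hk, rfl⟩ | hp) | hp)
    · exact hHρ k (hK hk)
    · exact hp.2.2
    · exact hp.2.2
  have hzero : ∀ k ∈ K₁ ∪ K₂, k ∈ slab xs ∧ pull γ k.1 k.2 = 0 ∧ 0 < ρ k := by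
    rintro k (hk | hk)
    · exact ⟨hs₁ hk, hz₁ k hk, hρ₁ k hk⟩
    · exact ⟨hs₂ hk, hz₂ k hk, hρ₂ k hk⟩
  have hdisjR : ∀ k ∈ K₁ ∪ K₂, ∀ m ∈ K₁ ∪ K₂, (m.1 = xs ∨ m.1 = xs + 1) → Ψ k ∈ R m → k = m := by
    intro k hk m hm hmx hkm
    obtain ⟨h1, h2, -⟩ := hzero k hk
    obtain ⟨h1', h2', h3'⟩ := hzero m hm
    exact hray m h1' hmx h2' h3' k h1 h2 hkm.1 hkm.2.1
  have hl : K₁ ⊆ K₁ ∪ K₂ := subset_union_left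
  have hr : K₂ ⊆ K₁ ∪ K₂ := subset_union_right
  have hnd : ∀ p, p ∈ K₁ → p ∉ K₂ := fun p hp => Set.disjoint_left.mp hdisj hp
  -- This gives the interleaving y₁ < y₂ < z₁ < z₂: left ends have y < xs + 1, right ends y > xs +
  -- 1.
  have hy₂x : y₂ < xs + 1 := (hs₂ hm₂).2.2.2
  refine not_interleaved_continua (K₁ := Ψ '' K₁ ∪ R (xs, y₁) ∪ R (xs + 1, z₁))
    (K₂ := Ψ '' K₂ ∪ R (xs, y₂) ∪ R (xs + 1, z₂)) (H := H) (a := y₁) (b := y₂) (c := z₁) (d := z₂)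
    (((hc₁.image hΨ).union (hRc _)).union (hRc _))
    (((hc₂.image hΨ).union (hRc _)).union (hRc _))
    (hconn K₁ hl hp₁ _ hm₁ _ hn₁) (hconn K₂ hr hp₂ _ hm₂ _ hn₂) ?_ (hbd K₁ hl _ _) (hbd K₂ hr _ _)
    (by linarith) (by linarith) (by linarith)
    (Or.inl (Or.inr (hRt _ (hl hm₁)))) (Or.inl (Or.inr (hRt _ (hr hm₂))))
    (Or.inr (hRt _ (hl hn₁))) (Or.inr (hRt _ (hr hn₂)))
  have hRR : ∀ m n p, p ∈ R m → p ∈ R n → m.2 = n.2 := fun m n p h1 h2 =>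
    (show p.1 = m.2 from h1.1).symm.trans h2.1
  rw [Set.disjoint_left]
  rintro p ((⟨k, hk, rfl⟩ | hp) | hp) ((⟨k', hk', he⟩ | hp') | hp')
  · obtain ⟨h1, h2, -⟩ := hzero k (hl hk)
    obtain ⟨h1', h2', -⟩ := hzero k' (hr hk')
    have e1 := congrArg Prod.fst he
    have e2 := congrArg Prod.snd he
    have := hinj k' h1' k h1 h2' h2 e1 e2
    exact hnd k hk (this ▸ hk')
  · have := hdisjR k (hl hk) _ (hr hm₂) (Or.inl rfl) hp'
    exact hnd k hk (this ▸ hm₂)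
  · have := hdisjR k (hl hk) _ (hr hn₂) (Or.inr rfl) hp'
    exact hnd k hk (this ▸ hn₂)
  · rw [← he] at hp
    have := hdisjR k' (hr hk') _ (hl hm₁) (Or.inl rfl) hp
    exact hnd k' (this ▸ hm₁) hk'
  · have := hRR _ _ _ hp hp'
    simp only at this
    linarith
  · have := hRR _ _ _ hp hp'
    simp only at this
    linarith
  · rw [← he] at hp
    have := hdisjR k' (hr hk') _ (hl hn₁) (Or.inr rfl) hp
    exact hnd k' (this ▸ hn₁) hk'
  · have := hRR _ _ _ hp hp'
    simp only at this
    linarith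
  · have := hRR _ _ _ hp hp'
    simp only at this
    linarith

end IsTrack

/-! ### The game -/

theorem eventually_add_right_iff {P : ℝ → Prop} (y : ℝ) :
    (∀ᶠ ε in 𝓝[>] (0 : ℝ), P (y + ε)) ↔ ∀ᶠ z in 𝓝[>] y, P z := by
  have : map (fun ε => y + ε) (𝓝[>] (0 : ℝ)) = 𝓝[>] y := by
    rw [map_add_left_nhdsGT, add_zero]
  rw [← this, eventually_map]

theorem eventually_left_iff {P : ℝ → Prop} (y : ℝ) :
    (∀ᶠ z in 𝓝[<] y, P z) ↔ ∀ᶠ z in 𝓝[>] (-y), P (-z) := by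
  have h1 : Tendsto Neg.neg (𝓝[>] (-y)) (𝓝[<] y) := tendsto_neg_nhdsGT_neg
  have h2 : Tendsto Neg.neg (𝓝[<] y) (𝓝[>] (-y)) := tendsto_neg_nhdsLT
  refine ⟨fun h => h1.eventually h, fun h => ?_⟩
  simpa only [neg_neg] using h2.eventually h

/-- A function decreases immediately to the right exactly if its derivative is negative there,
provided that the derivative has a sign there. -/
theorem eventually_lt_iff_of_sign {d f : ℝ → ℝ} (hd : ∀ z, HasDerivAt d (2 * f z) z) {y : ℝ}
    (hf : (∀ᶠ z in 𝓝[>] y, f z < 0) ∨ ∀ᶠ z in 𝓝[>] y, 0 < f z) :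
    (∀ᶠ z in 𝓝[>] y, d z < d y) ↔ ∀ᶠ z in 𝓝[>] y, f z < 0 := by
  have main : ∀ {d f : ℝ → ℝ}, (∀ z, HasDerivAt d (2 * f z) z) → (∀ᶠ z in 𝓝[>] y, f z < 0) →
      ∀ᶠ z in 𝓝[>] y, d z < d y := by
    intro d f hd h
    obtain ⟨b, hb, hsub⟩ := (mem_nhdsGT_iff_exists_Ioo_subset (a := y)).mp h
    filter_upwards [Ioo_mem_nhdsGT hb] with z hz
    refine lt_of_hasDerivAt_neg hd hz.1 fun w hw => ?_
    have : f w < 0 := hsub ⟨hw.1, hw.2.trans hz.2⟩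
    linarith
  refine ⟨fun h => hf.resolve_right fun hpos => ?_, main hd⟩
  have := main (d := fun z => -d z) (f := fun z => -f z)
    (fun z => (hd z).neg.congr_deriv (by ring)) (hpos.mono fun z hz => neg_lt_zero.mpr hz)
  obtain ⟨z, h1, h2⟩ := (h.and this).exists
  linarith

namespace IsFoldFamily

variable {F Fx Fy Fyy : ℝ → ℝ → ℝ}

theorem eventually_neg_of_fold (h : IsFoldFamily F Fx Fy Fyy) {x y : ℝ} (h0 : F x y = 0)
    (hy : Fy x y = 0) (hyy : Fyy x y < 0) : ∀ᶠ z in 𝓝[≠] y, F x z < 0 :=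
  eventually_neg_of_hasDerivAt_neg (h.deriv_y x) (h.deriv_yy x y) h0 hy hyy

theorem eventually_pos_of_fold (h : IsFoldFamily F Fx Fy Fyy) {x y : ℝ} (h0 : F x y = 0)
    (hy : Fy x y = 0) (hyy : 0 < Fyy x y) : ∀ᶠ z in 𝓝[≠] y, 0 < F x z :=
  (eventually_neg_of_hasDerivAt_neg (f := fun z => -F x z) (g := fun z => -Fy x z)
    (fun z => (h.deriv_y x z).neg) (h.deriv_yy x y).neg (by simp [h0]) (by simp [hy])
    (neg_lt_zero.mpr hyy)).mono fun _ hz => neg_lt_zero.mp hz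

/-- A zero has nonzero slope or is a nondegenerate extremum, so F x has a strict sign on each side
of every point. Hence the wishes of the puppy reduce to one-sided signs of the pull. -/
theorem sign_right (h : IsFoldFamily F Fx Fy Fyy) (x y : ℝ) :
    (∀ᶠ z in 𝓝[>] y, F x z < 0) ∨ ∀ᶠ z in 𝓝[>] y, 0 < F x z := by
  have hgt : 𝓝[>] y ≤ 𝓝[≠] y := nhdsWithin_mono _ fun z hz => ne_of_gt hz
  have hc := (h.continuous_right x).continuousAt (x := y)
  rcases lt_trichotomy (F x y) 0 with h0 | h0 | h0
  · exact Or.inl (mem_nhdsWithin_of_mem_nhds (hc.eventually_lt continuousAt_const h0))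
  · rcases lt_trichotomy (Fy x y) 0 with hy | hy | hy
    · have := (eventually_sign_of_hasDerivAt_pos (f := fun z => -F x z) (h.deriv_y x y).neg
        (by simp [h0]) (neg_pos.mpr hy)).1
      exact Or.inl (this.mono fun z hz => neg_pos.mp hz)
    · rcases lt_or_gt_of_ne (h.generic _ _ h0 hy).2 with hyy | hyy
      · exact Or.inl ((h.eventually_neg_of_fold h0 hy hyy).filter_mono hgt)
      · exact Or.inr ((h.eventually_pos_of_fold h0 hy hyy).filter_mono hgt)
    · exact Or.inr (eventually_sign_of_hasDerivAt_pos (h.deriv_y x y) h0 hy).1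
  · exact Or.inr (mem_nhdsWithin_of_mem_nhds (continuousAt_const.eventually_lt hc h0))

theorem sign_left (h : IsFoldFamily F Fx Fy Fyy) (x y : ℝ) :
    (∀ᶠ z in 𝓝[<] y, 0 < F x z) ∨ ∀ᶠ z in 𝓝[<] y, F x z < 0 := by
  rw [eventually_left_iff, eventually_left_iff]
  exact (h.reflect_y.sign_right x (-y)).imp (fun h => h.mono fun z hz => neg_lt_zero.mp hz)
    fun h => h.mono fun z hz => neg_pos.mp hz

/-- The zeros at which `F x` changes sign from negative to positive are nondegenerate. -/
theorem increasing_zero_iff (h : IsFoldFamily F Fx Fy Fyy) (x y : ℝ) :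
    ((∀ᶠ z in 𝓝[<] y, F x z < 0) ∧ ∀ᶠ z in 𝓝[>] y, 0 < F x z) ↔ F x y = 0 ∧ 0 < Fy x y := by
  have hgt : 𝓝[>] y ≤ 𝓝[≠] y := nhdsWithin_mono _ fun z hz => ne_of_gt hz
  have hlt : 𝓝[<] y ≤ 𝓝[≠] y := nhdsWithin_mono _ fun z hz => ne_of_lt hz
  have hc := (h.continuous_right x).continuousAt (x := y)
  constructor
  · rintro ⟨hl, hr⟩
    have h0 : F x y = 0 := by
      refine le_antisymm ?_ ?_
      · exact le_of_tendsto (hc.mono_left nhdsWithin_le_nhds) (hl.mono fun z hz => hz.le)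
      · exact ge_of_tendsto (hc.mono_left nhdsWithin_le_nhds) (hr.mono fun z hz => hz.le)
    refine ⟨h0, ?_⟩
    by_contra! hle
    rcases hle.lt_or_eq with hy | hy
    · have := (eventually_sign_of_hasDerivAt_pos (f := fun z => -F x z) (h.deriv_y x y).neg
        (by simp [h0]) (neg_pos.mpr hy)).1
      obtain ⟨z, h1, h2⟩ := (this.and hr).exists
      linarith
    · rcases lt_or_gt_of_ne (h.generic _ _ h0 hy).2 with hyy | hyy
      · have := (h.eventually_neg_of_fold h0 hy hyy).filter_mono hgt
        obtain ⟨z, h1, h2⟩ := (this.and hr).exists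
        linarith
      · have := (h.eventually_pos_of_fold h0 hy hyy).filter_mono hlt
        obtain ⟨z, h1, h2⟩ := (this.and hl).exists
        linarith
  · rintro ⟨h0, hy⟩
    exact (eventually_sign_of_hasDerivAt_pos (h.deriv_y x y) h0 hy).symm

end IsFoldFamily

/-- A forward run from `y` to `y'`, in terms of the pull. -/
def RunsForward (f : ℝ → ℝ) (y y' : ℝ) : Prop :=
  y < y' ∧ (∀ z ∈ Ico y y', ∀ᶠ w in 𝓝[>] z, f w < 0) ∧ ¬ ∀ᶠ w in 𝓝[>] y', f w < 0

/-- A backward run from `y` to `y'`, in terms of the pull. -/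
def RunsBackward (f : ℝ → ℝ) (y y' : ℝ) : Prop :=
  y' < y ∧ (∀ z ∈ Ioc y' y, ∀ᶠ w in 𝓝[<] z, 0 < f w) ∧ ¬ ∀ᶠ w in 𝓝[<] y', 0 < f w

theorem runsBackward_iff {f : ℝ → ℝ} {y y' : ℝ} :
    RunsBackward f y y' ↔ RunsForward (fun z => -f (-z)) (-y) (-y') := by
  simp only [RunsBackward, RunsForward, neg_lt_neg_iff, eventually_left_iff, Left.neg_neg_iff]
  refine and_congr_right fun _ => and_congr_left fun _ => ⟨fun h z hz => ?_, fun h z hz => ?_⟩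
  · have := h (-z) ⟨by linarith [hz.2], by linarith [hz.1]⟩
    rwa [neg_neg] at this
  · exact h (-z) ⟨by linarith [hz.2], by linarith [hz.1]⟩

/-- Every point with f > 0 stops the puppy. The infimum of the stopping points is a stopping point
itself, because the wish to run persists for a while to the right. -/
theorem exists_runsForward {f : ℝ → ℝ} {y : ℝ} (hy : ∀ᶠ w in 𝓝[>] y, f w < 0)
    (hf : Continuous f) (hpos : ∃ z > y, 0 < f z) : ∃ y', RunsForward f y y' := by
  obtain ⟨z₀, hz₀, hfz₀⟩ := hpos
  let E : Set ℝ := {z | y ≤ z ∧ ¬ ∀ᶠ w in 𝓝[>] z, f w < 0}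
  have hEz : z₀ ∈ E := ⟨hz₀.le, fun h => by
    have : ∀ᶠ w in 𝓝[>] z₀, 0 < f w :=
      mem_nhdsWithin_of_mem_nhds (continuousAt_const.eventually_lt hf.continuousAt hfz₀)
    obtain ⟨w, h1, h2⟩ := (h.and this).exists
    linarith⟩
  have hbdd : BddBelow E := ⟨y, fun z hz => hz.1⟩
  have hle : y ≤ sInf E := le_csInf ⟨z₀, hEz⟩ fun z hz => hz.1
  have hnot : ¬ ∀ᶠ w in 𝓝[>] (sInf E), f w < 0 := by
    intro h
    obtain ⟨b, hb, hsub⟩ := (mem_nhdsGT_iff_exists_Ioo_subset (a := sInf E)).mp h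
    obtain ⟨z, hzE, hzb⟩ := exists_lt_of_csInf_lt ⟨z₀, hEz⟩ hb
    rcases (csInf_le hbdd hzE).eq_or_lt with he | hlt
    · exact hzE.2 (he ▸ h)
    · exact hzE.2 (mem_of_superset (Ioo_mem_nhdsGT hzb) fun w hw => hsub ⟨hlt.trans hw.1, hw.2⟩)
  refine ⟨sInf E, lt_of_le_of_ne hle fun he => hnot (he ▸ hy), fun z hz => ?_, hnot⟩
  by_contra hn
  exact absurd (csInf_le hbdd ⟨hz.1, hn⟩) (not_le.mpr hz.2)

theorem RunsForward.nonpos {f : ℝ → ℝ} {y y' : ℝ} (h : RunsForward f y y') (hf : Continuous f) :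
    ∀ z ∈ Icc y y', f z ≤ 0 := by
  have hmain : ∀ z ∈ Ico y y', f z ≤ 0 := fun z hz =>
    le_of_tendsto (hf.continuousAt.mono_left nhdsWithin_le_nhds)
      ((h.2.1 z hz).mono fun w hw => hw.le)
  intro z hz
  rcases hz.2.eq_or_lt with rfl | hlt
  · have ht : Tendsto f (𝓝[<] z) (𝓝 (f z)) := hf.continuousAt.mono_left nhdsWithin_le_nhds
    refine le_of_tendsto ht ?_
    filter_upwards [Ioo_mem_nhdsLT h.1] with w hw
    exact hmain w ⟨hw.1.le, hw.2⟩
  · exact hmain z ⟨hz.1, hlt⟩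

namespace IsFoldFamily

variable {F Fx Fy Fyy : ℝ → ℝ → ℝ}

/-- The pull is negative just before the landing and positive just after it; a fold does not change
sign, so the landing is nondegenerate and stable. -/
theorem runsForward_landing (h : IsFoldFamily F Fx Fy Fyy) {x y y' : ℝ}
    (hr : RunsForward (F x) y y') :
    F x y' = 0 ∧ 0 < Fy x y' ∧ ∀ z ∈ Icc y y', F x z ≤ 0 := by
  have hnp := hr.nonpos (h.continuous_right x)
  have := (h.increasing_zero_iff x y').mp
    ⟨(h.sign_left x y').resolve_left fun hp => ?_, (h.sign_right x y').resolve_left hr.2.2⟩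
  · exact ⟨this.1, this.2, hnp⟩
  · obtain ⟨w, h1, h2⟩ := (hp.and (Ioo_mem_nhdsLT hr.1)).exists
    linarith [hnp w ⟨h2.1.le, h2.2.le⟩]

theorem runsBackward_landing (h : IsFoldFamily F Fx Fy Fyy) {x y y' : ℝ}
    (hr : RunsBackward (F x) y y') :
    F x y' = 0 ∧ 0 < Fy x y' ∧ ∀ z ∈ Icc y' y, 0 ≤ F x z := by
  obtain ⟨h1, h2, h3⟩ := h.reflect_y.runsForward_landing (runsBackward_iff.mp hr)
  simp only [neg_neg] at h1 h2
  refine ⟨neg_eq_zero.mp h1, h2, fun z hz => ?_⟩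
  have := h3 (-z) ⟨by linarith [hz.2], by linarith [hz.1]⟩
  rw [neg_neg] at this
  linarith

end IsFoldFamily

/-! ### The rules of the game in terms of the pull, and the winning strategy. -/

namespace IsTrack

variable {γ : ℝ → Plane}

theorem dist_lt_dist_iff (x y z : ℝ) :
    dist (γ x) (γ z) < dist (γ x) (γ y) ↔
      (γ z 0 - γ x 0) ^ 2 + (γ z 1 - γ x 1) ^ 2 < (γ y 0 - γ x 0) ^ 2 + (γ y 1 - γ x 1) ^ 2 := by
  have hd : ∀ w, dist (γ x) (γ w) ^ 2 = (γ w 0 - γ x 0) ^ 2 + (γ w 1 - γ x 1) ^ 2 := fun w => by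
    rw [dist_comm, dist_eq_norm, norm_sq_plane]
    simp
  rw [← hd, ← hd, sq_lt_sq₀ dist_nonneg dist_nonneg]

theorem hasDerivAt_sq_dist (h : IsTrack γ) (x y : ℝ) :
    HasDerivAt (fun z => (γ z 0 - γ x 0) ^ 2 + (γ z 1 - γ x 1) ^ 2) (2 * pull γ x y) y := by
  have d0 := hasDerivAt_coord (h.hasDerivAt y)
  exact ((((d0 0).sub_const (γ x 0)).pow 2).add (((d0 1).sub_const (γ x 1)).pow 2)).congr_deriv
    (by simp only [pull]; push_cast; ring)

theorem wantsForward_iff (h : IsTrack γ) (hgen : TransverseToEvolute γ) (x y : ℝ) :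
    WantsForward γ x y ↔ ∀ᶠ z in 𝓝[>] y, pull γ x z < 0 := by
  rw [WantsForward, eventually_add_right_iff (P := fun z => dist (γ x) (γ z) < dist (γ x) (γ y))]
  simp only [dist_lt_dist_iff]
  exact eventually_lt_iff_of_sign (h.hasDerivAt_sq_dist x)
    ((h.isFoldFamily hgen).sign_right x y)

theorem wantsBackward_iff (h : IsTrack γ) (hgen : TransverseToEvolute γ) (x y : ℝ) :
    WantsBackward γ x y ↔ ∀ᶠ z in 𝓝[<] y, 0 < pull γ x z := by
  have e : (∀ᶠ ε in 𝓝[>] (0 : ℝ), dist (γ x) (γ (y - ε)) < dist (γ x) (γ y)) ↔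
      ∀ᶠ z in 𝓝[>] (-y), dist (γ x) (γ (-z)) < dist (γ x) (γ y) := by
    rw [← eventually_add_right_iff (P := fun z => dist (γ x) (γ (-z)) < dist (γ x) (γ y))]
    simp only [neg_add, neg_neg, sub_eq_add_neg]
  rw [WantsBackward, e, eventually_left_iff]
  simp only [dist_lt_dist_iff]
  have := eventually_lt_iff_of_sign (y := -y)
    (d := fun z => (γ (-z) 0 - γ x 0) ^ 2 + (γ (-z) 1 - γ x 1) ^ 2) (f := fun z => -pull γ x (-z))
    (fun z => ((h.hasDerivAt_sq_dist x (-z)).comp z (hasDerivAt_neg z)).congr_deriv (by ring))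
    ((h.isFoldFamily hgen).reflect_y.sign_right x (-y))
  simpa only [neg_neg, Left.neg_neg_iff] using this

theorem stable_iff (h : IsTrack γ) (hgen : TransverseToEvolute γ) (x y : ℝ) :
    Stable γ x y ↔ pull γ x y = 0 ∧ 0 < pullY γ x y := by
  have hF := h.isFoldFamily hgen
  rw [← hF.increasing_zero_iff, Stable, h.wantsForward_iff hgen, h.wantsBackward_iff hgen]
  constructor
  · rintro ⟨h1, h2⟩
    exact ⟨(hF.sign_left x y).resolve_left h2, (hF.sign_right x y).resolve_left h1⟩
  · rintro ⟨h1, h2⟩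
    refine ⟨fun h3 => ?_, fun h3 => ?_⟩
    · obtain ⟨z, h4, h5⟩ := (h2.and h3).exists
      linarith
    · obtain ⟨z, h4, h5⟩ := (h1.and h3).exists
      linarith

theorem runs_iff (h : IsTrack γ) (hgen : TransverseToEvolute γ) (x y y' : ℝ) :
    Runs γ x y y' ↔ RunsForward (pull γ x) y y' ∨ RunsBackward (pull γ x) y y' := by
  simp only [Runs, RunsForward, RunsBackward, h.wantsForward_iff hgen, h.wantsBackward_iff hgen]

theorem pull_add_int (h : IsTrack γ) (x y : ℝ) (n : ℤ) : pull γ x (y + n) = pull γ x y := by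
  simpa using (h.periodic_pull x).int_mul n y

theorem pullY_add_int (h : IsTrack γ) (x y : ℝ) (n : ℤ) : pullY γ x (y + n) = pullY γ x y := by
  simpa using (h.periodic_pullY x).int_mul n y

theorem eventually_nhdsGT_add_int (h : IsTrack γ) (x y : ℝ) (n : ℤ) {Q : ℝ → Prop} :
    (∀ᶠ z in 𝓝[>] (y + n), Q (pull γ x z)) ↔ ∀ᶠ z in 𝓝[>] y, Q (pull γ x z) := by
  rw [← eventually_add_right_iff (P := fun z => Q (pull γ x z)),
    ← eventually_add_right_iff (P := fun z => Q (pull γ x z))]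
  simp only [add_right_comm y (n : ℝ), h.pull_add_int]

theorem eventually_nhdsLT_add_int (h : IsTrack γ) (x y : ℝ) (n : ℤ) {Q : ℝ → Prop} :
    (∀ᶠ z in 𝓝[<] (y + n), Q (pull γ x z)) ↔ ∀ᶠ z in 𝓝[<] y, Q (pull γ x z) := by
  rw [eventually_left_iff, eventually_left_iff,
    ← eventually_add_right_iff (P := fun z => Q (pull γ x (-z))),
    ← eventually_add_right_iff (P := fun z => Q (pull γ x (-z)))]
  have : ∀ ε : ℝ, -(-(y + n) + ε) = -(-y + ε) + n := fun ε => by ring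
  simp only [this, h.pull_add_int]

theorem exists_run_forward (h : IsTrack γ) (hgen : TransverseToEvolute γ) {x y : ℝ}
    (hy : ∀ᶠ z in 𝓝[>] y, pull γ x z < 0) : ∃ y', RunsForward (pull γ x) y y' := by
  obtain ⟨δ, hδ, -, hpos, -⟩ := h.exists_strip hgen
  refine exists_runsForward hy ((h.isFoldFamily hgen).continuous_right x) ?_
  obtain ⟨n, hn⟩ := exists_int_gt (y - x)
  refine ⟨x + δ + n, by linarith, ?_⟩
  rw [h.pull_add_int]
  exact hpos _ _ (by linarith) le_rfl

theorem exists_run_backward (h : IsTrack γ) (hgen : TransverseToEvolute γ) {x y : ℝ}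
    (hy : ∀ᶠ z in 𝓝[<] y, 0 < pull γ x z) : ∃ y', RunsBackward (pull γ x) y y' := by
  obtain ⟨δ, hδ, -, -, hneg⟩ := h.exists_strip hgen
  rw [eventually_left_iff] at hy
  obtain ⟨y', hy'⟩ := exists_runsForward (f := fun z => -pull γ x (-z)) (y := -y)
    (hy.mono fun z hz => neg_lt_zero.mpr hz)
    (((h.isFoldFamily hgen).continuous_right x).comp continuous_neg).neg (by
      obtain ⟨n, hn⟩ := exists_int_lt (y - x - 1)
      refine ⟨-(x + 1 - δ + n), by linarith, ?_⟩
      rw [neg_neg, h.pull_add_int]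
      exact neg_pos.mpr (hneg _ _ le_rfl (by linarith)))
  exact ⟨-y', runsBackward_iff.mpr (by rwa [neg_neg])⟩

/-- Two continuous followers of the same walk agree. -/
theorem eqOn_of_follow {F Fx Fy Fyy : ℝ → ℝ → ℝ} (hF : IsFoldFamily F Fx Fy Fyy) {T : ℝ}
    {X Y Z : ℝ → ℝ} (hX : Continuous X) (hY : ContinuousOn Y (Icc 0 T))
    (hZ : ContinuousOn Z (Icc 0 T)) (h0 : Y 0 = Z 0)
    (hYs : ∀ t ∈ Ico 0 T, F (X t) (Y t) = 0 ∧ 0 < Fy (X t) (Y t))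
    (hZs : ∀ t ∈ Ico 0 T, F (X t) (Z t) = 0) : EqOn Y Z (Icc 0 T) := by
  -- The times of agreement form a closed set. Near a common position F is strictly increasing in y,
  -- so two nearby zeros over the same human position coincide and agreement extends to the right.
  have hsub : Icc 0 T ⊆ {t | Y t = Z t} := by
    refine IsClosed.Icc_subset_of_forall_mem_nhdsWithin ?_ h0 ?_
    · have := (hY.sub hZ).preimage_isClosed_of_isClosed isClosed_Icc (isClosed_singleton (x := 0))
      convert this using 1
      ext t
      simp [sub_eq_zero, and_comm]
    · rintro t ⟨ht, htI⟩
      obtain ⟨δ, hδ, -, hbox⟩ := IsFoldFamily.exists_box (P := fun x y => 0 < Fy x y)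
        (continuousAt_const.eventually_lt hF.cont_y.continuousAt (hYs t htI).2) one_pos
      have hle : 𝓝[>] t ≤ 𝓝[Icc 0 T] t := by
        rw [← nhdsWithin_Ioc_eq_nhdsGT htI.2]
        exact nhdsWithin_mono _ fun s hs => ⟨htI.1.trans hs.1.le, hs.2⟩
      have hYt : Tendsto Y (𝓝[>] t) (𝓝 (Y t)) := (hY t ⟨htI.1, htI.2.le⟩).mono_left hle
      have hZt : Tendsto Z (𝓝[>] t) (𝓝 (Y t)) := by
        have : Y t = Z t := ht
        rw [this]
        exact (hZ t ⟨htI.1, htI.2.le⟩).mono_left hle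
      have hXt : Tendsto X (𝓝[>] t) (𝓝 (X t)) := hX.continuousAt.mono_left nhdsWithin_le_nhds
      have hnb : ∀ a : ℝ, Icc (a - δ) (a + δ) ∈ 𝓝 a := fun a =>
        Icc_mem_nhds (by linarith) (by linarith)
      filter_upwards [hYt (hnb _), hZt (hnb _), hXt (hnb _), Ioo_mem_nhdsGT htI.2] with s h1 h2 h3 h4
      have hs : s ∈ Ico 0 T := ⟨htI.1.trans h4.1.le, h4.2⟩
      have hYz := (hYs s hs).1
      have hZz := hZs s hs
      have hmono : ∀ a ∈ Icc (Y t - δ) (Y t + δ), ∀ b ∈ Icc (Y t - δ) (Y t + δ), a < b →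
          F (X s) a < F (X s) b := fun a ha b hb hab =>
        lt_of_hasDerivAt_pos (hF.deriv_y (X s)) hab fun w hw =>
          hbox _ h3 w ⟨ha.1.trans hw.1.le, hw.2.le.trans hb.2⟩
      rcases lt_trichotomy (Y s) (Z s) with hlt | heq | hlt
      · linarith [hmono _ h1 _ h2 hlt]
      · exact heq
      · linarith [hmono _ h2 _ h1 hlt]
  exact hsub

/-- The human can walk along an arc of stable configurations. -/
theorem canCatch_of_arc (h : IsTrack γ) (hgen : TransverseToEvolute γ) {p q : ℝ × ℝ} (n : ℤ)
    (harc : IsFoldFamily.Arc (pull γ) (pullY γ) p q) (hq : CanCatch γ q.1 (q.2 + n)) :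
    CanCatch γ p.1 (p.2 + n) := by
  have hF := h.isFoldFamily hgen
  obtain ⟨s, hsc, hsp, hsq, hs⟩ := harc
  by_cases hpq : p.1 = q.1
  · rw [← hsp, hpq, hsq]
    exact hq
  obtain ⟨σ, hσ, hσT⟩ : ∃ σ : ℝ, |σ| = 1 ∧ p.1 + σ * |q.1 - p.1| = q.1 := by
    rcases le_total p.1 q.1 with hle | hle
    · exact ⟨1, by simp, by rw [abs_of_nonneg (by linarith)]; ring⟩
    · exact ⟨-1, by simp, by rw [abs_of_nonpos (by linarith)]; ring⟩
  have hσ0 : σ ≠ 0 := by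
    rintro rfl
    simp at hσ
  set T := |q.1 - p.1| with hT
  have hT0 : 0 < T := abs_pos.mpr (sub_ne_zero.mpr (Ne.symm hpq))
  let X : ℝ → ℝ := fun t => p.1 + σ * t
  have hX : Continuous X := by fun_prop
  have hX0 : X 0 = p.1 := by simp [X]
  have hXm : ∀ t ∈ Icc 0 T, X t ∈ uIcc p.1 q.1 := by
    intro t ht
    rw [← hσT]
    rcases (abs_eq (zero_le_one (α := ℝ))).mp hσ with rfl | rfl
    · rw [uIcc_of_le (by linarith)]
      exact ⟨by simp only [X]; linarith [ht.1], by simp only [X]; linarith [ht.2]⟩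
    · rw [uIcc_of_ge (by linarith)]
      exact ⟨by simp only [X]; linarith [ht.2], by simp only [X]; linarith [ht.1]⟩
  have hXne : ∀ t ∈ Ico 0 T, X t ≠ q.1 := by
    intro t ht he
    have : σ * t = σ * T := by
      simp only [X] at he
      linarith
    exact ht.2.ne (mul_left_cancel₀ hσ0 this)
  let Y : ℝ → ℝ := fun t => s (X t) + n
  have hY : ContinuousOn Y (Icc 0 T) :=
    (hsc.comp hX.continuousOn hXm).add continuousOn_const
  have hYs : ∀ t ∈ Ico 0 T, pull γ (X t) (Y t) = 0 ∧ 0 < pullY γ (X t) (Y t) := by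
    intro t ht
    obtain ⟨h1, h2⟩ := hs (X t) (hXm t ⟨ht.1, ht.2.le⟩)
    simp only [Y]
    rw [h.pull_add_int, h.pullY_add_int]
    exact ⟨h1, h2 (hXne t ht)⟩
  have hY0 : Y 0 = p.2 + n := by simp only [Y, hX0, hsp]
  -- The end of the arc may be a fold, which is not stable; stability is required only before time
  -- T.
  have hfol : Follows γ T X (p.2 + n) Y :=
    ⟨hY0, hY, fun t ht => (h.stable_iff hgen _ _).mpr (hYs t ht)⟩
  rw [← hX0]
  refine CanCatch.walk T hT0.le X (LipschitzOnWith.of_dist_le_mul fun t _ t' _ => ?_) _ ⟨Y, hfol⟩ ?_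
  · simp only [X, Real.dist_eq, NNReal.coe_one, one_mul]
    rw [add_sub_add_left_eq_sub, ← mul_sub, abs_mul, hσ, one_mul]
  · intro Z hZ
    have heq := eqOn_of_follow hF hX hY hZ.continuousOn (hY0.trans hZ.start.symm) hYs
      (fun t ht => ((h.stable_iff hgen _ _).mp (hZ.stable t ht)).1) ⟨hT0.le, le_rfl⟩
    have hXT : X T = q.1 := hσT
    rw [← heq]
    simp only [Y]
    rw [hXT, hsq]
    exact hq

/-- The stable configurations, with the puppy in the `n`-th turn, from which the human cannot
catch the puppy. -/
def lost (γ : ℝ → Plane) (n : ℤ) : Set (ℝ × ℝ) :=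
  {p | p.1 < p.2 ∧ p.2 < p.1 + 1 ∧ pull γ p.1 p.2 = 0 ∧ 0 < pullY γ p.1 p.2 ∧
    ¬ CanCatch γ p.1 (p.2 + n)}

theorem ne_of_not_canCatch (h : IsTrack γ) {x y : ℝ} (n : ℤ)
    (hn : ¬ CanCatch γ x (y + n)) : y ≠ x ∧ y ≠ x + 1 := by
  have hper : γ (x + n) = γ x := by simpa using h.periodic.int_mul n x
  have hper1 : γ (x + 1 + n) = γ x := by
    have := h.periodic.int_mul (n + 1) x
    rw [← this]
    congr 1
    push_cast
    ring
  refine ⟨?_, ?_⟩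
  · rintro rfl
    exact hn (CanCatch.caught _ _ hper.symm)
  · rintro rfl
    exact hn (CanCatch.caught _ _ hper1.symm)

/-- A winning configuration makes every stable configuration with an arc leading to it winning. So
being lost spreads along arcs, passes to limits including folds, and survives at least one run from
a lost fold. -/
theorem isTrap_lost (h : IsTrack γ) (hgen : TransverseToEvolute γ) {n : ℤ} {δ : ℝ} (hδ : 0 < δ)
    (hpos : ∀ x y, x < y → y ≤ x + δ → 0 < pull γ x y)
    (hneg : ∀ x y, x + 1 - δ ≤ y → y < x + 1 → pull γ x y < 0) (hne : (lost γ n).Nonempty) :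
    IsTrap (pull γ) (pullY γ) (pullYY γ) (fun x => x + δ) (fun x => x + 1 - δ) (lost γ n) := by
  have hF := h.isFoldFamily hgen
  have hstrip : ∀ x y, x < y → y < x + 1 → pull γ x y = 0 → x + δ < y ∧ y < x + 1 - δ := by
    intro x y h1 h2 h0
    constructor
    · by_contra! hle
      exact (hpos x y h1 hle).ne' h0
    · by_contra! hle
      exact (hneg x y hle h2).ne h0
  have hcl : ∀ p ∈ closure (lost γ n), pull γ p.1 p.2 = 0 ∧ p.1 < p.2 ∧ p.2 < p.1 + 1 := by
    intro p hp
    have hclosed : IsClosed {p : ℝ × ℝ | pull γ p.1 p.2 = 0 ∧ p.1 + δ ≤ p.2 ∧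
        p.2 ≤ p.1 + 1 - δ} :=
      (isClosed_eq hF.cont continuous_const).and ((isClosed_le (by fun_prop) (by fun_prop)).and
        (isClosed_le (by fun_prop) (by fun_prop)))
    obtain ⟨h1, h2, h3⟩ := closure_minimal (fun q hq => by
      obtain ⟨h1, h2⟩ := hstrip _ _ hq.1 hq.2.1 hq.2.2.1
      exact ⟨hq.2.2.1, h1.le, h2.le⟩) hclosed hp
    exact ⟨h1, by linarith, by linarith⟩
  -- a limit of lost configurations that is reached by an arc is lost
  have hlim : ∀ p ∈ closure (lost γ n), ¬ CanCatch γ p.1 (p.2 + n) := by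
    intro p hp hcatch
    obtain ⟨h0, -⟩ := hcl p hp
    have hy0 : 0 ≤ pullY γ p.1 p.2 := closure_minimal (fun q hq => hq.2.2.2.1.le)
      (isClosed_le continuous_const hF.cont_y) hp
    have harc : ∀ᶠ q in 𝓝 p, pull γ q.1 q.2 = 0 → 0 < pullY γ q.1 q.2 →
        IsFoldFamily.Arc (pull γ) (pullY γ) q p := by
      rcases hy0.lt_or_eq with hy | hy
      · exact (hF.eventually_arc_of_regular h0 hy).mono fun q hq hq0 _ => (hq hq0).1
      · exact hF.eventually_arc_of_fold h0 hy.symm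
    obtain ⟨q, hq1, hq2⟩ := mem_closure_iff_nhds.mp hp _ harc
    exact hq2.2.2.2.2 (h.canCatch_of_arc hgen n (hq1 hq2.2.2.1 hq2.2.2.2.1) hcatch)
  refine ⟨by fun_prop, by fun_prop, fun x => hpos _ _ (by linarith) le_rfl,
    fun x => hneg _ _ le_rfl (by linarith), fun p hp => ?_, fun p hp => ?_, fun p hp hy => ?_,
    fun p hp hy hyy => ?_, fun p hp hy hyy => ?_, hne⟩
  · exact ⟨hp.2.2.1, hp.2.2.2.1, hstrip _ _ hp.1 hp.2.1 hp.2.2.1⟩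
  · filter_upwards [hF.eventually_arc_of_regular hp.2.2.1 hp.2.2.2.1,
      continuousAt_const.eventually_lt hF.cont_y.continuousAt hp.2.2.2.1,
      continuous_fst.continuousAt.eventually_lt continuous_snd.continuousAt hp.1,
      continuous_snd.continuousAt.eventually_lt
        (continuous_fst.add continuous_const).continuousAt hp.2.1] with q h1 h2 h3 h4 hq0
    exact ⟨h3, h4, hq0, h2, fun hc => hp.2.2.2.2 (h.canCatch_of_arc hgen n (h1 hq0).2 hc)⟩
  · obtain ⟨h0, h1, h2⟩ := hcl p hp
    exact ⟨h1, h2, h0, hy, hlim p hp⟩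
  · obtain ⟨h0, h1, h2⟩ := hcl p hp
    obtain ⟨x, y⟩ := p
    simp only at hy hyy h0 h1 h2
    have hev := hF.eventually_neg_of_fold h0 hy hyy
    have hright := (h.eventually_nhdsGT_add_int x y n (Q := fun w => w < 0)).mpr
      (hev.filter_mono (nhdsWithin_mono _ fun z hz => ne_of_gt hz))
    have hleft := (h.eventually_nhdsLT_add_int x y n (Q := fun w => w < 0)).mpr
      (hev.filter_mono (nhdsWithin_mono _ fun z hz => ne_of_lt hz))
    obtain ⟨Y, hY⟩ := h.exists_run_forward hgen hright
    obtain ⟨y', hrun, hlost⟩ : ∃ y', Runs γ x (y + n) y' ∧ ¬ CanCatch γ x y' := by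
      by_contra! hall
      exact hlim _ hp (CanCatch.run _ _ ⟨Y, (h.runs_iff hgen _ _ _).mpr (Or.inl hY)⟩ hall)
    -- The pull is negative on both sides of this fold, so a backward run is impossible.
    rcases (h.runs_iff hgen _ _ _).mp hrun with hr | hr
    swap
    · obtain ⟨w, h3, h4⟩ := ((hr.2.1 (y + n) ⟨hr.1, le_rfl⟩).and hleft).exists
      linarith
    obtain ⟨g0, gy, gn⟩ := hF.runsForward_landing hr
    obtain ⟨z, rfl⟩ : ∃ z, y' = z + n := ⟨y' - n, by ring⟩
    rw [h.pull_add_int] at g0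
    rw [h.pullY_add_int] at gy
    have hyz : y < z := by linarith [hr.1]
    have gn' : ∀ w ∈ Icc y z, pull γ x w ≤ 0 := fun w hw => by
      rw [← h.pull_add_int x w n]
      exact gn _ ⟨by linarith [hw.1], by linarith [hw.2]⟩
    refine ⟨z, hyz, ⟨by simp only; linarith, ?_, g0, gy, hlost⟩, gn'⟩
    by_contra! hle
    have hlt : x + 1 < z := lt_of_le_of_ne hle (h.ne_of_not_canCatch n hlost).2.symm
    -- A run past x + 1 would pass the human, just beyond whom the pull is positive.
    have hm : 0 < min δ (z - (x + 1)) := lt_min hδ (by linarith)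
    have h5 := hpos x (x + min δ (z - (x + 1))) (by linarith) (by linarith [min_le_left δ (z - (x + 1))])
    rw [← h.periodic_pull x] at h5
    linarith [gn' (x + min δ (z - (x + 1)) + 1)
      ⟨by linarith, by linarith [min_le_right δ (z - (x + 1))]⟩]
  · obtain ⟨h0, h1, h2⟩ := hcl p hp
    obtain ⟨x, y⟩ := p
    simp only at hy hyy h0 h1 h2
    have hev := hF.eventually_pos_of_fold h0 hy hyy
    have hright := (h.eventually_nhdsGT_add_int x y n (Q := fun w => 0 < w)).mpr
      (hev.filter_mono (nhdsWithin_mono _ fun z hz => ne_of_gt hz))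
    have hleft := (h.eventually_nhdsLT_add_int x y n (Q := fun w => 0 < w)).mpr
      (hev.filter_mono (nhdsWithin_mono _ fun z hz => ne_of_lt hz))
    obtain ⟨Y, hY⟩ := h.exists_run_backward hgen hleft
    obtain ⟨y', hrun, hlost⟩ : ∃ y', Runs γ x (y + n) y' ∧ ¬ CanCatch γ x y' := by
      by_contra! hall
      exact hlim _ hp (CanCatch.run _ _ ⟨Y, (h.runs_iff hgen _ _ _).mpr (Or.inr hY)⟩ hall)
    rcases (h.runs_iff hgen _ _ _).mp hrun with hr | hr
    · obtain ⟨w, h3, h4⟩ := ((hr.2.1 (y + n) ⟨le_rfl, hr.1⟩).and hright).exists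
      linarith
    obtain ⟨g0, gy, gn⟩ := hF.runsBackward_landing hr
    obtain ⟨z, rfl⟩ : ∃ z, y' = z + n := ⟨y' - n, by ring⟩
    rw [h.pull_add_int] at g0
    rw [h.pullY_add_int] at gy
    have hyz : z < y := by linarith [hr.1]
    have gn' : ∀ w ∈ Icc z y, 0 ≤ pull γ x w := fun w hw => by
      rw [← h.pull_add_int x w n]
      exact gn _ ⟨by linarith [hw.1], by linarith [hw.2]⟩
    refine ⟨z, hyz, ⟨?_, by simp only; linarith, g0, gy, hlost⟩, gn'⟩
    by_contra! hle
    have hlt : z < x := lt_of_le_of_ne hle (h.ne_of_not_canCatch n hlost).1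
    have hm : 0 < min δ (x - z) := lt_min hδ (by linarith)
    have h5 := hneg x (x - min δ (x - z) + 1) (by linarith [min_le_left δ (x - z)]) (by linarith)
    rw [h.periodic_pull x] at h5
    linarith [gn' (x - min δ (x - z)) ⟨by linarith [min_le_right δ (x - z)], by linarith⟩]

/-- Every stable configuration can be won. -/
theorem canCatch_of_stable (h : IsTrack γ) (hgen : TransverseToEvolute γ) {x y : ℝ}
    (h0 : pull γ x y = 0) (hy : 0 < pullY γ x y) : CanCatch γ x y := by
  by_contra hlost
  have hF := h.isFoldFamily hgen
  obtain ⟨δ, hδ, hδ1, hpos, hneg⟩ := h.exists_strip hgen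
  -- The shift by n turns brings the puppy into the strip; the boundary case y - n = x is already a
  -- catch.
  let n : ℤ := ⌊y - x⌋
  have hne : (lost γ n).Nonempty := by
    have e : y - n + n = y := by ring
    have hlost' : ¬ CanCatch γ x (y - n + n) := by rwa [e]
    refine ⟨(x, y - n), lt_of_le_of_ne ?_ (h.ne_of_not_canCatch n hlost').1.symm, ?_, ?_, ?_, hlost'⟩
    · have := Int.floor_le (y - x)
      simp only [n]
      linarith
    · have := Int.lt_floor_add_one (y - x)
      simp only [n]
      linarith
    · rw [← h.pull_add_int x _ n, e]
      exact h0
    · rw [← h.pullY_add_int x _ n, e]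
      exact hy
  have htrap := h.isTrap_lost hgen hδ hpos hneg hne
  obtain ⟨O₀, O₁, xs, hfar, hcrit, hfold⟩ := h.exists_farthest hgen
  have hfold' : ∀ x, x = xs ∨ x = xs + 1 → ∀ y, pull γ x y = 0 → pullY γ x y ≠ 0 := by
    rintro x (rfl | rfl) y
    · exact hfold y
    · rw [h.pull_add_one_left, h.pullY_add_one_left]
      exact hfold y
  obtain ⟨a₁, a₂, ha₁, ha₂, hJa⟩ :=
    htrap.exists_barrier hF (show xs ≤ xs + 1 by linarith) hfold'
  obtain ⟨b₁, b₂, hb₁, hb₂, hJb⟩ :=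
    htrap.exists_upper_barrier hF (show xs ≤ xs + 1 by linarith) hfold'
  obtain ⟨l₁, hl₁⟩ := htrap.fiber_nonempty hF xs
  obtain ⟨l₂, hl₂⟩ := htrap.fiber_nonempty hF (xs + 1)
  -- A point of L over each end of the turn lies between the barriers and so puts them in the right
  -- order there.
  refine h.not_opposite_barriers hgen hfar hcrit hδ hδ1 hpos hJa.source_mem.1 hJa.target_mem.1
    ((ha₁ _ hl₁).trans (hb₁ _ hl₁)) ((ha₂ _ hl₂).trans (hb₂ _ hl₂)) (hJa.mono ?_) (hJb.mono ?_)
  · rintro p ⟨h1, h2, h3, h4⟩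
    exact ⟨⟨h4.1, h4.2, by linarith, by linarith⟩, h3⟩
  · rintro p ⟨h1, h2, h3, h4⟩
    exact ⟨⟨h4.1, h4.2, by linarith, by linarith⟩, h3⟩

theorem canCatch (h : IsTrack γ) (hgen : TransverseToEvolute γ) (x y : ℝ) : CanCatch γ x y := by
  have hF := h.isFoldFamily hgen
  by_cases hst : Stable γ x y
  · obtain ⟨h0, hy⟩ := (h.stable_iff hgen x y).mp hst
    exact h.canCatch_of_stable hgen h0 hy
  refine CanCatch.run x y ?_ fun y' hr => ?_
  · rw [Stable, not_and_or, not_not, not_not] at hst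
    rcases hst with hw | hw
    · obtain ⟨y', hy'⟩ := h.exists_run_forward hgen ((h.wantsForward_iff hgen x y).mp hw)
      exact ⟨y', (h.runs_iff hgen _ _ _).mpr (Or.inl hy')⟩
    · obtain ⟨y', hy'⟩ := h.exists_run_backward hgen ((h.wantsBackward_iff hgen x y).mp hw)
      exact ⟨y', (h.runs_iff hgen _ _ _).mpr (Or.inr hy')⟩
  · rcases (h.runs_iff hgen _ _ _).mp hr with hr | hr
    · obtain ⟨h0, hy, -⟩ := hF.runsForward_landing hr
      exact h.canCatch_of_stable hgen h0 hy
    · obtain ⟨h0, hy, -⟩ := hF.runsBackward_landing hr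
      exact h.canCatch_of_stable hgen h0 hy

end IsTrack

end Puppy

end

theorem mainTheorem2 (γ : ℝ → Plane) (hγ : Puppy.IsTrack γ)
    (hgen : Puppy.TransverseToEvolute γ) (x y : ℝ) : Puppy.CanCatch γ x y := by
  exact hγ.canCatch hgen x y
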